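/- Let $f:(\mathbb R^2,0)\to(\mathbb R^3,0)$ be a $C^\infty$ map-germ with $\operatorname{rank} df_0=1$. Let $\xi,\eta$ be $C^\infty$ vector fields defined near $0\in\mathbb R^2$ such that $\xi_0,\eta_0$ are linearly independent and $df_0(\eta_0)=0$. For a vector field $\zeta$ and a vector-valued function $g$, let $\zeta g$ denote the directional derivative of $g$ by $\zeta$, and put $$\varphi=\det(\xi f,\ \eta f,\ \eta\eta f).$$ Call two map-germs $f_1,f_2:(\mathbb R^2,0)\to(\mathbb R^3,0)$ $\mathcal A$-equivalent if there are germs of $C^\infty$-diffeomorphisms $d_s:(\mathbb R^2,0)\to(\mathbb R^2,0)$ and $d_t:(\mathbb R^3,0)\to(\mathbb R^3,0)$ with $d_t\circ f_1=f_2\circ d_s$. Then: (1) $f$ is $\mathcal A$-equivalent to the germ at $0$ of the Chen–Matumoto–Mond $-$ singularity $(x,y)\mapsto(x,\,y^2,\,y(x^2-y^2))$ if and only if $\varphi$ has a critical point at $0$ and $\det\operatorname{Hess}\varphi(0)>0$. (2) $f$ is $\mathcal A$-equivalent to the germ at $0$ of the Chen–Matumoto–Mond $+$ singularity $(x,y)\mapsto(x,\,y^2,\,y(x^2+y^2))$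 if and only if $\varphi$ has a critical point at $0$, $\det\operatorname{Hess}\varphi(0)<0$, and the two vectors $\xi f(0)$ and $\eta\eta f(0)$ are linearly independent. -/

import Mathlib

open Filter Topology
open scoped ContDiff

namespace MapGerm

/-- A representative `g` of a map-germ at the origin is of class `C^∞`: it is smooth on some
neighbourhood of `0`. (Mathlib's `ContDiffAt ℝ ∞ g 0` alone would let the neighbourhood shrink
with the order of differentiability.) -/
def IsSmooth {m n : ℕ} (g : (Fin m → ℝ) → (Fin n → ℝ)) : Prop :=
  ∀ᶠ p in 𝓝 (0 : Fin m → ℝ), ContDiffAt ℝ ∞ g p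

/-- `d` represents a germ of a `C^∞`-diffeomorphism `(ℝⁿ, 0) → (ℝⁿ, 0)`: it is smooth near `0`,
fixes `0`, and has a smooth two-sided inverse as a germ. -/
def IsDiffeo {n : ℕ} (d : (Fin n → ℝ) → (Fin n → ℝ)) : Prop :=
  IsSmooth d ∧ d 0 = 0 ∧
    ∃ e : (Fin n → ℝ) → (Fin n → ℝ), IsSmooth e ∧ e 0 = 0 ∧
      (∀ᶠ p in 𝓝 (0 : Fin n → ℝ), e (d p) = p) ∧ (∀ᶠ p in 𝓝 (0 : Fin n → ℝ), d (e p) = p)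

/-- `𝒜`-equivalence of two map-germs `(ℝ², 0) → (ℝ³, 0)`: `d_t ∘ f₁ = f₂ ∘ d_s` as germs at `0`. -/
def AEquiv (f₁ f₂ : (Fin 2 → ℝ) → (Fin 3 → ℝ)) : Prop :=
  ∃ (ds : (Fin 2 → ℝ) → (Fin 2 → ℝ)) (dt : (Fin 3 → ℝ) → (Fin 3 → ℝ)),
    IsDiffeo ds ∧ IsDiffeo dt ∧ ∀ᶠ p in 𝓝 (0 : Fin 2 → ℝ), dt (f₁ p) = f₂ (ds p)

/-- The origin is a corank one singular point of `f`: `rank df_0 = 1`. -/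
def IsCorankOne (f : (Fin 2 → ℝ) → (Fin 3 → ℝ)) : Prop :=
  Module.finrank ℝ (LinearMap.range (fderiv ℝ f 0 : (Fin 2 → ℝ) →ₗ[ℝ] (Fin 3 → ℝ))) = 1

/-- The directional derivative `ζg` of a vector valued function `g` by a vector field `ζ`. -/
noncomputable def dirDeriv (ζ : (Fin 2 → ℝ) → (Fin 2 → ℝ)) (g : (Fin 2 → ℝ) → (Fin 3 → ℝ)) :
    (Fin 2 → ℝ) → (Fin 3 → ℝ) :=
  fun p => fderiv ℝ g p (ζ p)

/-- The function `φ = det(ξf, ηf, ηηf)`, the three vectors being the columns. -/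
noncomputable def phi (ξ η : (Fin 2 → ℝ) → (Fin 2 → ℝ)) (f : (Fin 2 → ℝ) → (Fin 3 → ℝ)) :
    (Fin 2 → ℝ) → ℝ :=
  fun p => (Matrix.of ![dirDeriv ξ f p, dirDeriv η f p, dirDeriv η (dirDeriv η f) p]).transpose.det

/-- The Hessian matrix at the origin of a function of two variables: the `(i, j)` entry is the
second partial derivative `∂ᵢ∂ⱼφ(0)`. -/
noncomputable def hess (φ : (Fin 2 → ℝ) → ℝ) : Matrix (Fin 2) (Fin 2) ℝ :=
  Matrix.of fun i j =>
    fderiv ℝ (fun p => fderiv ℝ φ p (Pi.single j 1)) 0 (Pi.single i 1)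

/-- The Chen–Matumoto–Mond `+` singularity `(x, y) ↦ (x, y², y(x² + y²))`. -/
def cmmPlus : (Fin 2 → ℝ) → (Fin 3 → ℝ) :=
  fun p => ![p 0, p 1 ^ 2, p 1 * (p 0 ^ 2 + p 1 ^ 2)]

/-- The Chen–Matumoto–Mond `-` singularity `(x, y) ↦ (x, y², y(x² - y²))`. -/
def cmmMinus : (Fin 2 → ℝ) → (Fin 3 → ℝ) :=
  fun p => ![p 0, p 1 ^ 2, p 1 * (p 0 ^ 2 - p 1 ^ 2)]

end MapGerm

/-!
The criteria hold because both sides are unchanged under `𝒜`-equivalence and under a change of the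
null frame `(ξ, η)`, and can be read off from a normal form.

*Invariance.* Near the origin `φ(p) = det (df_p ξ, df_p η, d²f_p(η, η))`, since the remaining part
of `ηηf` lies in the image of `df_p` (`phi_eventuallyEq`). The condition on `φ` is encoded by the
predicate `QSign s φ`: up to `o(|p|²)`, `φ` is a quadratic form `a x² + 2 b x y + c y²` with `0 <
s (a c - b²)` (`qSign_iff`; here `s = 1` for the `-` germ and `s = -1` for the `+` germ). A
diffeomorphism of the source transports `φ` together with the frame (`phiAt_comp_source`).
Replacing the frame multiplies `φ` by a nonvanishing function and, for `φ` critical at the origin,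
adds terms that are `o(|p|²)`: the mixed term `det (df X, df Y, d²f(X, Y))` that arises enters
with a coefficient vanishing at the origin, and criticality makes it `o(|p|)` (`mixed_isLittleO`,
`qSign_frame`). A diffeomorphism of the target multiplies `φ` by its Jacobian determinant at the
origin, up to third order (`QSign.comp_target`). Hence `QSign` is an invariant
(`QSign.of_aEquiv`), and so is the independence of `ξf(0)` and `ηηf(0)`, which says that `d²f_0(η,
η)` is not in the image of `df_0` (`IsTransversal.of_aEquiv`). This gives necessity by a
computation on the two model germs.

*Normal form.* A germ of corank one is equivalent to `(x, G, H)` with `G_y` and `H_y` vanishing at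
the origin (`exists_graph`). One of `G_yy(0)`, `H_yy(0)` is nonzero: for the `+` germ this is the
independence hypothesis, and for the `-` germ it is forced by the positive Hessian determinant
(`snd_ne_zero_of_qSign`). The parametric Morse lemma (`SmoothGerm.exists_morse`) turns that
function into `y²` up to a function of `x`, and Whitney's theorem on even functions
(`SmoothGerm.exists_even_odd`) writes the other one as `a(x, y²) + y b(x, y²)`, where `a(x, y²)`
is removed in the target. For `(x, y², y b(x, y²))` the leading part of `φ` is `-2 b_x x - b_xx x²
+ 6 b_v y²`, with `v` the second variable of `b`, so the condition on `φ` says `b_x = 0` and `s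
b_xx b_v < 0` (`phi_evenForm_isLittleO`, `evenForm_of_qSign`). A Morse lemma in `x` and a
rescaling then give `(x, y², y (x² - s y²))` (`aEquiv_cmm_of_coeff`).

Whitney's theorem is obtained from Fourier inversion: after a cutoff the germ is a superposition
of exponentials, whose even parts in `y` are `cos (b y) = c (b² y²)` with `c s = cos √s`. The
derivatives of `c` are bounded on `[0, ∞)`, by the differential equation `4 s c'' + 2 c' + c = 0`,
so one may differentiate under the integral sign (`contDiff_phase_integral`).
-/

namespace MapGerm

/-! ### Smooth germs and Hadamard's lemma -/

/-- A representative `F` of a germ at the origin is of class `C^∞`: it is smooth at every point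
near `0`. This is `IsSmooth` for arbitrary normed source and target. -/
def SmoothGerm {E G : Type*} [NormedAddCommGroup E] [NormedSpace ℝ E] [NormedAddCommGroup G]
    [NormedSpace ℝ G] (F : E → G) : Prop :=
  ∀ᶠ p in 𝓝 (0 : E), ContDiffAt ℝ ∞ F p

section SmoothGerm

variable {E G H : Type*} [NormedAddCommGroup E] [NormedSpace ℝ E] [NormedAddCommGroup G]
  [NormedSpace ℝ G] [NormedAddCommGroup H] [NormedSpace ℝ H]

theorem SmoothGerm.contDiffAt {F : E → G} (h : SmoothGerm F) : ContDiffAt ℝ ∞ F 0 :=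
  h.self_of_nhds

theorem SmoothGerm.continuousAt {F : E → G} (h : SmoothGerm F) : ContinuousAt F 0 :=
  h.contDiffAt.continuousAt

theorem SmoothGerm.differentiableAt {F : E → G} (h : SmoothGerm F) : DifferentiableAt ℝ F 0 :=
  h.contDiffAt.differentiableAt (by simp)

theorem SmoothGerm.eventually_differentiableAt {F : E → G} (h : SmoothGerm F) :
    ∀ᶠ p in 𝓝 (0 : E), DifferentiableAt ℝ F p :=
  h.mono fun _ hp => hp.differentiableAt (by simp)

theorem _root_.ContDiff.smoothGerm {F : E → G} (h : ContDiff ℝ ∞ F) : SmoothGerm F :=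
  Eventually.of_forall fun _ => h.contDiffAt

theorem SmoothGerm.congr {F F' : E → G} (h : SmoothGerm F) (e : F' =ᶠ[𝓝 0] F) :
    SmoothGerm F' := by
  filter_upwards [h, e.eventuallyEq_nhds] with p hp he
  exact hp.congr_of_eventuallyEq he

theorem SmoothGerm.comp {F : G → H} {d : E → G} (hF : SmoothGerm F) (hd : SmoothGerm d)
    (h0 : d 0 = 0) : SmoothGerm (fun p => F (d p)) := by
  have hc : Tendsto d (𝓝 0) (𝓝 0) := by simpa [ContinuousAt, h0] using hd.continuousAt
  filter_upwards [hc.eventually hF, hd] with p h1 h2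
  exact ContDiffAt.comp p h1 h2

theorem SmoothGerm.fderiv_right {F : E → G} (hF : SmoothGerm F) : SmoothGerm (fderiv ℝ F) := by
  filter_upwards [hF] with p hp
  exact hp.fderiv_right (by simp)

theorem SmoothGerm.clm_apply {F : E → G →L[ℝ] H} {v : E → G} (hF : SmoothGerm F)
    (hv : SmoothGerm v) : SmoothGerm (fun p => F p (v p)) := by
  filter_upwards [hF, hv] with p hp hq
  exact hp.clm_apply hq

theorem SmoothGerm.fderiv_apply {F : E → G} {v : E → E} (hF : SmoothGerm F) (hv : SmoothGerm v) :
    SmoothGerm (fun p => fderiv ℝ F p (v p)) :=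
  hF.fderiv_right.clm_apply hv

theorem SmoothGerm.const (c : G) : SmoothGerm (fun _ : E => c) :=
  contDiff_const.smoothGerm

theorem SmoothGerm.add {F F' : E → G} (hF : SmoothGerm F) (hF' : SmoothGerm F') :
    SmoothGerm (fun p => F p + F' p) := by
  filter_upwards [hF, hF'] with p hp hq
  exact hp.add hq

theorem SmoothGerm.sub {F F' : E → G} (hF : SmoothGerm F) (hF' : SmoothGerm F') :
    SmoothGerm (fun p => F p - F' p) := by
  filter_upwards [hF, hF'] with p hp hq
  exact hp.sub hq

theorem SmoothGerm.mul {F F' : E → ℝ} (hF : SmoothGerm F) (hF' : SmoothGerm F') :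
    SmoothGerm (fun p => F p * F' p) := by
  filter_upwards [hF, hF'] with p hp hq
  exact hp.mul hq

theorem SmoothGerm.sqrt {F : E → ℝ} (hF : SmoothGerm F) (h0 : F 0 ≠ 0) :
    SmoothGerm (fun p => Real.sqrt (F p)) := by
  filter_upwards [hF, hF.continuousAt.eventually_ne h0] with p hp hq
  exact hp.sqrt hq

theorem SmoothGerm.pow {F : E → ℝ} (hF : SmoothGerm F) (n : ℕ) :
    SmoothGerm (fun p => F p ^ n) := by
  filter_upwards [hF] with p hp
  exact hp.pow n

theorem SmoothGerm.pi {n : ℕ} {F : E → Fin n → ℝ} (h : ∀ i, SmoothGerm (fun p => F p i)) :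
    SmoothGerm F := by
  filter_upwards [eventually_all.2 h] with p hp
  exact contDiffAt_pi.2 hp

theorem SmoothGerm.apply {n : ℕ} {F : E → Fin n → ℝ} (h : SmoothGerm F) (i : Fin n) :
    SmoothGerm (fun p => F p i) := by
  filter_upwards [h] with p hp
  exact contDiffAt_pi.1 hp i

theorem SmoothGerm.vec2 {u v : E → ℝ} (hu : SmoothGerm u) (hv : SmoothGerm v) :
    SmoothGerm (fun p => ![u p, v p]) :=
  SmoothGerm.pi fun i => by fin_cases i <;> simpa

theorem SmoothGerm.vec3 {u v w : E → ℝ} (hu : SmoothGerm u) (hv : SmoothGerm v)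
    (hw : SmoothGerm w) : SmoothGerm (fun p => ![u p, v p, w p]) :=
  SmoothGerm.pi fun i => by fin_cases i <;> simpa

theorem SmoothGerm.coord {n : ℕ} (i : Fin n) : SmoothGerm (fun p : Fin n → ℝ => p i) :=
  (contDiff_apply ℝ ℝ i).smoothGerm

/-- A smooth germ on a finite-dimensional space has a compactly supported smooth representative,
obtained by multiplication with a cutoff function supported in any prescribed neighbourhood. -/
theorem SmoothGerm.exists_cutoff [FiniteDimensional ℝ E] {F : E → ℝ} (hF : SmoothGerm F)
    {s : Set E} (hs : s ∈ 𝓝 (0 : E)) :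
    ∃ K : E → ℝ, ContDiff ℝ ∞ K ∧ HasCompactSupport K ∧ K =ᶠ[𝓝 0] F ∧
      ∀ p, K p ≠ 0 → p ∈ s ∧ F p ≠ 0 := by
  obtain ⟨ε, hε, hb⟩ := Metric.mem_nhds_iff.1 (inter_mem hF hs)
  let χ : ContDiffBump (0 : E) := ⟨ε / 3, ε / 2, by positivity, by linarith⟩
  have hsub : tsupport (χ : E → ℝ) ⊆ Metric.ball 0 ε := by
    rw [χ.tsupport_eq]
    exact Metric.closedBall_subset_ball (by change ε / 2 < ε; linarith)
  refine ⟨fun p => χ p * F p, ?_, χ.hasCompactSupport.mul_right, ?_, ?_⟩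
  · refine contDiff_iff_contDiffAt.2 fun p => ?_
    by_cases hp : p ∈ tsupport (χ : E → ℝ)
    · exact χ.contDiff.contDiffAt.mul (hb (hsub hp)).1
    · have : (fun p => χ p * F p) =ᶠ[𝓝 p] fun _ => 0 := by
        filter_upwards [(isClosed_tsupport (χ : E → ℝ)).isOpen_compl.mem_nhds hp] with q hq
        rw [image_eq_zero_of_notMem_tsupport hq, zero_mul]
      exact contDiffAt_const.congr_of_eventuallyEq this
  · filter_upwards [χ.eventuallyEq_one] with p hp
    simp [hp]
  · intro p hp
    have h1 : χ p ≠ 0 := left_ne_zero_of_mul hp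
    exact ⟨(hb (hsub (subset_tsupport _ h1))).2, right_ne_zero_of_mul hp⟩

end SmoothGerm

section ParametricIntegral

variable {E : Type*} [NormedAddCommGroup E] [NormedSpace ℝ E] [FiniteDimensional ℝ E]

theorem hasFDerivAt_integral_unitInterval {H : E × ℝ → ℝ} (hH : ContDiff ℝ ∞ H) (x : E) :
    HasFDerivAt (fun x => ∫ t in (0 : ℝ)..1, H (x, t))
      (∫ t in (0 : ℝ)..1, (fderiv ℝ H (x, t)).comp (ContinuousLinearMap.inl ℝ E ℝ)) x := by
  have hc : Continuous fun q : E × ℝ => (fderiv ℝ H q).comp (ContinuousLinearMap.inl ℝ E ℝ) :=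
    (hH.continuous_fderiv (by simp)).clm_comp continuous_const
  obtain ⟨C, hC⟩ :=
    ((isCompact_closedBall x 1).prod (isCompact_Icc (a := (0 : ℝ)) (b := 1))).exists_bound_of_continuousOn
    hc.continuousOn
  refine intervalIntegral.hasFDerivAt_integral_of_dominated_of_fderiv_le
    (F := fun x t => H (x, t))
    (F' := fun x t => (fderiv ℝ H (x, t)).comp (ContinuousLinearMap.inl ℝ E ℝ))
    (bound := fun _ => C) (Metric.closedBall_mem_nhds x one_pos) ?_ ?_ ?_ ?_ ?_ ?_
  · exact Eventually.of_forall fun y =>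
      (hH.continuous.comp (Continuous.prodMk_right y)).aestronglyMeasurable
  · exact (hH.continuous.comp (Continuous.prodMk_right x)).intervalIntegrable _ _
  · exact (hc.comp (Continuous.prodMk_right x)).aestronglyMeasurable
  · refine Eventually.of_forall fun t ht y hy => hC (y, t) ⟨hy, ?_⟩
    rw [Set.uIoc_of_le zero_le_one] at ht
    exact Set.Ioc_subset_Icc_self ht
  · exact intervalIntegrable_const
  · refine Eventually.of_forall fun t _ y _ => ?_
    have h1 : HasFDerivAt (fun y : E => (y, t)) (ContinuousLinearMap.inl ℝ E ℝ) y :=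
      hasFDerivAt_prodMk_left y t
    exact ((hH.differentiable (by simp)) (y, t)).hasFDerivAt.comp y h1

theorem contDiff_integral_unitInterval {H : E × ℝ → ℝ} (hH : ContDiff ℝ ∞ H) :
    ContDiff ℝ ∞ (fun x => ∫ t in (0 : ℝ)..1, H (x, t)) := by
  refine contDiff_infty.2 fun n => ?_
  induction n generalizing H with
  | zero =>
    exact contDiff_zero.2 (continuous_iff_continuousAt.2 fun x =>
      (hasFDerivAt_integral_unitInterval hH x).continuousAt)
  | succ n ih =>
    refine contDiff_succ_iff_fderiv_apply.2
      ⟨fun x => (hasFDerivAt_integral_unitInterval hH x).differentiableAt,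
        fun h => absurd h (WithTop.natCast_ne_top n), fun y => ?_⟩
    have hG : ContDiff ℝ ∞ fun q : E × ℝ => fderiv ℝ H q (y, 0) :=
      (hH.fderiv_right (by simp)).clm_apply contDiff_const
    convert ih hG using 2 with x
    rw [(hasFDerivAt_integral_unitInterval hH x).fderiv,
      ContinuousLinearMap.intervalIntegral_apply]
    · simp
    · have hc : Continuous fun q : E × ℝ =>
          (fderiv ℝ H q).comp (ContinuousLinearMap.inl ℝ E ℝ) :=
        (hH.continuous_fderiv (by simp)).clm_comp continuous_const
      exact (hc.comp (Continuous.prodMk_right x)).intervalIntegrable _ _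

end ParametricIntegral

theorem hasDerivAt_vec2_right (x y : ℝ) :
    HasDerivAt (fun t : ℝ => (![x, t] : Fin 2 → ℝ)) ![0, 1] y := by
  rw [hasDerivAt_pi]
  intro i
  fin_cases i
  · exact hasDerivAt_const y x
  · exact hasDerivAt_id y

theorem vec2_eta (p : Fin 2 → ℝ) : ![p 0, p 1] = p := by
  ext i; fin_cases i <;> rfl

/-- **Hadamard's lemma**: a smooth germ of two variables that vanishes on the axis `y = 0` is
divisible by `y`. -/
theorem SmoothGerm.exists_eq_mul {F : (Fin 2 → ℝ) → ℝ} (hF : SmoothGerm F)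
    (h0 : ∀ᶠ p in 𝓝 (0 : Fin 2 → ℝ), F ![p 0, 0] = 0) :
    ∃ K : (Fin 2 → ℝ) → ℝ, SmoothGerm K ∧ ∀ᶠ p in 𝓝 (0 : Fin 2 → ℝ), F p = p 1 * K p := by
  obtain ⟨F', hF', -, heq, hs⟩ := hF.exists_cutoff h0
  have hz : ∀ x : ℝ, F' ![x, 0] = 0 := by
    intro x
    by_contra h
    obtain ⟨h1, h2⟩ := hs _ h
    exact h2 h1
  let H : (Fin 2 → ℝ) × ℝ → ℝ := fun q => fderiv ℝ F' ![q.1 0, q.2 * q.1 1] ![0, 1]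
  have hH : ContDiff ℝ ∞ H := by
    have hv : ContDiff ℝ ∞ fun q : (Fin 2 → ℝ) × ℝ => (![q.1 0, q.2 * q.1 1] : Fin 2 → ℝ) := by
      refine contDiff_pi.2 fun i => ?_
      fin_cases i
      · change ContDiff ℝ ∞ fun q : (Fin 2 → ℝ) × ℝ => q.1 0
        fun_prop
      · change ContDiff ℝ ∞ fun q : (Fin 2 → ℝ) × ℝ => q.2 * q.1 1
        fun_prop
    exact ((hF'.fderiv_right (m := ∞) (by simp)).comp hv).clm_apply contDiff_const
  refine ⟨_, (contDiff_integral_unitInterval hH).smoothGerm, ?_⟩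
  filter_upwards [heq] with p hp
  rw [← hp]
  have hd : ∀ t : ℝ, HasDerivAt (fun t : ℝ => F' ![p 0, t * p 1]) (p 1 * H (p, t)) t := by
    intro t
    have h1 : HasDerivAt (fun t : ℝ => t * p 1) (p 1) t := by
      simpa using (hasDerivAt_id t).mul_const (p 1)
    have h2 : HasDerivAt (fun t : ℝ => (![p 0, t * p 1] : Fin 2 → ℝ)) (p 1 • ![0, 1]) t :=
      HasDerivAt.scomp (h := fun t : ℝ => t * p 1) t (hasDerivAt_vec2_right (p 0) (t * p 1)) h1
    have h3 := ((hF'.differentiable (by simp)) ![p 0, t * p 1]).hasFDerivAt.comp_hasDerivAt t h2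
    rwa [map_smul, smul_eq_mul] at h3
  have hint : Continuous fun t => p 1 * H (p, t) :=
    continuous_const.mul (hH.continuous.comp (Continuous.prodMk_right p))
  have := intervalIntegral.integral_eq_sub_of_hasDerivAt (fun t _ => hd t)
    (hint.intervalIntegrable 0 1)
  rw [intervalIntegral.integral_const_mul] at this
  rw [this]
  simp [hz, vec2_eta]

/-! ### The function `cos √s` and bounds for its derivatives -/

/-- The entire function `s ↦ ∑ (-1)ⁿ sⁿ / (2n)!`, which is `cos √s` for `s ≥ 0`. -/
noncomputable def cosSqrt : ℝ → ℝ :=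
  FormalMultilinearSeries.ofScalarsSum fun n : ℕ => ((-1 : ℝ) ^ n / (2 * n).factorial)

theorem contDiff_cosSqrt : ContDiff ℝ ∞ cosSqrt := by
  have hr : (FormalMultilinearSeries.ofScalars ℝ
      fun n : ℕ => ((-1 : ℝ) ^ n / (2 * n).factorial)).radius = ⊤ := by
    refine FormalMultilinearSeries.ofScalars_radius_eq_top_of_tendsto _ _
      (Eventually.of_forall fun n => by positivity) ?_
    have : ∀ n : ℕ, ‖(-1 : ℝ) ^ n.succ / (2 * n.succ).factorial‖ /
        ‖(-1 : ℝ) ^ n / (2 * n).factorial‖ = 1 / ((2 * n + 1) * (2 * n + 2) : ℝ) := by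
      intro n
      have h2 : (2 * n.succ).factorial = (2 * n + 2) * ((2 * n + 1) * (2 * n).factorial) := by
        rw [show 2 * n.succ = 2 * n + 1 + 1 by omega, Nat.factorial_succ, Nat.factorial_succ]
      have h3 : ((2 * n).factorial : ℝ) ≠ 0 := by positivity
      simp only [norm_div, norm_pow, norm_neg, norm_one, one_pow, Real.norm_natCast, h2]
      push_cast
      field_simp
    simp_rw [this]
    refine squeeze_zero (fun n => by positivity) (fun n => ?_)
      (tendsto_one_div_add_atTop_nhds_zero_nat (𝕜 := ℝ))
    have hn : (0 : ℝ) ≤ n := n.cast_nonneg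
    exact one_div_le_one_div_of_le (by positivity) (by nlinarith)
  have h := FormalMultilinearSeries.hasFPowerSeriesOnBall (p := FormalMultilinearSeries.ofScalars ℝ
      fun n : ℕ => ((-1 : ℝ) ^ n / (2 * n).factorial)) (by rw [hr]; exact ENNReal.zero_lt_top)
  rw [hr] at h
  refine contDiff_iff_contDiffAt.2 fun s => ?_
  exact (h.analyticAt_of_mem (by simp)).contDiffAt

theorem cosSqrt_sq (y : ℝ) : cosSqrt (y ^ 2) = Real.cos y := by
  rw [cosSqrt, FormalMultilinearSeries.ofScalarsSum_eq_tsum]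
  refine Eq.trans (tsum_congr fun n => ?_) (Real.hasSum_cos y).tsum_eq
  rw [smul_eq_mul, ← pow_mul]
  ring

theorem hasDerivAt_iteratedDeriv {c : ℝ → ℝ} (hc : ContDiff ℝ ∞ c) (n : ℕ) (s : ℝ) :
    HasDerivAt (iteratedDeriv n c) (iteratedDeriv (n + 1) c s) s := by
  rw [iteratedDeriv_succ]
  exact ((hc.differentiable_iteratedDeriv n (by exact_mod_cast WithTop.coe_lt_top _)) s).hasDerivAt

theorem two_mul_iteratedDeriv_cosSqrt (y : ℝ) :
    2 * y * iteratedDeriv 1 cosSqrt (y ^ 2) = -Real.sin y := by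
  have h1 : HasDerivAt (fun y : ℝ => cosSqrt (y ^ 2))
      (iteratedDeriv 1 cosSqrt (y ^ 2) * (2 * y)) y := by
    have h1 := hasDerivAt_iteratedDeriv contDiff_cosSqrt 0 (y ^ 2)
    rw [iteratedDeriv_zero] at h1
    have h2 : HasDerivAt (fun y : ℝ => y ^ 2) (2 * y) y := by simpa using hasDerivAt_pow 2 y
    exact HasDerivAt.comp (h := fun y : ℝ => y ^ 2) y h1 h2
  simp_rw [cosSqrt_sq] at h1
  rw [← h1.unique (Real.hasDerivAt_cos y)]
  ring

/-- The differential equation `4 s c'' + 2 c' + c = 0` of `c(s) = cos √s`, differentiated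
`n` times. -/
theorem cosSqrt_ode (n : ℕ) (s : ℝ) (hs : 0 < s) :
    4 * s * iteratedDeriv (n + 2) cosSqrt s + (4 * n + 2) * iteratedDeriv (n + 1) cosSqrt s +
      iteratedDeriv n cosSqrt s = 0 := by
  induction n generalizing s with
  | zero =>
    set y := Real.sqrt s
    have hy : s = y ^ 2 := (Real.sq_sqrt hs.le).symm
    have h1 : HasDerivAt (fun y : ℝ => 2 * y * iteratedDeriv 1 cosSqrt (y ^ 2))
        (2 * 1 * iteratedDeriv 1 cosSqrt (y ^ 2) +
          2 * y * (iteratedDeriv 2 cosSqrt (y ^ 2) * (2 * y))) y := by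
      refine ((hasDerivAt_id y).const_mul 2).mul ?_
      have h2 : HasDerivAt (fun y : ℝ => y ^ 2) (2 * y) y := by simpa using hasDerivAt_pow 2 y
      exact HasDerivAt.comp (h := fun y : ℝ => y ^ 2) y
        (hasDerivAt_iteratedDeriv contDiff_cosSqrt 1 (y ^ 2)) h2
    simp_rw [two_mul_iteratedDeriv_cosSqrt] at h1
    have h2 := h1.unique (Real.hasDerivAt_sin y).neg
    rw [hy, iteratedDeriv_zero, cosSqrt_sq]
    simp only [Nat.cast_zero, zero_add]
    linear_combination h2
  | succ n ih =>
    have hD := hasDerivAt_iteratedDeriv contDiff_cosSqrt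
    have h1 : HasDerivAt (fun s => 4 * s * iteratedDeriv (n + 2) cosSqrt s +
        (4 * n + 2) * iteratedDeriv (n + 1) cosSqrt s + iteratedDeriv n cosSqrt s)
        ((4 * 1 * iteratedDeriv (n + 2) cosSqrt s + 4 * s * iteratedDeriv (n + 3) cosSqrt s) +
          (4 * n + 2) * iteratedDeriv (n + 2) cosSqrt s + iteratedDeriv (n + 1) cosSqrt s) s :=
      ((((hasDerivAt_id s).const_mul 4).mul (hD (n + 2) s)).add
        ((hD (n + 1) s).const_mul _)).add (hD n s)
    have h2 : (fun s => 4 * s * iteratedDeriv (n + 2) cosSqrt s +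
        (4 * n + 2) * iteratedDeriv (n + 1) cosSqrt s + iteratedDeriv n cosSqrt s) =ᶠ[𝓝 s]
        fun _ => 0 := by
      filter_upwards [lt_mem_nhds hs] with t ht using ih t ht
    have h3 := h1.unique ((hasDerivAt_const s (0 : ℝ)).congr_of_eventuallyEq h2)
    push_cast
    linear_combination h3

theorem continuous_iteratedDeriv_of_smooth {c : ℝ → ℝ} (hc : ContDiff ℝ ∞ c) (n : ℕ) :
    Continuous (iteratedDeriv n c) :=
  continuous_iff_continuousAt.2 fun s => (hasDerivAt_iteratedDeriv hc n s).continuousAt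

theorem cosSqrt_bound (n : ℕ) : ∃ K : ℝ, ∀ s, 0 ≤ s → |iteratedDeriv n cosSqrt s| ≤ K := by
  have hcpt : ∀ n, ∃ K : ℝ, ∀ s ∈ Set.Icc (0 : ℝ) 1, |iteratedDeriv n cosSqrt s| ≤ K := fun n =>
    isCompact_Icc.exists_bound_of_continuousOn
      (continuous_iteratedDeriv_of_smooth contDiff_cosSqrt n).continuousOn
  induction n using Nat.twoStepInduction with
  | zero =>
    refine ⟨1, fun s hs => ?_⟩
    rw [iteratedDeriv_zero, ← Real.sq_sqrt hs, cosSqrt_sq]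
    exact Real.abs_cos_le_one _
  | one =>
    obtain ⟨K, hK⟩ := hcpt 1
    refine ⟨max K 1, fun s hs => ?_⟩
    rcases le_total s 1 with h | h
    · exact (hK s ⟨hs, h⟩).trans (le_max_left _ _)
    · refine le_trans ?_ (le_max_right _ _)
      have hy : 1 ≤ Real.sqrt s := Real.one_le_sqrt.2 h
      have h1 := two_mul_iteratedDeriv_cosSqrt (Real.sqrt s)
      rw [Real.sq_sqrt hs] at h1
      have h2 : 2 * Real.sqrt s * |iteratedDeriv 1 cosSqrt s| ≤ 1 := by
        rw [← abs_of_pos (show 0 < 2 * Real.sqrt s by linarith), ← abs_mul, h1, abs_neg]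
        exact Real.abs_sin_le_one _
      nlinarith [abs_nonneg (iteratedDeriv 1 cosSqrt s)]
  | more n ih1 ih2 =>
    obtain ⟨K, hK⟩ := hcpt (n + 2)
    obtain ⟨K1, hK1⟩ := ih1
    obtain ⟨K2, hK2⟩ := ih2
    refine ⟨max K ((4 * n + 2) * K2 + K1), fun s hs => ?_⟩
    rcases le_total s 1 with h | h
    · exact (hK s ⟨hs, h⟩).trans (le_max_left _ _)
    · refine le_trans ?_ (le_max_right _ _)
      have h1 := cosSqrt_ode n s (by linarith)
      have h2 : 4 * s * |iteratedDeriv (n + 2) cosSqrt s| ≤ (4 * n + 2) * K2 + K1 := by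
        rw [← abs_of_pos (show 0 < 4 * s by linarith), ← abs_mul]
        rw [show 4 * s * iteratedDeriv (n + 2) cosSqrt s =
          -((4 * n + 2) * iteratedDeriv (n + 1) cosSqrt s + iteratedDeriv n cosSqrt s) by
            linear_combination h1, abs_neg]
        refine (abs_add_le _ _).trans (add_le_add ?_ (hK1 s hs))
        rw [abs_mul, abs_of_pos (show (0 : ℝ) < 4 * n + 2 by positivity)]
        exact mul_le_mul_of_nonneg_left (hK2 s hs) (by positivity)
      nlinarith [abs_nonneg (iteratedDeriv (n + 2) cosSqrt s)]

/-- `cosSqrt` cut off on the negative half-line, so that all its derivatives are bounded. -/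
noncomputable def cosSqrtCutoff (s : ℝ) : ℝ :=
  Real.smoothTransition (s + 2) * cosSqrt s

theorem contDiff_cosSqrtCutoff : ContDiff ℝ ∞ cosSqrtCutoff :=
  (Real.smoothTransition.contDiff.comp (contDiff_id.add contDiff_const)).mul contDiff_cosSqrt

theorem iteratedDeriv_cosSqrtCutoff (n : ℕ) {s : ℝ} (hs : 0 ≤ s) :
    iteratedDeriv n cosSqrtCutoff s = iteratedDeriv n cosSqrt s := by
  refine Filter.EventuallyEq.iteratedDeriv_eq n ?_
  filter_upwards [lt_mem_nhds (show -1 < s by linarith)] with t ht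
  rw [cosSqrtCutoff, Real.smoothTransition.one_of_one_le (by linarith), one_mul]

theorem cosSqrtCutoff_bound (n : ℕ) : ∃ K : ℝ, ∀ s, |iteratedDeriv n cosSqrtCutoff s| ≤ K := by
  obtain ⟨K1, hK1⟩ := cosSqrt_bound n
  obtain ⟨K2, hK2⟩ := (isCompact_Icc (a := (-2 : ℝ)) (b := 0)).exists_bound_of_continuousOn
      (continuous_iteratedDeriv_of_smooth contDiff_cosSqrtCutoff n).continuousOn
  refine ⟨max K1 K2, fun s => ?_⟩
  rcases le_total 0 s with h | h
  · rw [iteratedDeriv_cosSqrtCutoff n h]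
    exact (hK1 s h).trans (le_max_left _ _)
  rcases le_or_gt (-2) s with h' | h'
  · exact (hK2 s ⟨h', h⟩).trans (le_max_right _ _)
  · have : cosSqrtCutoff =ᶠ[𝓝 s] fun _ => (0 : ℝ) := by
      filter_upwards [gt_mem_nhds h'] with t ht
      rw [cosSqrtCutoff, Real.smoothTransition.zero_of_nonpos (by linarith), zero_mul]
    rw [this.iteratedDeriv_eq n]
    have h0 := (abs_nonneg _).trans (hK1 0 le_rfl)
    simpa [iteratedDeriv_const] using Or.inl h0

end MapGerm

namespace MapGerm

open MeasureTheory FourierTransform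

/-! ### Whitney's theorem on even functions -/

/-- A sequence of complex functions on the line, each the derivative of the preceding one and each
bounded: a smooth function all of whose derivatives are bounded, given with its derivatives. -/
def BoundedDerivs (A : ℕ → ℝ → ℂ) : Prop :=
  (∀ n s, HasDerivAt (A n) (A (n + 1) s) s) ∧ ∀ n, ∃ K : ℝ, ∀ s, ‖A n s‖ ≤ K

theorem BoundedDerivs.succ {A : ℕ → ℝ → ℂ} (hA : BoundedDerivs A) :
    BoundedDerivs fun n => A (n + 1) :=
  ⟨fun n => hA.1 (n + 1), fun n => hA.2 (n + 1)⟩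

theorem BoundedDerivs.continuous {A : ℕ → ℝ → ℂ} (hA : BoundedDerivs A) (n : ℕ) :
    Continuous (A n) :=
  continuous_iff_continuousAt.2 fun s => (hA.1 n s).continuousAt

section

variable {Ω : Type*} [MeasurableSpace Ω] {μ : Measure Ω} {α β : Ω → ℝ}

/-- All moments of `u` with respect to the two phases `α` and `β` are finite. -/
def FiniteMoments (μ : Measure Ω) (α β : Ω → ℝ) (u : Ω → ℂ) : Prop :=
  ∀ i j : ℕ, Integrable (fun w => ((α w : ℂ) ^ i * (β w : ℂ) ^ j) * u w) μ

theorem FiniteMoments.integrable {u : Ω → ℂ} (hu : FiniteMoments μ α β u) : Integrable u μ := by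
  simpa using hu 0 0

theorem FiniteMoments.mul_left {u : Ω → ℂ} (hu : FiniteMoments μ α β u) :
    FiniteMoments μ α β fun w => α w * u w := fun i j =>
  (hu (i + 1) j).congr (Eventually.of_forall fun w => by simp only []; ring)

theorem FiniteMoments.mul_right {u : Ω → ℂ} (hu : FiniteMoments μ α β u) :
    FiniteMoments μ α β fun w => β w * u w := fun i j =>
  (hu i (j + 1)).congr (Eventually.of_forall fun w => by simp only []; ring)

variable [TopologicalSpace Ω] [BorelSpace Ω]

theorem FiniteMoments.integrable_mul {u : Ω → ℂ} (hu : FiniteMoments μ α β u)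
    (hα : Continuous α) (hβ : Continuous β)
    {A B : ℕ → ℝ → ℂ} (hA : BoundedDerivs A) (hB : BoundedDerivs B) (p : Fin 2 → ℝ) (m n : ℕ) :
    Integrable (fun w => u w * (A m (α w * p 0) * B n (β w * p 1))) μ := by
  obtain ⟨K, hK⟩ := hA.2 m
  obtain ⟨L, hL⟩ := hB.2 n
  refine hu.integrable.mul_bdd (c := K * L) ?_ (Eventually.of_forall fun w => ?_)
  · exact (((hA.continuous m).comp (hα.mul continuous_const)).mul
      ((hB.continuous n).comp (hβ.mul continuous_const))).aestronglyMeasurable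
  · rw [norm_mul]
    exact mul_le_mul (hK _) (hL _) (norm_nonneg _) ((norm_nonneg _).trans (hK 0))

theorem hasFDerivAt_phase_integral {u : Ω → ℂ} (hu : FiniteMoments μ α β u)
    (hα : Continuous α) (hβ : Continuous β)
    {A B : ℕ → ℝ → ℂ} (hA : BoundedDerivs A) (hB : BoundedDerivs B) (p : Fin 2 → ℝ) :
    HasFDerivAt (fun p : Fin 2 → ℝ => ∫ w, u w * (A 0 (α w * p 0) * B 0 (β w * p 1)) ∂μ)
      ((ContinuousLinearMap.proj (R := ℝ) (φ := fun _ : Fin 2 => ℝ) 0).smulRight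
          (∫ w, α w * u w * (A 1 (α w * p 0) * B 0 (β w * p 1)) ∂μ) +
        (ContinuousLinearMap.proj (R := ℝ) (φ := fun _ : Fin 2 => ℝ) 1).smulRight
          (∫ w, β w * u w * (A 0 (α w * p 0) * B 1 (β w * p 1)) ∂μ)) p := by
  obtain ⟨K0, hK0⟩ := hA.2 0
  obtain ⟨K1, hK1⟩ := hA.2 1
  obtain ⟨L0, hL0⟩ := hB.2 0
  obtain ⟨L1, hL1⟩ := hB.2 1
  let π : Fin 2 → ((Fin 2 → ℝ) →L[ℝ] ℝ) := fun i =>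
    ContinuousLinearMap.proj (R := ℝ) (φ := fun _ : Fin 2 => ℝ) i
  let S : Fin 2 → ℂ →L[ℝ] ((Fin 2 → ℝ) →L[ℝ] ℂ) := fun i =>
    ContinuousLinearMap.smulRightL ℝ (Fin 2 → ℝ) ℂ (π i)
  let F' : (Fin 2 → ℝ) → Ω → ((Fin 2 → ℝ) →L[ℝ] ℂ) := fun p w =>
    S 0 (α w * u w * (A 1 (α w * p 0) * B 0 (β w * p 1))) +
      S 1 (β w * u w * (A 0 (α w * p 0) * B 1 (β w * p 1)))
  have hi0 := hu.mul_left.integrable_mul hα hβ hA hB p 1 0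
  have hi1 := hu.mul_right.integrable_mul hα hβ hA hB p 0 1
  have key : HasFDerivAt
      (fun p : Fin 2 → ℝ => ∫ w, u w * (A 0 (α w * p 0) * B 0 (β w * p 1)) ∂μ)
      (∫ w, F' p w ∂μ) p := by
    refine hasFDerivAt_integral_of_dominated_of_fderiv_le
      (bound := fun w => ‖S 0‖ * (‖(α w : ℂ) * u w‖ * (K1 * L0)) +
        ‖S 1‖ * (‖(β w : ℂ) * u w‖ * (K0 * L1))) (s := Set.univ) univ_mem ?_ ?_ ?_ ?_ ?_ ?_
    · exact Eventually.of_forall fun q => (hu.integrable_mul hα hβ hA hB q 0 0).1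
    · exact hu.integrable_mul hα hβ hA hB p 0 0
    · exact (((S 0).integrable_comp hi0).add ((S 1).integrable_comp hi1)).1
    · refine Eventually.of_forall fun w q _ => (norm_add_le _ _).trans (add_le_add ?_ ?_)
      · refine ((S 0).le_opNorm _).trans (mul_le_mul_of_nonneg_left ?_ (norm_nonneg _))
        rw [norm_mul, norm_mul (A 1 _)]
        exact mul_le_mul_of_nonneg_left (mul_le_mul (hK1 _) (hL0 _) (norm_nonneg _)
          ((norm_nonneg _).trans (hK1 0))) (norm_nonneg _)
      · refine ((S 1).le_opNorm _).trans (mul_le_mul_of_nonneg_left ?_ (norm_nonneg _))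
        rw [norm_mul, norm_mul (A 0 _)]
        exact mul_le_mul_of_nonneg_left (mul_le_mul (hK0 _) (hL1 _) (norm_nonneg _)
          ((norm_nonneg _).trans (hK0 0))) (norm_nonneg _)
    · exact ((hu.mul_left.integrable.norm.mul_const _).const_mul _).add
        ((hu.mul_right.integrable.norm.mul_const _).const_mul _)
    · refine Eventually.of_forall fun w q _ => ?_
      have ha : HasFDerivAt (fun q : Fin 2 → ℝ => α w * q 0) (α w • π 0) q :=
        ((π 0).hasFDerivAt (x := q)).const_mul (α w)
      have hb : HasFDerivAt (fun q : Fin 2 → ℝ => β w * q 1) (β w • π 1) q :=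
        ((π 1).hasFDerivAt (x := q)).const_mul (β w)
      have h1 := (hA.1 0 (α w * q 0)).hasFDerivAt.comp q ha
      have h2 := (hB.1 0 (β w * q 1)).hasFDerivAt.comp q hb
      refine ((h1.mul h2).const_mul (u w)).congr_fderiv ?_
      ext v
      simp [F', S, π]
      ring
  refine key.congr_fderiv ?_
  rw [integral_add ((S 0).integrable_comp hi0) ((S 1).integrable_comp hi1),
    (S 0).integral_comp_comm hi0, (S 1).integral_comp_comm hi1]
  rfl

/-- Integrals `∫ u(w) A(α(w) x) B(β(w) y) dμ(w)` are smooth in `(x, y)` when `u` has finite moments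
and all derivatives of `A` and `B` are bounded. -/
theorem contDiff_phase_integral {u : Ω → ℂ} (hu : FiniteMoments μ α β u)
    (hα : Continuous α) (hβ : Continuous β)
    {A B : ℕ → ℝ → ℂ} (hA : BoundedDerivs A) (hB : BoundedDerivs B) :
    ContDiff ℝ ∞
      (fun p : Fin 2 → ℝ => ∫ w, u w * (A 0 (α w * p 0) * B 0 (β w * p 1)) ∂μ) := by
  refine contDiff_infty.2 fun n => ?_
  induction n generalizing u A B with
  | zero =>
    exact contDiff_zero.2 (continuous_iff_continuousAt.2 fun x =>
      (hasFDerivAt_phase_integral hu hα hβ hA hB x).continuousAt)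
  | succ n ih =>
    refine contDiff_succ_iff_fderiv_apply.2
      ⟨fun x => (hasFDerivAt_phase_integral hu hα hβ hA hB x).differentiableAt,
        fun h => absurd h (WithTop.natCast_ne_top n), fun y => ?_⟩
    have h := ((ih hu.mul_left hA.succ hB).const_smul (y 0)).add
      ((ih hu.mul_right hA hB.succ).const_smul (y 1))
    convert h using 2 with x
    rw [(hasFDerivAt_phase_integral hu hα hβ hA hB x).fderiv]
    simp

end

theorem boundedDerivs_exp :
    BoundedDerivs fun n s => Complex.I ^ n * Complex.exp (s * Complex.I) := by
  refine ⟨fun n s => ?_, fun n => ⟨1, fun s => ?_⟩⟩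
  · have h1 : HasDerivAt (fun s : ℝ => (s : ℂ) * Complex.I) (1 * Complex.I) s :=
      (Complex.ofRealCLM.hasDerivAt (x := s)).mul_const Complex.I
    refine (h1.cexp.const_mul _).congr_deriv ?_
    ring
  · simp [Complex.norm_exp_ofReal_mul_I]

theorem boundedDerivs_cosSqrtCutoff :
    BoundedDerivs fun n s => ((iteratedDeriv n cosSqrtCutoff s : ℝ) : ℂ) := by
  refine ⟨fun n s => (hasDerivAt_iteratedDeriv contDiff_cosSqrtCutoff n s).ofReal_comp, fun n => ?_⟩
  obtain ⟨K, hK⟩ := cosSqrtCutoff_bound n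
  exact ⟨K, fun s => by simpa using hK s⟩

theorem exp_mul_I_eq_cosSqrtCutoff (b y : ℝ) :
    Complex.exp ((b * y : ℝ) * Complex.I) =
      ((iteratedDeriv 0 cosSqrtCutoff (b ^ 2 * y ^ 2) : ℝ) : ℂ) -
        y * (2 * b * Complex.I * (iteratedDeriv 1 cosSqrtCutoff (b ^ 2 * y ^ 2) : ℝ)) := by
  have h : 0 ≤ b ^ 2 * y ^ 2 := by positivity
  rw [iteratedDeriv_cosSqrtCutoff 0 h, iteratedDeriv_cosSqrtCutoff 1 h, iteratedDeriv_zero,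
    ← mul_pow, cosSqrt_sq, Complex.exp_mul_I, ← Complex.ofReal_cos, ← Complex.ofReal_sin]
  have h2 : (2 * (b * y) * (iteratedDeriv 1 cosSqrt ((b * y) ^ 2) : ℝ) : ℂ) = -Real.sin (b * y) := by
    exact_mod_cast two_mul_iteratedDeriv_cosSqrt (b * y)
  push_cast at h2 ⊢
  linear_combination Complex.I * h2

open scoped SchwartzMap in
theorem finiteMoments_schwartz (g : 𝓢(EuclideanSpace ℝ (Fin 2), ℂ)) :
    FiniteMoments volume (fun w : EuclideanSpace ℝ (Fin 2) => 2 * Real.pi * w 0)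
      (fun w : EuclideanSpace ℝ (Fin 2) => (2 * Real.pi * w 1) ^ 2) g := by
  intro i j
  refine ((g.integrable_pow_mul volume (i + 2 * j)).const_mul
    ((2 * Real.pi) ^ i * (2 * Real.pi) ^ (2 * j))).mono' ?_ (Eventually.of_forall fun w => ?_)
  · exact (Continuous.mul (by fun_prop) g.continuous).aestronglyMeasurable
  · have h0 : |w 0| ≤ ‖w‖ := PiLp.norm_apply_le w 0
    have h1 : |w 1| ≤ ‖w‖ := PiLp.norm_apply_le w 1
    have hpi : 0 ≤ 2 * Real.pi := by positivity
    rw [norm_mul, norm_mul, norm_pow, norm_pow, Complex.norm_real, Complex.norm_real,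
      norm_pow, ← pow_mul, Real.norm_eq_abs, Real.norm_eq_abs, abs_mul _ (w 0), abs_mul _ (w 1),
      abs_of_nonneg hpi,
      mul_pow _ |w 0|, mul_pow _ |w 1|, pow_add ‖w‖]
    calc (2 * Real.pi) ^ i * |w 0| ^ i * ((2 * Real.pi) ^ (2 * j) * |w 1| ^ (2 * j)) * ‖g w‖
        ≤ (2 * Real.pi) ^ i * ‖w‖ ^ i * ((2 * Real.pi) ^ (2 * j) * ‖w‖ ^ (2 * j)) * ‖g w‖ := by
          gcongr
      _ = _ := by ring

/-- **Whitney's theorem on even functions**, in the form of a division theorem: a smooth germ of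
two variables is `E(x, y²) + y O(x, y²)` with `E` and `O` smooth on the whole plane. -/
theorem SmoothGerm.exists_even_odd {F : (Fin 2 → ℝ) → ℝ} (hF : SmoothGerm F) :
    ∃ E O : (Fin 2 → ℝ) → ℝ, ContDiff ℝ ∞ E ∧ ContDiff ℝ ∞ O ∧
      ∀ᶠ p in 𝓝 (0 : Fin 2 → ℝ), F p = E ![p 0, p 1 ^ 2] + p 1 * O ![p 0, p 1 ^ 2] := by
  obtain ⟨K, hK, hKc, hKF, -⟩ := hF.exists_cutoff univ_mem
  let e := EuclideanSpace.equiv (Fin 2) ℝ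
  let f : EuclideanSpace ℝ (Fin 2) → ℂ := fun w => (K (e w) : ℂ)
  have hf : ContDiff ℝ ∞ f := Complex.ofRealCLM.contDiff.comp (hK.comp e.contDiff)
  have hfc : HasCompactSupport f :=
    (hKc.comp_homeomorph e.toHomeomorph).comp_left (g := fun x : ℝ => (x : ℂ)) (by simp)
  let g := 𝓕 (hfc.toSchwartzMap hf)
  let α : EuclideanSpace ℝ (Fin 2) → ℝ := fun w => 2 * Real.pi * w 0
  let β : EuclideanSpace ℝ (Fin 2) → ℝ := fun w => 2 * Real.pi * w 1
  have hα : Continuous α := by fun_prop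
  have hβ : Continuous fun w => β w ^ 2 := by fun_prop
  have hg : FiniteMoments volume α (fun w => β w ^ 2) g := finiteMoments_schwartz g
  have hg' : FiniteMoments volume α (fun w => β w ^ 2)
      (fun w => -(2 * β w * Complex.I) * g w) := by
    intro i j
    have h1 := hg i j
    have h2 := hg i (j + 1)
    have h3 := h1.norm.add h2.norm
    refine (h3.const_mul 2).mono' ?_ (Eventually.of_forall fun w => ?_)
    · exact (Continuous.mul (by fun_prop) (Continuous.mul (by fun_prop)
        g.continuous)).aestronglyMeasurable
    · have hb : |β w| ≤ 1 + β w ^ 2 := by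
        nlinarith [sq_abs (β w), sq_nonneg (|β w| - 1), abs_nonneg (β w)]
      simp only [Pi.add_apply, norm_mul, norm_neg, norm_pow, Complex.norm_real, Real.norm_eq_abs,
        Complex.norm_I, Complex.norm_ofNat, mul_one, pow_succ, one_mul,
        pow_zero]
      have h4 : |β w| * |β w| = β w ^ 2 := by rw [← sq, sq_abs]
      rw [h4]
      have h5 : 0 ≤ |α w| ^ i * (β w ^ 2) ^ j * ‖g w‖ := by positivity
      nlinarith [mul_le_mul_of_nonneg_left hb h5]
  have hE := contDiff_phase_integral hg hα hβ boundedDerivs_exp boundedDerivs_cosSqrtCutoff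
  have hO := contDiff_phase_integral hg' hα hβ boundedDerivs_exp boundedDerivs_cosSqrtCutoff.succ
  refine ⟨_, _, Complex.reCLM.contDiff.comp hE, Complex.reCLM.contDiff.comp hO, ?_⟩
  filter_upwards [hKF] with p hp
  rw [← hp]
  have hinv : f (e.symm p) = ∫ w, g w * (Complex.exp ((α w * p 0 : ℝ) * Complex.I) *
      Complex.exp ((β w * p 1 : ℝ) * Complex.I)) := by
    have h1 : (𝓕⁻ g) (e.symm p) = f (e.symm p) := by
      simp only [g, FourierTransform.fourierInv_fourier_eq]
      rfl
    rw [← h1, SchwartzMap.fourierInv_coe, Real.fourierInv_eq']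
    refine integral_congr_ae (Eventually.of_forall fun w => ?_)
    simp only [smul_eq_mul]
    rw [mul_comm, ← Complex.exp_add]
    congr 2
    have h2 : inner ℝ w (e.symm p) = p 0 * w 0 + p 1 * w 1 := by
      rw [PiLp.inner_apply, Fin.sum_univ_two]
      rfl
    rw [h2]
    simp only [α, β]
    push_cast
    ring
  have hre : K p = (f (e.symm p)).re := by simp [f]
  rw [hre, hinv]
  have h1 := hg.integrable_mul hα hβ boundedDerivs_exp boundedDerivs_cosSqrtCutoff
    ![p 0, p 1 ^ 2] 0 0
  have h2 := hg'.integrable_mul hα hβ boundedDerivs_exp boundedDerivs_cosSqrtCutoff.succ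
    ![p 0, p 1 ^ 2] 0 0
  have h3 : (∫ w, g w * (Complex.exp ((α w * p 0 : ℝ) * Complex.I) *
      Complex.exp ((β w * p 1 : ℝ) * Complex.I))) = _ :=
    (integral_congr_ae (Eventually.of_forall fun w => ?_)).trans
      (integral_add h1 (h2.const_mul (p 1 : ℂ)))
  · rw [h3, integral_const_mul, Complex.add_re, Complex.re_ofReal_mul]
    rfl
  · simp only [Matrix.cons_val_zero, Matrix.cons_val_one, pow_zero,
      one_mul, zero_add]
    rw [exp_mul_I_eq_cosSqrtCutoff (β w) (p 1)]
    ring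

end MapGerm

namespace MapGerm

/-! ### Germs of diffeomorphisms and `𝒜`-equivalence -/

/-- **Inverse function theorem** for germs: a smooth germ fixing the origin whose derivative there
is injective is the germ of a diffeomorphism. -/
theorem isDiffeo_of_injective {n : ℕ} {d : (Fin n → ℝ) → (Fin n → ℝ)} (hd : SmoothGerm d)
    (h0 : d 0 = 0) (hinj : ∀ v, fderiv ℝ d 0 v = 0 → v = 0) : IsDiffeo d := by
  let L : (Fin n → ℝ) ≃L[ℝ] (Fin n → ℝ) :=
    (LinearEquiv.ofInjectiveEndo (fderiv ℝ d 0 : (Fin n → ℝ) →ₗ[ℝ] (Fin n → ℝ))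
      ((injective_iff_map_eq_zero _).2 hinj)).toContinuousLinearEquiv
  have hL : (L : (Fin n → ℝ) →L[ℝ] (Fin n → ℝ)) = fderiv ℝ d 0 := by
    ext v : 1
    rfl
  have hderiv : HasFDerivAt d (L : (Fin n → ℝ) →L[ℝ] (Fin n → ℝ)) 0 := by
    rw [hL]
    exact hd.differentiableAt.hasFDerivAt
  let Φ := hd.contDiffAt.toOpenPartialHomeomorph d hderiv (by simp)
  have hΦ : (Φ : (Fin n → ℝ) → (Fin n → ℝ)) = d :=
    hd.contDiffAt.toOpenPartialHomeomorph_coe hderiv (by simp)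
  have hs : (0 : Fin n → ℝ) ∈ Φ.source :=
    hd.contDiffAt.mem_toOpenPartialHomeomorph_source hderiv (by simp)
  have ht : (0 : Fin n → ℝ) ∈ Φ.target := by
    simpa [hΦ, h0] using Φ.map_source hs
  have he0 : Φ.symm 0 = 0 := by
    have := Φ.left_inv hs
    rwa [hΦ, h0] at this
  have hec : Tendsto Φ.symm (𝓝 0) (𝓝 0) := by
    have := Φ.symm.continuousAt ht
    rwa [ContinuousAt, he0] at this
  have hinv : ∀ᶠ p in 𝓝 (0 : Fin n → ℝ), ∃ M : (Fin n → ℝ) ≃L[ℝ] (Fin n → ℝ),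
      (M : (Fin n → ℝ) →L[ℝ] (Fin n → ℝ)) = fderiv ℝ d p := by
    have h1 := ContinuousLinearEquiv.nhds L
    rw [hL] at h1
    exact hd.fderiv_right.continuousAt.eventually h1
  refine ⟨hd, h0, Φ.symm, ?_, he0, ?_, ?_⟩
  · filter_upwards [hec.eventually (hd.and hinv), Φ.open_target.mem_nhds ht] with q hq hqt
    obtain ⟨hq1, M, hM⟩ := hq
    refine Φ.contDiffAt_symm (f₀' := M) hqt ?_ (by rwa [hΦ])
    rw [hM, hΦ]
    exact (hq1.differentiableAt (by simp)).hasFDerivAt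
  · filter_upwards [Φ.open_source.mem_nhds hs] with p hp
    have := Φ.left_inv hp
    rwa [hΦ] at this
  · filter_upwards [Φ.open_target.mem_nhds ht] with p hp
    have := Φ.right_inv hp
    rwa [hΦ] at this

theorem IsDiffeo.tendsto {n : ℕ} {d : (Fin n → ℝ) → (Fin n → ℝ)} (h : IsDiffeo d) :
    Tendsto d (𝓝 0) (𝓝 0) := by
  have := SmoothGerm.continuousAt h.1
  rwa [ContinuousAt, h.2.1] at this

theorem IsDiffeo.exists_inverse {n : ℕ} {d : (Fin n → ℝ) → (Fin n → ℝ)} (h : IsDiffeo d) :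
    ∃ e, IsDiffeo e ∧ (∀ᶠ p in 𝓝 (0 : Fin n → ℝ), e (d p) = p) ∧
      ∀ᶠ p in 𝓝 (0 : Fin n → ℝ), d (e p) = p := by
  obtain ⟨h1, h2, e, h3, h4, h5, h6⟩ := h
  exact ⟨e, ⟨h3, h4, d, h1, h2, h6, h5⟩, h5, h6⟩

theorem IsDiffeo.id (n : ℕ) : IsDiffeo (fun p : Fin n → ℝ => p) :=
  ⟨contDiff_id.smoothGerm, rfl, _, contDiff_id.smoothGerm, rfl, Eventually.of_forall fun _ => rfl,
    Eventually.of_forall fun _ => rfl⟩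

theorem IsDiffeo.comp {n : ℕ} {d d' : (Fin n → ℝ) → (Fin n → ℝ)} (h : IsDiffeo d)
    (h' : IsDiffeo d') : IsDiffeo (fun p => d (d' p)) := by
  obtain ⟨e, he, h1, h2⟩ := h.exists_inverse
  obtain ⟨e', he', h1', h2'⟩ := h'.exists_inverse
  refine ⟨SmoothGerm.comp h.1 h'.1 h'.2.1, by simp [h.2.1, h'.2.1], fun p => e' (e p),
    SmoothGerm.comp he'.1 he.1 he.2.1, by simp [he.2.1, he'.2.1], ?_, ?_⟩
  · filter_upwards [h1', h'.tendsto.eventually h1] with p hp hq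
    rw [hq, hp]
  · filter_upwards [h2, he.tendsto.eventually h2'] with p hp hq
    rw [hq, hp]

/-- The derivative of a diffeomorphism germ at the origin is injective. -/
theorem IsDiffeo.injective_fderiv {n : ℕ} {d : (Fin n → ℝ) → (Fin n → ℝ)} (h : IsDiffeo d)
    {v : Fin n → ℝ} (hv : fderiv ℝ d 0 v = 0) : v = 0 := by
  obtain ⟨e, he, h1, -⟩ := h.exists_inverse
  have h2 : HasFDerivAt (fun p => e (d p)) ((fderiv ℝ e 0).comp (fderiv ℝ d 0)) 0 := by
    have h3 : HasFDerivAt e (fderiv ℝ e 0) (d 0) := by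
      rw [h.2.1]
      exact (SmoothGerm.differentiableAt he.1).hasFDerivAt
    exact h3.comp 0 (SmoothGerm.differentiableAt h.1).hasFDerivAt
  have h4 := h2.unique ((hasFDerivAt_id (𝕜 := ℝ) (0 : Fin n → ℝ)).congr_of_eventuallyEq h1)
  have h5 := congrArg (fun A => A v) h4
  simpa [hv] using h5.symm

theorem AEquiv.of_eventuallyEq {f g : (Fin 2 → ℝ) → (Fin 3 → ℝ)} (h : f =ᶠ[𝓝 0] g) :
    AEquiv f g :=
  ⟨_, _, IsDiffeo.id 2, IsDiffeo.id 3, h⟩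

theorem AEquiv.symm {f g : (Fin 2 → ℝ) → (Fin 3 → ℝ)} (h : AEquiv f g) (hf : IsSmooth f)
    (hf0 : f 0 = 0) : AEquiv g f := by
  obtain ⟨ds, dt, hs, ht, h⟩ := h
  obtain ⟨es, hes, -, hs2⟩ := hs.exists_inverse
  obtain ⟨et, het, ht1, -⟩ := ht.exists_inverse
  refine ⟨es, et, hes, het, ?_⟩
  have hfc : Tendsto f (𝓝 0) (𝓝 0) := by
    have := SmoothGerm.continuousAt hf
    rwa [ContinuousAt, hf0] at this
  filter_upwards [hs2, hes.tendsto.eventually h,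
    hes.tendsto.eventually (hfc.eventually ht1)] with p h1 h2 h3
  rw [← h3, h2, h1]

theorem AEquiv.trans {f g k : (Fin 2 → ℝ) → (Fin 3 → ℝ)} (h : AEquiv f g) (h' : AEquiv g k) :
    AEquiv f k := by
  obtain ⟨ds, dt, hs, ht, h⟩ := h
  obtain ⟨ds', dt', hs', ht', h'⟩ := h'
  refine ⟨_, _, hs'.comp hs, ht'.comp ht, ?_⟩
  filter_upwards [h, hs.tendsto.eventually h'] with p hp hq
  rw [hp, hq]

/-- A change of coordinates in the source. -/
theorem AEquiv.of_source {f : (Fin 2 → ℝ) → (Fin 3 → ℝ)} {d : (Fin 2 → ℝ) → (Fin 2 → ℝ)}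
    (hd : IsDiffeo d) : AEquiv (fun p => f (d p)) f :=
  ⟨d, _, hd, IsDiffeo.id 3, Eventually.of_forall fun _ => rfl⟩

/-- A change of coordinates in the target. -/
theorem AEquiv.of_target {f : (Fin 2 → ℝ) → (Fin 3 → ℝ)} {d : (Fin 3 → ℝ) → (Fin 3 → ℝ)}
    (hd : IsDiffeo d) : AEquiv f (fun p => d (f p)) :=
  ⟨_, d, IsDiffeo.id 2, hd, Eventually.of_forall fun _ => rfl⟩

/-! ### The Morse lemma with a parameter -/

theorem fderiv_component {E : Type*} [NormedAddCommGroup E] [NormedSpace ℝ E] {n : ℕ}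
    {d : E → Fin n → ℝ} {p : E} (hd : DifferentiableAt ℝ d p) (v : E) (i : Fin n) :
    fderiv ℝ (fun q => d q i) p v = fderiv ℝ d p v i := by
  rw [(hasFDerivAt_pi'.1 hd.hasFDerivAt i).fderiv]
  rfl

theorem fderiv_coord {n : ℕ} (i : Fin n) (p v : Fin n → ℝ) :
    fderiv ℝ (fun q : Fin n → ℝ => q i) p v = v i := by
  rw [fderiv_component (d := fun q => q) differentiableAt_id, fderiv_fun_id]
  rfl

theorem eq_smul_add_smul (v : Fin 2 → ℝ) : v = v 0 • ![1, 0] + v 1 • ![0, 1] := by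
  ext i; fin_cases i <;> simp

theorem fderiv_mul_coord {F H : (Fin 2 → ℝ) → ℝ} {p : Fin 2 → ℝ}
    (h : F =ᶠ[𝓝 p] fun q => q 1 * H q) (hH : DifferentiableAt ℝ H p) :
    fderiv ℝ F p ![0, 1] = H p + p 1 * fderiv ℝ H p ![0, 1] := by
  rw [h.fderiv_eq, fderiv_fun_mul (by fun_prop) hH]
  simp [fderiv_coord]
  ring

/-- The derivative in the direction of the second axis, as a derivative along the line. -/
theorem fderiv_eq_deriv_line {E : Type*} [NormedAddCommGroup E] [NormedSpace ℝ E]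
    {F : (Fin 2 → ℝ) → E} {p : Fin 2 → ℝ} (hF : DifferentiableAt ℝ F p) :
    fderiv ℝ F p ![0, 1] = deriv (fun t : ℝ => F ![p 0, p 1 + t]) 0 := by
  rw [← hF.lineDeriv_eq_fderiv, lineDeriv]
  congr 2 with t
  congr 1
  ext i; fin_cases i <;> simp

theorem tendsto_vec2 {l : Filter (Fin 2 → ℝ)} {u v : (Fin 2 → ℝ) → ℝ} {a b : ℝ}
    (hu : Tendsto u l (𝓝 a)) (hv : Tendsto v l (𝓝 b)) :
    Tendsto (fun p => ![u p, v p]) l (𝓝 ![a, b]) := by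
  refine tendsto_pi_nhds.2 fun i => ?_
  fin_cases i <;> simpa

theorem vec2_zero : (![0, 0] : Fin 2 → ℝ) = 0 := by
  ext i; fin_cases i <;> rfl

theorem tendsto_coord (i : Fin 2) : Tendsto (fun p : Fin 2 → ℝ => p i) (𝓝 0) (𝓝 0) := by
  have := (continuous_apply i).tendsto (0 : Fin 2 → ℝ)
  simpa using this

/-- **Morse lemma with a parameter**: if `∂G/∂y` vanishes at the origin and `σ ∂²G/∂y² > 0` there,
then `G(x, y) = c(x) + σ Y(x, y)²`, where `(x, Y)` are local coordinates. -/
theorem SmoothGerm.exists_morse {G : (Fin 2 → ℝ) → ℝ} (hG : SmoothGerm G) {σ : ℝ}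
    (hσ : σ ^ 2 = 1) (h1 : fderiv ℝ G 0 ![0, 1] = 0)
    (h2 : 0 < σ * fderiv ℝ (fun p => fderiv ℝ G p ![0, 1]) 0 ![0, 1]) :
    ∃ (c : ℝ → ℝ) (Y : (Fin 2 → ℝ) → ℝ), SmoothGerm c ∧ SmoothGerm Y ∧ Y 0 = 0 ∧
      0 < fderiv ℝ Y 0 ![0, 1] ∧ ∀ᶠ p in 𝓝 (0 : Fin 2 → ℝ), G p = c (p 0) + σ * Y p ^ 2 := by
  set G1 : (Fin 2 → ℝ) → ℝ := fun p => fderiv ℝ G p ![0, 1] with hG1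
  have hG1s : SmoothGerm G1 := hG.fderiv_apply (SmoothGerm.const _)
  -- the curve `y = s(x)` of critical points, from the inverse of `(x, y) ↦ (x, G_y)`
  have hd : IsDiffeo fun p : Fin 2 → ℝ => ![p 0, G1 p] := by
    have hds : SmoothGerm fun p : Fin 2 → ℝ => ![p 0, G1 p] := (SmoothGerm.coord 0).vec2 hG1s
    refine isDiffeo_of_injective hds ?_ fun v hv => ?_
    · simp only [Pi.zero_apply]
      rw [show G1 0 = 0 from h1, vec2_zero]
    · have hv0 := fderiv_component hds.differentiableAt v 0
      have hv1 := fderiv_component hds.differentiableAt v 1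
      rw [hv] at hv0 hv1
      simp only [Matrix.cons_val_zero, Matrix.cons_val_one, Pi.zero_apply] at hv0 hv1
      rw [fderiv_coord] at hv0
      rw [eq_smul_add_smul v, map_add, map_smul, map_smul, hv0] at hv1
      have : v 1 = 0 := by
        rw [zero_smul, zero_add, smul_eq_mul] at hv1
        rcases mul_eq_zero.1 hv1 with h | h
        · exact h
        · rw [h, mul_zero] at h2
          exact absurd h2 (lt_irrefl _)
      rw [eq_smul_add_smul v, hv0, this]
      simp
  obtain ⟨e, he, -, hde⟩ := hd.exists_inverse
  let s : ℝ → ℝ := fun x => e ![x, 0] 1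
  have haxis : SmoothGerm fun x : ℝ => ![x, 0] := contDiff_id.smoothGerm.vec2 (SmoothGerm.const 0)
  have hss : SmoothGerm s := (SmoothGerm.comp he.1 haxis vec2_zero).apply 1
  have hs0 : s 0 = 0 := by simp only [s, vec2_zero, he.2.1, Pi.zero_apply]
  have hcrit : ∀ᶠ x in 𝓝 (0 : ℝ), G1 ![x, s x] = 0 := by
    have ht : Tendsto (fun x : ℝ => (![x, 0] : Fin 2 → ℝ)) (𝓝 0) (𝓝 0) := by
      have := haxis.continuousAt
      rwa [ContinuousAt, vec2_zero] at this
    filter_upwards [ht.eventually hde] with x hx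
    have h0 : e ![x, 0] 0 = x := by simpa using congrFun hx 0
    have h3 : ![x, s x] = e ![x, 0] := by
      rw [← vec2_eta (e ![x, 0]), h0]
    rw [h3]
    simpa using congrFun hx 1
  have hsx : SmoothGerm fun p : Fin 2 → ℝ => s (p 0) := hss.comp (SmoothGerm.coord 0) rfl
  let m : (Fin 2 → ℝ) → Fin 2 → ℝ := fun p => ![p 0, s (p 0) + p 1]
  have hm : SmoothGerm m := (SmoothGerm.coord 0).vec2 (hsx.add (SmoothGerm.coord 1))
  have hm0 : m 0 = 0 := by simp [m, hs0, vec2_zero]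
  have hmt : Tendsto m (𝓝 0) (𝓝 0) := by
    have := hm.continuousAt
    rwa [ContinuousAt, hm0] at this
  let n : (Fin 2 → ℝ) → Fin 2 → ℝ := fun p => ![p 0, s (p 0)]
  have hn : SmoothGerm n := (SmoothGerm.coord 0).vec2 hsx
  have hn0 : n 0 = 0 := by simp [n, hs0, vec2_zero]
  let K : (Fin 2 → ℝ) → ℝ := fun p => G (m p) - G (n p)
  have hK : SmoothGerm K := (hG.comp hm hm0).sub (hG.comp hn hn0)
  -- derivatives in `y` commute with the shear `m`
  have hline : ∀ F : (Fin 2 → ℝ) → ℝ, SmoothGerm F → ∀ᶠ p in 𝓝 (0 : Fin 2 → ℝ), ∀ a : ℝ → ℝ,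
      DifferentiableAt ℝ (fun q => F (m q) - a (q 0)) p →
      fderiv ℝ (fun q => F (m q) - a (q 0)) p ![0, 1] = fderiv ℝ F (m p) ![0, 1] := by
    intro F hF
    filter_upwards [hmt.eventually hF.eventually_differentiableAt] with p hp a ha
    rw [fderiv_eq_deriv_line ha, fderiv_eq_deriv_line hp]
    simp [m, add_assoc]
  have hDK : ∀ᶠ p in 𝓝 (0 : Fin 2 → ℝ), fderiv ℝ K p ![0, 1] = G1 (m p) := by
    filter_upwards [hline G hG, hK.eventually_differentiableAt] with p hp hq
    exact hp (fun x => G ![x, s x]) hq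
  obtain ⟨K1, hK1, hKK1⟩ := hK.exists_eq_mul (Eventually.of_forall fun p => by simp [K, m, n])
  have hDK1 : ∀ᶠ p in 𝓝 (0 : Fin 2 → ℝ),
      fderiv ℝ K p ![0, 1] = K1 p + p 1 * fderiv ℝ K1 p ![0, 1] := by
    filter_upwards [hKK1.eventually_nhds, hK1.eventually_differentiableAt] with p hp hq
    exact fderiv_mul_coord hp hq
  have haxis2 : Tendsto (fun p : Fin 2 → ℝ => (![p 0, 0] : Fin 2 → ℝ)) (𝓝 0) (𝓝 0) := by
    have := tendsto_vec2 (tendsto_coord 0) (tendsto_const_nhds (x := (0 : ℝ)))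
    rwa [vec2_zero] at this
  obtain ⟨K2, hK2, hKK2⟩ := hK1.exists_eq_mul (by
    filter_upwards [haxis2.eventually hDK1, haxis2.eventually hDK,
      (tendsto_coord 0).eventually hcrit] with p hp hq hr
    rw [hq] at hp
    simp only [m, Matrix.cons_val_zero, Matrix.cons_val_one, add_zero, zero_mul] at hp
    rw [← hp, hr])
  have hK20 : fderiv ℝ G1 0 ![0, 1] = 2 * K2 0 := by
    have e1 := (hline G1 hG1s).self_of_nhds (fun _ => 0)
      ((hG1s.comp hm hm0).differentiableAt.sub_const 0)
    simp only [sub_zero, hm0] at e1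
    have e2 : (fun p => G1 (m p)) =ᶠ[𝓝 0]
        fun p => p 1 * (2 * K2 p + p 1 * fderiv ℝ K2 p ![0, 1]) := by
      filter_upwards [hDK, hDK1, hKK2, hKK2.eventually_nhds,
        hK2.eventually_differentiableAt] with p h3 h4 h5 h6 h7
      rw [← h3, h4, fderiv_mul_coord h6 h7, h5]
      ring
    rw [← e1, fderiv_mul_coord e2]
    · simp
    · exact (((SmoothGerm.const 2).mul hK2).add ((SmoothGerm.coord 1).mul
        (hK2.fderiv_apply (SmoothGerm.const _)))).differentiableAt
  have hK2pos : 0 < σ * K2 0 := by rw [hK20] at h2; linarith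
  let m' : (Fin 2 → ℝ) → Fin 2 → ℝ := fun p => ![p 0, p 1 - s (p 0)]
  have hm' : SmoothGerm m' := (SmoothGerm.coord 0).vec2 ((SmoothGerm.coord 1).sub hsx)
  have hm'0 : m' 0 = 0 := by simp [m', hs0, vec2_zero]
  have hm't : Tendsto m' (𝓝 0) (𝓝 0) := by
    have := hm'.continuousAt
    rwa [ContinuousAt, hm'0] at this
  have hσK : SmoothGerm fun p => σ * K2 (m' p) := (SmoothGerm.const σ).mul (hK2.comp hm' hm'0)
  have hR : SmoothGerm fun p => Real.sqrt (σ * K2 (m' p)) :=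
    hσK.sqrt (by rw [hm'0]; exact hK2pos.ne')
  have hA : SmoothGerm fun p : Fin 2 → ℝ => p 1 - s (p 0) := (SmoothGerm.coord 1).sub hsx
  refine ⟨fun x => G ![x, s x], fun p => (p 1 - s (p 0)) * Real.sqrt (σ * K2 (m' p)), ?_,
    hA.mul hR, ?_, ?_, ?_⟩
  · exact hG.comp (contDiff_id.smoothGerm.vec2 hss) (by simp [hs0, vec2_zero])
  · simp [hs0]
  · rw [fderiv_fun_mul hA.differentiableAt hR.differentiableAt]
    simp only [Pi.zero_apply, hs0, sub_zero, zero_smul, zero_add, hm'0,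
      smul_apply, smul_eq_mul]
    rw [fderiv_eq_deriv_line hA.differentiableAt]
    simp [hK2pos]
  · have hpos : ∀ᶠ p in 𝓝 (0 : Fin 2 → ℝ), 0 < σ * K2 (m' p) :=
      hσK.continuousAt.eventually (lt_mem_nhds (by simpa only [hm'0] using hK2pos))
    filter_upwards [hm't.eventually hKK1, hm't.eventually hKK2, hpos] with p h3 h4 h5
    rw [mul_pow, Real.sq_sqrt h5.le]
    rw [h4] at h3
    have h6 : K (m' p) = G p - G ![p 0, s (p 0)] := by
      simp [K, m, n, m', vec2_eta]
    have h7 : m' p 1 = p 1 - s (p 0) := rfl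
    rw [h6, h7] at h3
    linear_combination h3 - (p 1 - s (p 0)) ^ 2 * K2 (m' p) * hσ

end MapGerm

namespace MapGerm

open Asymptotics

/-! ### Leading quadratic forms -/

/-- `φ` agrees with the quadratic form `a x² + 2 b x y + c y²` up to `o(|p|²)` at the origin. -/
def HasQuad (φ : (Fin 2 → ℝ) → ℝ) (a b c : ℝ) : Prop :=
  (fun p => φ p - (a * p 0 ^ 2 + 2 * b * p 0 * p 1 + c * p 1 ^ 2)) =o[𝓝 0] fun p => ‖p‖ ^ 2

/-- `φ` has a nondegenerate quadratic form as leading term at the origin, and the discriminant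
`ac - b²` of the form has the sign of `s`. For smooth `φ` this is the condition on the gradient and
the Hessian (`qSign_iff`), stated without derivatives so that it can be transported. -/
def QSign (s : ℝ) (φ : (Fin 2 → ℝ) → ℝ) : Prop :=
  ∃ a b c : ℝ, HasQuad φ a b c ∧ 0 < s * (a * c - b ^ 2)

theorem eq_zero_of_isLittleO_sq {l q : ℝ}
    (h : (fun t : ℝ => l * t + q * t ^ 2) =o[𝓝 0] fun t => t ^ 2) : l = 0 ∧ q = 0 := by
  have h1 := (h.mono nhdsWithin_le_nhds : _ =o[𝓝[≠] (0 : ℝ)] _).tendsto_div_nhds_zero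
  have hid : Tendsto (fun t : ℝ => t) (𝓝[≠] 0) (𝓝 0) := tendsto_id.mono_left nhdsWithin_le_nhds
  have hl : l = 0 := by
    have h2 : Tendsto (fun t : ℝ => l + q * t) (𝓝[≠] 0) (𝓝 (0 * 0)) := by
      refine (h1.mul hid).congr' ?_
      filter_upwards [self_mem_nhdsWithin] with t ht
      have : t ≠ 0 := ht
      field_simp
    have h3 : Tendsto (fun t : ℝ => l + q * t) (𝓝[≠] 0) (𝓝 (l + q * 0)) :=
      (hid.const_mul q).const_add l
    simpa using tendsto_nhds_unique h3 h2
  refine ⟨hl, ?_⟩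
  have h2 : Tendsto (fun _ : ℝ => q) (𝓝[≠] 0) (𝓝 0) := by
    refine h1.congr' ?_
    filter_upwards [self_mem_nhdsWithin] with t ht
    have : t ≠ 0 := ht
    rw [hl]
    field_simp
    ring
  exact tendsto_nhds_unique tendsto_const_nhds h2

/-- A polynomial of degree two without constant term that is `o(|p|²)` is zero. -/
theorem quad_unique {l m a b c : ℝ}
    (h : (fun p : Fin 2 → ℝ => l * p 0 + m * p 1 +
      (a * p 0 ^ 2 + 2 * b * p 0 * p 1 + c * p 1 ^ 2)) =o[𝓝 0] fun p => ‖p‖ ^ 2) :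
    l = 0 ∧ m = 0 ∧ a = 0 ∧ b = 0 ∧ c = 0 := by
  have key : ∀ x y : ℝ, l * x + m * y = 0 ∧ a * x ^ 2 + 2 * b * x * y + c * y ^ 2 = 0 := by
    intro x y
    have ht : Tendsto (fun t : ℝ => t • (![x, y] : Fin 2 → ℝ)) (𝓝 0) (𝓝 0) := by
      have : Continuous fun t : ℝ => t • (![x, y] : Fin 2 → ℝ) := by fun_prop
      simpa using this.tendsto 0
    refine eq_zero_of_isLittleO_sq ?_
    have h1 := h.comp_tendsto ht
    have h2 : ((fun p : Fin 2 → ℝ => ‖p‖ ^ 2) ∘ fun t : ℝ => t • (![x, y] : Fin 2 → ℝ)) =O[𝓝 0]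
        fun t => t ^ 2 := by
      refine IsBigO.of_bound (‖(![x, y] : Fin 2 → ℝ)‖ ^ 2) (Eventually.of_forall fun t => ?_)
      rw [Function.comp_apply, norm_pow, norm_norm, norm_smul, mul_pow, norm_pow, mul_comm]
    refine (h1.trans_isBigO h2).congr_left fun t => ?_
    simp
    ring
  have h1 := key 1 0
  have h2 := key 0 1
  have h3 := key 1 1
  norm_num at h1 h2 h3
  exact ⟨h1.1, h2.1, h1.2, by linarith [h1.2, h2.2, h3.2], h2.2⟩

theorem isLittleO_sq_of_fderiv {E : Type*} [NormedAddCommGroup E] [NormedSpace ℝ E]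
    {ψ : E → ℝ} {ψ' : E → E →L[ℝ] ℝ} (h : ∀ᶠ p in 𝓝 (0 : E), HasFDerivAt ψ (ψ' p) p)
    (h0 : ψ 0 = 0) (ho : ψ' =o[𝓝 0] fun p => p) : ψ =o[𝓝 0] fun p => ‖p‖ ^ 2 := by
  refine isLittleO_iff.2 fun ε hε => ?_
  obtain ⟨r, hr, hb⟩ := Metric.eventually_nhds_iff_ball.1 (h.and (isLittleO_iff.1 ho hε))
  filter_upwards [Metric.ball_mem_nhds (0 : E) hr] with p hp
  have hsub : ∀ q ∈ Metric.closedBall (0 : E) ‖p‖, q ∈ Metric.ball (0 : E) r := fun q hq => by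
    rw [mem_ball_zero_iff] at hp ⊢
    exact (mem_closedBall_zero_iff.1 hq).trans_lt hp
  have h1 := (convex_closedBall (0 : E) ‖p‖).norm_image_sub_le_of_norm_hasFDerivWithin_le
    (f := ψ) (f' := ψ') (C := ε * ‖p‖) (x := 0) (y := p)
    (fun q hq => (hb q (hsub q hq)).1.hasFDerivWithinAt)
    (fun q hq => (hb q (hsub q hq)).2.trans
      (mul_le_mul_of_nonneg_left (mem_closedBall_zero_iff.1 hq) hε.le))
    (by simp) (by simp)
  rw [h0, sub_zero, sub_zero] at h1
  rw [norm_pow, norm_norm]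
  exact h1.trans (le_of_eq (by ring))

/-- Taylor's formula of order two at the origin. -/
theorem taylor_two {E : Type*} [NormedAddCommGroup E] [NormedSpace ℝ E]
    {φ : E → ℝ} (hφ : ContDiffAt ℝ 2 φ 0) :
    (fun p => φ p - (φ 0 + fderiv ℝ φ 0 p + fderiv ℝ (fderiv ℝ φ) 0 p p / 2)) =o[𝓝 0]
      fun p => ‖p‖ ^ 2 := by
  set B := fderiv ℝ (fderiv ℝ φ) 0
  have hsymm : ∀ v w, B v w = B w v := hφ.isSymmSndFDerivAt (by simp)
  have hd : ∀ᶠ p in 𝓝 (0 : E), DifferentiableAt ℝ φ p := by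
    filter_upwards [hφ.eventually (by simp)] with p hp using hp.differentiableAt (by simp)
  have hd2 : DifferentiableAt ℝ (fderiv ℝ φ) 0 :=
    (hφ.fderiv_right (m := 1) (by norm_num)).differentiableAt (by simp)
  refine isLittleO_sq_of_fderiv (ψ' := fun p => fderiv ℝ φ p - fderiv ℝ φ 0 - B p) ?_ (by simp) ?_
  · filter_upwards [hd] with p hp
    have h1 : HasFDerivAt (fun q => B q q) (B.flip p + B p) p := by
      refine (B.hasFDerivAt.clm_apply (hasFDerivAt_id p)).congr_fderiv ?_
      ext v
      simp [add_comm]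
    have h2 := hp.hasFDerivAt.sub (((fderiv ℝ φ 0).hasFDerivAt.const_add (φ 0)).add
      (h1.mul_const (1 / 2)))
    refine (h2.congr_fderiv ?_).congr_of_eventuallyEq (Eventually.of_forall fun q => ?_)
    · ext v
      simp [hsymm v p]
      ring
    · simp
      ring
  · simpa using hasFDerivAt_iff_isLittleO_nhds_zero.1 hd2.hasFDerivAt

theorem hess_apply {φ : (Fin 2 → ℝ) → ℝ} (hφ : ContDiffAt ℝ 2 φ 0) (i j : Fin 2) :
    hess φ i j = fderiv ℝ (fderiv ℝ φ) 0 (Pi.single i 1) (Pi.single j 1) := by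
  have hd2 : DifferentiableAt ℝ (fderiv ℝ φ) 0 :=
    (hφ.fderiv_right (m := 1) (by norm_num)).differentiableAt (by simp)
  rw [hess, Matrix.of_apply, fderiv_clm_apply hd2 (by fun_prop)]
  simp

theorem single_zero_eq : (Pi.single 0 1 : Fin 2 → ℝ) = ![1, 0] := by
  ext i; fin_cases i <;> simp

theorem single_one_eq : (Pi.single 1 1 : Fin 2 → ℝ) = ![0, 1] := by
  ext i; fin_cases i <;> simp

theorem qSign_iff {s : ℝ} {φ : (Fin 2 → ℝ) → ℝ} (hφ : ContDiffAt ℝ 2 φ 0) (h0 : φ 0 = 0) :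
    QSign s φ ↔ fderiv ℝ φ 0 = 0 ∧ 0 < s * (hess φ).det := by
  set B := fderiv ℝ (fderiv ℝ φ) 0 with hB
  have hsymm : ∀ v w, B v w = B w v := hφ.isSymmSndFDerivAt (by simp)
  have hT := taylor_two hφ
  have hT' : (fun p => φ p - (fderiv ℝ φ 0 ![1, 0] * p 0 + fderiv ℝ φ 0 ![0, 1] * p 1 +
      (B ![1, 0] ![1, 0] / 2 * p 0 ^ 2 + 2 * (B ![1, 0] ![0, 1] / 2) * p 0 * p 1 +
        B ![0, 1] ![0, 1] / 2 * p 1 ^ 2))) =o[𝓝 0] fun p => ‖p‖ ^ 2 := by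
    refine hT.congr_left fun p => ?_
    have h1 : fderiv ℝ φ 0 p = p 0 * fderiv ℝ φ 0 ![1, 0] + p 1 * fderiv ℝ φ 0 ![0, 1] := by
      conv_lhs => rw [eq_smul_add_smul p]
      simp only [map_add, map_smul, smul_eq_mul]
    have h2 : B p p = p 0 ^ 2 * B ![1, 0] ![1, 0] + 2 * p 0 * p 1 * B ![1, 0] ![0, 1] +
        p 1 ^ 2 * B ![0, 1] ![0, 1] := by
      conv_lhs => rw [eq_smul_add_smul p]
      simp only [map_add, map_smul, add_apply, smul_apply, smul_eq_mul]
      rw [hsymm ![0, 1] ![1, 0]]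
      ring
    rw [h0, h1, ← hB, h2]
    ring
  have hdet : (hess φ).det =
      B ![1, 0] ![1, 0] * B ![0, 1] ![0, 1] - B ![1, 0] ![0, 1] ^ 2 := by
    rw [Matrix.det_fin_two, hess_apply hφ, hess_apply hφ, hess_apply hφ, hess_apply hφ,
      single_zero_eq, single_one_eq, ← hB, hsymm ![0, 1] ![1, 0]]
    ring
  rw [hdet]
  constructor
  · rintro ⟨a, b, c, hq, hs⟩
    have h1 : (fun p : Fin 2 → ℝ => fderiv ℝ φ 0 ![1, 0] * p 0 + fderiv ℝ φ 0 ![0, 1] * p 1 +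
      ((B ![1, 0] ![1, 0] / 2 - a) * p 0 ^ 2 + 2 * (B ![1, 0] ![0, 1] / 2 - b) * p 0 * p 1 +
        (B ![0, 1] ![0, 1] / 2 - c) * p 1 ^ 2)) =o[𝓝 0] fun p => ‖p‖ ^ 2 :=
      (hq.sub hT').congr_left fun p => by ring
    obtain ⟨hl, hm, ha, hb, hc⟩ := quad_unique h1
    refine ⟨?_, ?_⟩
    · ext v
      rw [eq_smul_add_smul v, map_add, map_smul, map_smul, hl, hm]
      simp
    · rw [show B ![1, 0] ![1, 0] = 2 * a by linarith, show B ![0, 1] ![0, 1] = 2 * c by linarith,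
        show B ![1, 0] ![0, 1] = 2 * b by linarith]
      nlinarith
  · rintro ⟨hd, hs⟩
    refine ⟨B ![1, 0] ![1, 0] / 2, B ![1, 0] ![0, 1] / 2, B ![0, 1] ![0, 1] / 2, ?_, by nlinarith⟩
    refine hT'.congr_left fun p => ?_
    simp [hd]

theorem isBigO_coord (i : Fin 2) : (fun p : Fin 2 → ℝ => p i) =O[𝓝 0] fun p => ‖p‖ :=
  IsBigO.of_bound 1 (Eventually.of_forall fun p => by simpa using norm_le_pi_norm p i)

theorem HasQuad.isBigO {φ : (Fin 2 → ℝ) → ℝ} {a b c : ℝ} (h : HasQuad φ a b c) :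
    φ =O[𝓝 0] fun p => ‖p‖ ^ 2 := by
  have hq : ∀ i j : Fin 2, (fun p : Fin 2 → ℝ => p i * p j) =O[𝓝 0] fun p => ‖p‖ ^ 2 :=
    fun i j => ((isBigO_coord i).mul (isBigO_coord j)).congr_right fun p => (sq _).symm
  have h2 := (((hq 0 0).const_mul_left a).add ((hq 0 1).const_mul_left (2 * b))).add
    ((hq 1 1).const_mul_left c)
  exact ((IsLittleO.isBigO h).add h2).congr_left fun p => by ring

/-- Multiplication by a nonvanishing factor does not change the sign of the discriminant. -/
theorem QSign.of_isLittleO {s : ℝ} {φ ψ u : (Fin 2 → ℝ) → ℝ} (h : QSign s φ)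
    (hu : ContinuousAt u 0) (hu0 : u 0 ≠ 0)
    (ho : (fun p => ψ p - u p * φ p) =o[𝓝 0] fun p => ‖p‖ ^ 2) : QSign s ψ := by
  obtain ⟨a, b, c, hq, hs⟩ := h
  refine ⟨u 0 * a, u 0 * b, u 0 * c, ?_, ?_⟩
  · have h1 : (fun p => u p - u 0) =o[𝓝 0] fun _ => (1 : ℝ) := by
      rw [isLittleO_one_iff]
      simpa using hu.tendsto.sub_const (u 0)
    have h2 := (h1.mul_isBigO hq.isBigO).congr_right fun p => one_mul _
    exact ((ho.add h2).add (hq.const_mul_left (u 0))).congr_left fun p => by ring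
  · rw [show s * (u 0 * a * (u 0 * c) - (u 0 * b) ^ 2) = u 0 ^ 2 * (s * (a * c - b ^ 2)) by ring]
    positivity

theorem isBigO_of_differentiableAt {E F : Type*} [NormedAddCommGroup E] [NormedSpace ℝ E]
    [NormedAddCommGroup F] [NormedSpace ℝ F] {d : E → F}
    (hd : DifferentiableAt ℝ d 0) (h0 : d 0 = 0) : d =O[𝓝 0] fun p => ‖p‖ := by
  have := hd.hasFDerivAt.isBigO_sub
  simp only [h0, sub_zero] at this
  exact this.norm_right

theorem QSign.comp {s : ℝ} {φ : (Fin 2 → ℝ) → ℝ} {d : (Fin 2 → ℝ) → (Fin 2 → ℝ)} (h : QSign s φ)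
    (hd : DifferentiableAt ℝ d 0) (h0 : d 0 = 0) (hinj : ∀ v, fderiv ℝ d 0 v = 0 → v = 0) :
    QSign s (fun p => φ (d p)) := by
  obtain ⟨a, b, c, hq, hs⟩ := h
  set D := fderiv ℝ d 0
  set m := D ![1, 0] 0
  set n := D ![1, 0] 1
  set k := D ![0, 1] 0
  set l := D ![0, 1] 1
  have hD : ∀ p : Fin 2 → ℝ, D p = ![p 0 * m + p 1 * k, p 0 * n + p 1 * l] := by
    intro p
    conv_lhs => rw [eq_smul_add_smul p]
    rw [map_add, map_smul, map_smul]
    ext i; fin_cases i <;> simp [m, n, k, l]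
  have hdet : m * l - n * k ≠ 0 := by
    intro hz
    have h1 : (![l, -n] : Fin 2 → ℝ) = 0 := by
      refine hinj _ ?_
      rw [hD]
      ext i; fin_cases i
      · simp; linarith
      · simp; ring
    have h2 : (![-k, m] : Fin 2 → ℝ) = 0 := by
      refine hinj _ ?_
      rw [hD]
      ext i; fin_cases i
      · simp; ring
      · simp; linarith
    have hn : n = 0 := by simpa using congrFun h1 1
    have hm : m = 0 := by simpa using congrFun h2 1
    have h3 := hinj ![1, 0] (by rw [hD]; ext i; fin_cases i <;> simp [hm, hn])
    simpa using congrFun h3 0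
  refine ⟨a * m ^ 2 + 2 * b * m * n + c * n ^ 2,
    a * m * k + b * (m * l + n * k) + c * n * l, a * k ^ 2 + 2 * b * k * l + c * l ^ 2, ?_, ?_⟩
  · have hdO := isBigO_of_differentiableAt hd h0
    have hdt : Tendsto d (𝓝 0) (𝓝 0) := by
      have := hd.continuousAt
      rwa [ContinuousAt, h0] at this
    have h1 : (fun p => φ (d p) - (a * d p 0 ^ 2 + 2 * b * d p 0 * d p 1 + c * d p 1 ^ 2)) =o[𝓝 0]
        fun p => ‖p‖ ^ 2 := (hq.comp_tendsto hdt).trans_isBigO (hdO.norm_left.pow 2)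
    have hδ : ∀ i, (fun p => d p i - D p i) =o[𝓝 0] fun p => ‖p‖ := by
      intro i
      have h2 := hasFDerivAt_iff_isLittleO_nhds_zero.1 hd.hasFDerivAt
      simp only [zero_add, h0, sub_zero] at h2
      exact (isLittleO_pi.1 h2 i).norm_right
    have hc : ∀ i, (fun p => d p i) =O[𝓝 0] fun p => ‖p‖ := fun i => isBigO_pi.1 hdO i
    have hDc : ∀ i, (fun p => D p i) =O[𝓝 0] fun p => ‖p‖ := fun i =>
      isBigO_pi.1 (D.isBigO_id (𝓝 0)).norm_right i
    have hsq : ∀ {f g : (Fin 2 → ℝ) → ℝ}, f =o[𝓝 0] (fun p => ‖p‖) → g =O[𝓝 0] (fun p => ‖p‖) →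
        (fun p => f p * g p) =o[𝓝 0] fun p => ‖p‖ ^ 2 := fun hf hg =>
      (hf.mul_isBigO hg).congr_right fun p => (sq _).symm
    have h3 := (((hsq (hδ 0) ((hc 0).add (hDc 0))).const_mul_left a).add
      (((hsq (hδ 0) (hc 1)).add (hsq (hδ 1) (hDc 0))).const_mul_left (2 * b))).add
      ((hsq (hδ 1) ((hc 1).add (hDc 1))).const_mul_left c)
    refine (h1.add h3).congr_left fun p => ?_
    rw [hD]
    simp only [Matrix.cons_val_zero, Matrix.cons_val_one]
    ring
  · rw [show ∀ s : ℝ, s * ((a * m ^ 2 + 2 * b * m * n + c * n ^ 2) *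
      (a * k ^ 2 + 2 * b * k * l + c * l ^ 2) - (a * m * k + b * (m * l + n * k) + c * n * l) ^ 2) =
      (m * l - n * k) ^ 2 * (s * (a * c - b ^ 2)) by intro s; ring]
    positivity

/-! ### The function `φ` as a determinant in the first and second derivatives -/

/-- The determinant of three columns. -/
noncomputable def det3 (a b c : Fin 3 → ℝ) : ℝ :=
  (Matrix.of ![a, b, c]).transpose.det

theorem det3_eq (a b c : Fin 3 → ℝ) : det3 a b c =
    b 0 * (c 1 * a 2 - a 1 * c 2) + b 1 * (a 0 * c 2 - c 0 * a 2) +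
      b 2 * (c 0 * a 1 - a 0 * c 1) := by
  rw [det3, Matrix.det_transpose, Matrix.det_fin_three]
  simp
  ring

theorem clm_apply_two (A : (Fin 2 → ℝ) →L[ℝ] (Fin 3 → ℝ)) (v : Fin 2 → ℝ) (i : Fin 3) :
    A v i = v 0 * A ![1, 0] i + v 1 * A ![0, 1] i := by
  conv_lhs => rw [eq_smul_add_smul v]
  rw [map_add, map_smul, map_smul]
  rfl

theorem clm_apply_three (M : (Fin 3 → ℝ) →L[ℝ] (Fin 3 → ℝ)) (v : Fin 3 → ℝ) (i : Fin 3) :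
    M v i = v 0 * M ![1, 0, 0] i + v 1 * M ![0, 1, 0] i + v 2 * M ![0, 0, 1] i := by
  have : v = v 0 • ![1, 0, 0] + v 1 • ![0, 1, 0] + v 2 • ![0, 0, 1] := by
    ext i; fin_cases i <;> simp
  conv_lhs => rw [this]
  rw [map_add, map_add, map_smul, map_smul, map_smul]
  rfl

/-- Three vectors in the image of the plane are linearly dependent. -/
theorem det3_range (A : (Fin 2 → ℝ) →L[ℝ] (Fin 3 → ℝ)) (u v w : Fin 2 → ℝ) :
    det3 (A u) (A v) (A w) = 0 := by
  simp only [det3_eq, clm_apply_two A u, clm_apply_two A v, clm_apply_two A w]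
  ring

theorem det3_add_right (a b c c' : Fin 3 → ℝ) : det3 a b (c + c') = det3 a b c + det3 a b c' := by
  simp only [det3_eq, Pi.add_apply]
  ring

theorem det3_map (M : (Fin 3 → ℝ) →L[ℝ] (Fin 3 → ℝ)) (a b c : Fin 3 → ℝ) :
    det3 (M a) (M b) (M c) =
      det3 (M ![1, 0, 0]) (M ![0, 1, 0]) (M ![0, 0, 1]) * det3 a b c := by
  simp only [det3_eq, clm_apply_three M a, clm_apply_three M b, clm_apply_three M c]
  ring

theorem det3_basis_ne_zero {M : (Fin 3 → ℝ) →L[ℝ] (Fin 3 → ℝ)} (hM : ∀ v, M v = 0 → v = 0) :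
    det3 (M ![1, 0, 0]) (M ![0, 1, 0]) (M ![0, 0, 1]) ≠ 0 := by
  have hinj : Function.Injective (M : (Fin 3 → ℝ) →ₗ[ℝ] (Fin 3 → ℝ)) :=
    (injective_iff_map_eq_zero _).2 hM
  have hsurj := LinearMap.injective_iff_surjective.1 hinj
  obtain ⟨a, ha⟩ := hsurj ![1, 0, 0]
  obtain ⟨b, hb⟩ := hsurj ![0, 1, 0]
  obtain ⟨c, hc⟩ := hsurj ![0, 0, 1]
  simp only [ContinuousLinearMap.coe_coe] at ha hb hc
  have h := det3_map M a b c
  rw [ha, hb, hc] at h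
  intro h0
  rw [h0, zero_mul, det3_eq] at h
  simp at h

theorem SmoothGerm.det3 {E : Type*} [NormedAddCommGroup E] [NormedSpace ℝ E]
    {a b c : E → Fin 3 → ℝ} (ha : SmoothGerm a) (hb : SmoothGerm b) (hc : SmoothGerm c) :
    SmoothGerm fun p => det3 (a p) (b p) (c p) := by
  simp only [det3_eq]
  refine SmoothGerm.add (SmoothGerm.add ?_ ?_) ?_
  · exact (hb.apply _).mul (((hc.apply _).mul (ha.apply _)).sub ((ha.apply _).mul (hc.apply _)))
  · exact (hb.apply _).mul (((ha.apply _).mul (hc.apply _)).sub ((hc.apply _).mul (ha.apply _)))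
  · exact (hb.apply _).mul (((hc.apply _).mul (ha.apply _)).sub ((ha.apply _).mul (hc.apply _)))

/-- At a point where the middle column vanishes, only this column has to be differentiated. -/
theorem fderiv_det3_of_zero {E : Type*} [NormedAddCommGroup E] [NormedSpace ℝ E]
    {a b c : E → Fin 3 → ℝ} (ha : SmoothGerm a) (hb : SmoothGerm b) (hc : SmoothGerm c)
    (h0 : b 0 = 0) (v : E) :
    fderiv ℝ (fun p => det3 (a p) (b p) (c p)) 0 v = det3 (a 0) (fderiv ℝ b 0 v) (c 0) := by
  have key : ∀ (i : Fin 3) {F : E → ℝ}, SmoothGerm F →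
      HasFDerivAt (fun p => b p i * F p) (F 0 • fderiv ℝ (fun p => b p i) 0) 0 := by
    intro i F hF
    have h1 := (hb.apply i).differentiableAt.hasFDerivAt.mul hF.differentiableAt.hasFDerivAt
    refine h1.congr_fderiv ?_
    simp [h0]
  have hm : ∀ i j k l : Fin 3, SmoothGerm fun p => c p i * a p j - a p k * c p l :=
    fun i j k l => ((hc.apply i).mul (ha.apply j)).sub ((ha.apply k).mul (hc.apply l))
  have hm' : ∀ i j k l : Fin 3, SmoothGerm fun p => a p i * c p j - c p k * a p l :=
    fun i j k l => ((ha.apply i).mul (hc.apply j)).sub ((hc.apply k).mul (ha.apply l))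
  have h2 := ((key 0 (hm 1 2 1 2)).add (key 1 (hm' 0 2 0 2))).add (key 2 (hm 0 1 0 1))
  simp only [det3_eq]
  refine (congrArg (fun A => A v) (HasFDerivAt.fderiv h2)).trans ?_
  simp only [add_apply, smul_apply, smul_eq_mul, fderiv_component hb.differentiableAt]
  ring

/-- The pointwise form of `phi`: the determinant of `X f`, `Y f` and of the second derivative of
`f` in the direction `Y`, for vectors `X` and `Y` at the point `p`. -/
noncomputable def phiAt (f : (Fin 2 → ℝ) → (Fin 3 → ℝ)) (p X Y : Fin 2 → ℝ) : ℝ :=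
  det3 (fderiv ℝ f p X) (fderiv ℝ f p Y) (fderiv ℝ (fderiv ℝ f) p Y Y)

/-- The derivative of the vector field `Y` does not contribute to `phi`, because it enters only
through a vector in the image of `df`. -/
theorem phi_eventuallyEq {f : (Fin 2 → ℝ) → (Fin 3 → ℝ)} (hf : SmoothGerm f)
    {X Y : (Fin 2 → ℝ) → (Fin 2 → ℝ)} (hY : SmoothGerm Y) :
    phi X Y f =ᶠ[𝓝 0] fun p => phiAt f p (X p) (Y p) := by
  filter_upwards [hf.fderiv_right.eventually_differentiableAt,
    hY.eventually_differentiableAt] with p hp hq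
  change det3 (fderiv ℝ f p (X p)) (fderiv ℝ f p (Y p))
    (fderiv ℝ (fun q => fderiv ℝ f q (Y q)) p (Y p)) = _
  rw [fderiv_clm_apply hp hq, phiAt]
  simp only [add_apply, ContinuousLinearMap.comp_apply, ContinuousLinearMap.flip_apply]
  rw [det3_add_right, det3_range, zero_add]

theorem phiAt_congr {f g : (Fin 2 → ℝ) → (Fin 3 → ℝ)} (h : f =ᶠ[𝓝 0] g) :
    ∀ᶠ p in 𝓝 (0 : Fin 2 → ℝ), ∀ X Y, phiAt f p X Y = phiAt g p X Y := by
  filter_upwards [h.eventuallyEq_nhds] with p hp X Y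
  rw [phiAt, phiAt, hp.fderiv_eq, hp.fderiv.fderiv_eq]

theorem SmoothGerm.phiAt {f : (Fin 2 → ℝ) → (Fin 3 → ℝ)} (hf : SmoothGerm f)
    {X Y : (Fin 2 → ℝ) → (Fin 2 → ℝ)} (hX : SmoothGerm X) (hY : SmoothGerm Y) :
    SmoothGerm fun p => phiAt f p (X p) (Y p) :=
  (hf.fderiv_apply hX).det3 (hf.fderiv_apply hY)
    ((hf.fderiv_right.fderiv_right.clm_apply hY).clm_apply hY)

theorem qSign_congr {s : ℝ} {φ ψ : (Fin 2 → ℝ) → ℝ} (h : φ =ᶠ[𝓝 0] ψ) :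
    QSign s φ ↔ QSign s ψ := by
  have key : ∀ {φ ψ : (Fin 2 → ℝ) → ℝ}, φ =ᶠ[𝓝 0] ψ → QSign s φ → QSign s ψ := by
    rintro φ ψ h ⟨a, b, c, hq, hs⟩
    exact ⟨a, b, c, hq.congr' (h.mono fun p hp => by simp only [hp]) EventuallyEq.rfl, hs⟩
  exact ⟨key h, key h.symm⟩

/-- The second derivative of a composition in the direction `Y`. -/
theorem snd_fderiv_comp {m n k : ℕ} {h : (Fin n → ℝ) → (Fin k → ℝ)} {d : (Fin m → ℝ) → (Fin n → ℝ)}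
    (hh : SmoothGerm h) (hd : SmoothGerm d) (h0 : d 0 = 0) :
    ∀ᶠ p in 𝓝 (0 : Fin m → ℝ), (∀ Y, fderiv ℝ (fun q => h (d q)) p Y =
        fderiv ℝ h (d p) (fderiv ℝ d p Y)) ∧
      ∀ Y, fderiv ℝ (fderiv ℝ fun q => h (d q)) p Y Y =
        fderiv ℝ (fderiv ℝ h) (d p) (fderiv ℝ d p Y) (fderiv ℝ d p Y) +
          fderiv ℝ h (d p) (fderiv ℝ (fderiv ℝ d) p Y Y) := by
  have hdt : Tendsto d (𝓝 0) (𝓝 0) := by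
    have := hd.continuousAt
    rwa [ContinuousAt, h0] at this
  have h1 : ∀ᶠ p in 𝓝 (0 : Fin m → ℝ),
      HasFDerivAt (fun q => h (d q)) ((fderiv ℝ h (d p)).comp (fderiv ℝ d p)) p := by
    filter_upwards [hdt.eventually hh.eventually_differentiableAt,
      hd.eventually_differentiableAt] with p hp hq
    exact hp.hasFDerivAt.comp p hq.hasFDerivAt
  filter_upwards [h1.eventually_nhds, hdt.eventually hh.fderiv_right.eventually_differentiableAt,
    hd.fderiv_right.eventually_differentiableAt, hd.eventually_differentiableAt]
    with p hp h2 h3 h4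
  refine ⟨fun Y => ?_, fun Y => ?_⟩
  · rw [hp.self_of_nhds.fderiv]
    rfl
  · have h5 : fderiv ℝ (fun q => h (d q)) =ᶠ[𝓝 p]
        fun q => (fderiv ℝ h (d q)).comp (fderiv ℝ d q) := hp.mono fun q hq => hq.fderiv
    have h6 : HasFDerivAt (fun q => fderiv ℝ h (d q))
        ((fderiv ℝ (fderiv ℝ h) (d p)).comp (fderiv ℝ d p)) p :=
      h2.hasFDerivAt.comp p h4.hasFDerivAt
    rw [h5.fderiv_eq, (h6.clm_comp h3.hasFDerivAt).fderiv]
    simp [add_comm]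

theorem linearIndependent_pair_iff_det (u v : Fin 2 → ℝ) :
    LinearIndependent ℝ ![u, v] ↔ u 0 * v 1 - u 1 * v 0 ≠ 0 := by
  rw [LinearIndependent.pair_iff]
  constructor
  · intro h hz
    have h1 := h (v 1) (-u 1) (by
      ext i; fin_cases i
      · simp; linarith
      · simp; ring)
    have h2 := h (-v 0) (u 0) (by
      ext i; fin_cases i
      · simp; ring
      · simp; linarith)
    have h3 := h 1 1 (by
      ext i; fin_cases i
      · simp [h2.2, neg_eq_zero.1 h2.1]
      · simp [h1.1, neg_eq_zero.1 h1.2])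
    exact one_ne_zero h3.1
  · intro h a b hab
    have h0 : a * u 0 + b * v 0 = 0 := by simpa using congrFun hab 0
    have h1 : a * u 1 + b * v 1 = 0 := by simpa using congrFun hab 1
    constructor
    · refine (mul_eq_zero.1 (?_ : a * (u 0 * v 1 - u 1 * v 0) = 0)).resolve_right h
      linear_combination v 1 * h0 - v 0 * h1
    · refine (mul_eq_zero.1 (?_ : b * (u 0 * v 1 - u 1 * v 0) = 0)).resolve_right h
      linear_combination u 0 * h1 - u 1 * h0

/-- Coordinates of a plane vector in a basis (Cramer's rule). -/
theorem exists_frame_coordinates {u v : Fin 2 → ℝ} (h : LinearIndependent ℝ ![u, v]) :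
    ∃ α β : (Fin 2 → ℝ) →L[ℝ] ℝ, ∀ w, w = α w • u + β w • v := by
  have hW := (linearIndependent_pair_iff_det u v).1 h
  set W := u 0 * v 1 - u 1 * v 0
  let π : Fin 2 → ((Fin 2 → ℝ) →L[ℝ] ℝ) := fun i =>
    ContinuousLinearMap.proj (R := ℝ) (φ := fun _ : Fin 2 => ℝ) i
  refine ⟨W⁻¹ • (v 1 • π 0 - v 0 • π 1), W⁻¹ • (u 0 • π 1 - u 1 • π 0), fun w => ?_⟩
  ext i; fin_cases i
  · simp [π]
    field_simp
    simp only [W]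
    ring
  · simp [π]
    field_simp
    simp only [W]
    ring

/-- A frame `X, Y` of smooth vector fields in the source of `f`, near the origin, whose second
member spans the kernel of `df` at the origin (but not necessarily at other points). -/
structure IsNullFrame (f : (Fin 2 → ℝ) → (Fin 3 → ℝ)) (X Y : (Fin 2 → ℝ) → (Fin 2 → ℝ)) :
    Prop where
  smooth_left : SmoothGerm X
  smooth_right : SmoothGerm Y
  null : fderiv ℝ f 0 (Y 0) = 0
  linearIndependent : LinearIndependent ℝ ![X 0, Y 0]

theorem IsNullFrame.const {f : (Fin 2 → ℝ) → (Fin 3 → ℝ)} {X Y : (Fin 2 → ℝ) → (Fin 2 → ℝ)}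
    (h : IsNullFrame f X Y) : IsNullFrame f (fun _ => X 0) (fun _ => Y 0) :=
  ⟨SmoothGerm.const _, SmoothGerm.const _, h.null, h.linearIndependent⟩

theorem IsNullFrame.fderiv_ne_zero {f : (Fin 2 → ℝ) → (Fin 3 → ℝ)}
    {X Y : (Fin 2 → ℝ) → (Fin 2 → ℝ)} (h : IsNullFrame f X Y) (hf : fderiv ℝ f 0 ≠ 0) :
    fderiv ℝ f 0 (X 0) ≠ 0 := by
  intro h0
  obtain ⟨α, β, hαβ⟩ := exists_frame_coordinates h.linearIndependent
  refine hf (ContinuousLinearMap.ext fun w => ?_)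
  rw [hαβ w, map_add, map_smul, map_smul, h0, h.null]
  simp

theorem IsNullFrame.phiAt_zero {f : (Fin 2 → ℝ) → (Fin 3 → ℝ)}
    {X Y : (Fin 2 → ℝ) → (Fin 2 → ℝ)} (h : IsNullFrame f X Y) : phiAt f 0 (X 0) (Y 0) = 0 := by
  rw [phiAt, h.null, det3_eq]
  simp

theorem isLittleO_of_fderiv_eq_zero {φ : (Fin 2 → ℝ) → ℝ} (hφ : DifferentiableAt ℝ φ 0)
    (h0 : φ 0 = 0) (hd : fderiv ℝ φ 0 = 0) : φ =o[𝓝 0] fun p => ‖p‖ := by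
  have := hasFDerivAt_iff_isLittleO_nhds_zero.1 hφ.hasFDerivAt
  simp only [h0, hd, zero_add, sub_zero, zero_apply] at this
  exact this.norm_right

theorem fderiv_eq_zero_of_isLittleO {φ : (Fin 2 → ℝ) → ℝ}
    (h0 : φ 0 = 0) (ho : φ =o[𝓝 0] fun p => ‖p‖) : fderiv ℝ φ 0 = 0 := by
  refine HasFDerivAt.fderiv (hasFDerivAt_iff_isLittleO_nhds_zero.2 ?_)
  simpa [h0] using ho.of_norm_right

theorem isLittleO_norm_sq_norm :
    (fun p : Fin 2 → ℝ => ‖p‖ ^ 2) =o[𝓝 0] fun p => ‖p‖ := by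
  have h : (fun p : Fin 2 → ℝ => ‖p‖) =o[𝓝 0] fun _ => (1 : ℝ) := by
    rw [isLittleO_one_iff]
    exact tendsto_norm_zero
  exact (h.mul_isBigO (isBigO_refl (fun p : Fin 2 → ℝ => ‖p‖) _)).congr
    (fun p => (sq _).symm) fun p => one_mul _

theorem QSign.isLittleO {s : ℝ} {φ : (Fin 2 → ℝ) → ℝ} (h : QSign s φ) :
    φ =o[𝓝 0] fun p => ‖p‖ := by
  obtain ⟨a, b, c, hq, -⟩ := h
  exact hq.isBigO.trans_isLittleO isLittleO_norm_sq_norm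

/-! ### Invariance under `𝒜`-equivalence and change of frame -/

theorem det3_frame (A : (Fin 2 → ℝ) →L[ℝ] (Fin 3 → ℝ))
    (B : (Fin 2 → ℝ) →L[ℝ] (Fin 2 → ℝ) →L[ℝ] (Fin 3 → ℝ)) (hB : ∀ v w, B v w = B w v)
    (u v : Fin 2 → ℝ) (a b c e : ℝ) :
    det3 (A (a • u + b • v)) (A (c • u + e • v)) (B (c • u + e • v) (c • u + e • v)) =
      (a * e - b * c) * (e ^ 2 * det3 (A u) (A v) (B v v) +
        2 * c * e * det3 (A u) (A v) (B u v) + c ^ 2 * det3 (A u) (A v) (B u u)) := by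
  simp only [map_add, map_smul, add_apply, smul_apply, hB v u]
  simp only [det3_eq, Pi.add_apply, Pi.smul_apply, smul_eq_mul]
  ring

theorem SmoothGerm.clm {E F G : Type*} [NormedAddCommGroup E] [NormedSpace ℝ E]
    [NormedAddCommGroup F] [NormedSpace ℝ F] [NormedAddCommGroup G] [NormedSpace ℝ G]
    {h : E → F} (hh : SmoothGerm h) (A : F →L[ℝ] G) : SmoothGerm fun p => A (h p) :=
  (SmoothGerm.const A).clm_apply hh

theorem SmoothGerm.isBigO {F : (Fin 2 → ℝ) → ℝ} (hF : SmoothGerm F) (h0 : F 0 = 0) :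
    F =O[𝓝 0] fun p => ‖p‖ :=
  isBigO_of_differentiableAt hF.differentiableAt h0

theorem SmoothGerm.isBigO_one {E G : Type*} [NormedAddCommGroup E] [NormedSpace ℝ E]
    [NormedAddCommGroup G] [NormedSpace ℝ G] {F : E → G} (hF : SmoothGerm F) :
    F =O[𝓝 0] fun _ => (1 : ℝ) :=
  hF.continuousAt.tendsto.isBigO_one ℝ

/-- The mixed determinant that appears when a null frame is changed vanishes to second order as soon
as the origin is a critical point of `phi`. This is what allows `Y` to be any field that is null at
the origin only. -/
theorem mixed_isLittleO {f : (Fin 2 → ℝ) → (Fin 3 → ℝ)} (hf : SmoothGerm f) {X Y : Fin 2 → ℝ}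
    (h : IsNullFrame f (fun _ => X) (fun _ => Y))
    (hP : (fun p => phiAt f p X Y) =o[𝓝 0] fun p => ‖p‖) :
    (fun p => det3 (fderiv ℝ f p X) (fderiv ℝ f p Y) (fderiv ℝ (fderiv ℝ f) p X Y)) =o[𝓝 0]
      fun p => ‖p‖ := by
  obtain ⟨α, β, hαβ⟩ := exists_frame_coordinates h.linearIndependent
  have hX : SmoothGerm fun p => fderiv ℝ f p X := hf.fderiv_apply (SmoothGerm.const X)
  have hY : SmoothGerm fun p => fderiv ℝ f p Y := hf.fderiv_apply (SmoothGerm.const Y)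
  have hB : ∀ v w, SmoothGerm fun p => fderiv ℝ (fderiv ℝ f) p v w := fun v w =>
    (hf.fderiv_right.fderiv_right.clm_apply (SmoothGerm.const v)).clm_apply (SmoothGerm.const w)
  have hY0 : fderiv ℝ f 0 Y = 0 := h.null
  have hdY : ∀ v, fderiv ℝ (fun p => fderiv ℝ f p Y) 0 v = fderiv ℝ (fderiv ℝ f) 0 v Y := by
    intro v
    rw [fderiv_clm_apply hf.fderiv_right.differentiableAt (by fun_prop)]
    simp
  have hφ := fderiv_eq_zero_of_isLittleO h.phiAt_zero hP
  have hφX := congrArg (fun A => A X) hφ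
  simp only [phiAt, zero_apply] at hφX
  rw [fderiv_det3_of_zero hX hY (hB Y Y) hY0, hdY] at hφX
  refine isLittleO_of_fderiv_eq_zero (hX.det3 hY (hB X Y)).differentiableAt ?_ ?_
  · rw [hY0, det3_eq]
    simp
  · ext v
    rw [fderiv_det3_of_zero hX hY (hB X Y) hY0, hdY, hαβ v]
    rw [det3_eq] at hφX
    simp only [det3_eq, map_add, map_smul, add_apply, smul_apply, Pi.add_apply,
      Pi.smul_apply, smul_eq_mul, zero_apply]
    linear_combination (-β v) * hφX

/-- The condition on the leading form of `phi` does not depend on the null frame. -/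
theorem qSign_frame {f : (Fin 2 → ℝ) → (Fin 3 → ℝ)} (hf : SmoothGerm f) (hf1 : fderiv ℝ f 0 ≠ 0)
    {X Y : (Fin 2 → ℝ) → (Fin 2 → ℝ)} (h : IsNullFrame f X Y) {X₀ Y₀ : Fin 2 → ℝ}
    (h₀ : IsNullFrame f (fun _ => X₀) (fun _ => Y₀)) {s : ℝ} :
    QSign s (fun p => phiAt f p (X p) (Y p)) ↔ QSign s (fun p => phiAt f p X₀ Y₀) := by
  obtain ⟨α, β, hαβ⟩ := exists_frame_coordinates h₀.linearIndependent
  set P : (Fin 2 → ℝ) → ℝ := fun p => phiAt f p X₀ Y₀ with hP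
  set P' : (Fin 2 → ℝ) → ℝ := fun p => phiAt f p (X p) (Y p) with hP'
  let Ψ : (Fin 2 → ℝ) → ℝ := fun p =>
    det3 (fderiv ℝ f p X₀) (fderiv ℝ f p Y₀) (fderiv ℝ (fderiv ℝ f) p X₀ Y₀)
  let Ω : (Fin 2 → ℝ) → ℝ := fun p =>
    det3 (fderiv ℝ f p X₀) (fderiv ℝ f p Y₀) (fderiv ℝ (fderiv ℝ f) p X₀ X₀)
  let Δ : (Fin 2 → ℝ) → ℝ := fun p => α (X p) * β (Y p) - β (X p) * α (Y p)
  let c : (Fin 2 → ℝ) → ℝ := fun p => α (Y p)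
  let e : (Fin 2 → ℝ) → ℝ := fun p => β (Y p)
  have hc : SmoothGerm c := h.smooth_right.clm α
  have he : SmoothGerm e := h.smooth_right.clm β
  have hΔ : SmoothGerm Δ := ((h.smooth_left.clm α).mul he).sub ((h.smooth_left.clm β).mul hc)
  have hX : SmoothGerm fun p => fderiv ℝ f p X₀ := hf.fderiv_apply (SmoothGerm.const X₀)
  have hY : SmoothGerm fun p => fderiv ℝ f p Y₀ := hf.fderiv_apply (SmoothGerm.const Y₀)
  have hB : ∀ v w, SmoothGerm fun p => fderiv ℝ (fderiv ℝ f) p v w := fun v w =>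
    (hf.fderiv_right.fderiv_right.clm_apply (SmoothGerm.const v)).clm_apply (SmoothGerm.const w)
  have hY0 : fderiv ℝ f 0 Y₀ = 0 := h₀.null
  have hΨ0 : Ψ 0 = 0 := by simp only [Ψ]; rw [hY0, det3_eq]; simp
  have hΨ : Ψ =O[𝓝 0] fun p => ‖p‖ := (hX.det3 hY (hB X₀ Y₀)).isBigO hΨ0
  have hΩ : Ω =O[𝓝 0] fun p => ‖p‖ := (hX.det3 hY (hB X₀ X₀)).isBigO (by
    rw [hY0, det3_eq]; simp)
  -- the second members of both frames are proportional at the origin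
  have hc0 : c 0 = 0 := by
    have h1 := h.null
    rw [hαβ (Y 0), map_add, map_smul, map_smul, hY0, smul_zero, add_zero] at h1
    exact (smul_eq_zero.1 h1).resolve_right (h₀.fderiv_ne_zero hf1)
  have hcO : c =O[𝓝 0] fun p => ‖p‖ := hc.isBigO hc0
  have hu0 : Δ 0 * e 0 ^ 2 ≠ 0 := by
    have h1 := (linearIndependent_pair_iff_det _ _).1 h.linearIndependent
    have hΔ0 : Δ 0 ≠ 0 := by
      intro hz
      apply h1
      rw [hαβ (X 0), hαβ (Y 0)]
      simp only [Pi.add_apply, Pi.smul_apply, smul_eq_mul]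
      linear_combination (X₀ 0 * Y₀ 1 - X₀ 1 * Y₀ 0) * hz
    refine mul_ne_zero hΔ0 (pow_ne_zero 2 fun hz => hΔ0 ?_)
    change α (X 0) * e 0 - β (X 0) * c 0 = 0
    rw [hz, hc0]
    ring
  have hu : SmoothGerm fun p => Δ p * e p ^ 2 := hΔ.mul (he.pow 2)
  have hexp : ∀ᶠ p in 𝓝 (0 : Fin 2 → ℝ),
      P' p = Δ p * (e p ^ 2 * P p + 2 * c p * e p * Ψ p + c p ^ 2 * Ω p) := by
    filter_upwards [hf] with p hp
    have hsymm : ∀ v w, fderiv ℝ (fderiv ℝ f) p v w = fderiv ℝ (fderiv ℝ f) p w v :=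
      hp.isSymmSndFDerivAt (by
        rw [minSmoothness_of_isRCLikeNormedField]
        exact WithTop.coe_le_coe.2 le_top)
    have h1 := det3_frame (fderiv ℝ f p) _ hsymm X₀ Y₀ (α (X p)) (β (X p)) (α (Y p)) (β (Y p))
    rwa [← hαβ, ← hαβ] at h1
  have hcc : (fun p => c p ^ 2 * Ω p) =o[𝓝 0] fun p => ‖p‖ ^ 2 :=
    ((hcO.pow 2).mul_isLittleO (hΩ.trans_isLittleO
      ((isLittleO_one_iff ℝ).2 tendsto_norm_zero))).congr_right fun p => mul_one _
  have hmain : P =o[𝓝 0] (fun p => ‖p‖) →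
      (fun p => P' p - Δ p * e p ^ 2 * P p) =o[𝓝 0] fun p => ‖p‖ ^ 2 := by
    intro hPo
    have hΨo : Ψ =o[𝓝 0] fun p => ‖p‖ := mixed_isLittleO hf h₀ hPo
    have h1 : (fun p => c p * Ψ p) =o[𝓝 0] fun p => ‖p‖ ^ 2 :=
      (hcO.mul_isLittleO hΨo).congr_right fun p => (sq _).symm
    have h2 := hΔ.isBigO_one.mul_isLittleO
      (((he.isBigO_one.mul_isLittleO h1).const_mul_left 2).add
        (hcc.congr_right fun p => (one_mul _).symm))
    refine h2.congr' ?_ (Eventually.of_forall fun p => by simp only [one_mul])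
    filter_upwards [hexp] with p hp
    rw [hp]
    ring
  constructor
  · intro hq
    have hP'o : P' =o[𝓝 0] fun p => ‖p‖ := hq.isLittleO
    have hPo : P =o[𝓝 0] fun p => ‖p‖ := by
      have h1 : (fun p => Δ p * e p ^ 2 * P p) =o[𝓝 0] fun p => ‖p‖ := by
        have h2 : (fun p => c p * Ψ p) =o[𝓝 0] fun p => ‖p‖ :=
          ((hcO.mul hΨ).congr_right fun p => (sq _).symm).trans_isLittleO isLittleO_norm_sq_norm
        have h3 := hΔ.isBigO_one.mul_isLittleO
          (((he.isBigO_one.mul_isLittleO h2).const_mul_left 2).add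
            ((hcc.trans isLittleO_norm_sq_norm).congr_right fun p => (one_mul _).symm))
        refine (hP'o.sub (h3.congr_right fun p => by simp only [one_mul])).congr' ?_ EventuallyEq.rfl
        filter_upwards [hexp] with p hp
        rw [hp]
        ring
      have h4 : (fun p => (Δ p * e p ^ 2)⁻¹) =O[𝓝 0] fun _ => (1 : ℝ) :=
        (hu.continuousAt.inv₀ hu0).tendsto.isBigO_one ℝ
      refine (h4.mul_isLittleO h1).congr' ?_ (Eventually.of_forall fun p => one_mul _)
      filter_upwards [hu.continuousAt.eventually_ne hu0] with p hp
      exact inv_mul_cancel_left₀ hp _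
    refine hq.of_isLittleO (u := fun p => (Δ p * e p ^ 2)⁻¹) (hu.continuousAt.inv₀ hu0)
      (inv_ne_zero hu0) ?_
    have h4 : (fun p => (Δ p * e p ^ 2)⁻¹) =O[𝓝 0] fun _ => (1 : ℝ) :=
      (hu.continuousAt.inv₀ hu0).tendsto.isBigO_one ℝ
    refine (h4.mul_isLittleO (hmain hPo)).neg_left.congr' ?_
      (Eventually.of_forall fun p => one_mul _)
    filter_upwards [hu.continuousAt.eventually_ne hu0] with p hp
    rw [mul_sub, inv_mul_cancel_left₀ hp]
    ring
  · intro hq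
    exact hq.of_isLittleO hu.continuousAt hu0 (hmain hq.isLittleO)

theorem det3_isBigO {a b c : (Fin 2 → ℝ) → (Fin 3 → ℝ)} {A B C : (Fin 2 → ℝ) → ℝ}
    (ha : a =O[𝓝 0] A) (hb : b =O[𝓝 0] B) (hc : c =O[𝓝 0] C) :
    (fun p => det3 (a p) (b p) (c p)) =O[𝓝 0] fun p => B p * (C p * A p) := by
  have ha' := fun i => isBigO_pi.1 ha i
  have hb' := fun i => isBigO_pi.1 hb i
  have hc' := fun i => isBigO_pi.1 hc i
  have h1 : ∀ i j k l m, (fun p => b p i * (c p j * a p k - a p l * c p m)) =O[𝓝 0]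
      fun p => B p * (C p * A p) := fun i j k l m =>
    (hb' i).mul (((hc' j).mul (ha' k)).sub (((ha' l).mul (hc' m)).congr_right fun p =>
      mul_comm _ _))
  refine (((h1 0 1 2 1 2).sub (h1 1 0 2 0 2)).add (h1 2 0 1 0 1)).congr_left fun p => ?_
  rw [det3_eq]
  ring

/-- Diffeomorphisms of the target multiply `phi` by a nonvanishing factor, up to third order. -/
theorem QSign.comp_target {f : (Fin 2 → ℝ) → (Fin 3 → ℝ)} (hf : SmoothGerm f) (hf0 : f 0 = 0)
    {X Y : Fin 2 → ℝ} (hY : fderiv ℝ f 0 Y = 0) {d : (Fin 3 → ℝ) → (Fin 3 → ℝ)} (hd : IsDiffeo d)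
    {s : ℝ} (h : QSign s (fun p => phiAt f p X Y)) :
    QSign s (fun p => phiAt (fun q => d (f q)) p X Y) := by
  have hds : SmoothGerm d := hd.1
  have hM : SmoothGerm fun p => fderiv ℝ d (f p) := hds.fderiv_right.comp hf hf0
  have hN : SmoothGerm fun p => fderiv ℝ (fderiv ℝ d) (f p) :=
    hds.fderiv_right.fderiv_right.comp hf hf0
  have hfX : SmoothGerm fun p => fderiv ℝ f p X := hf.fderiv_apply (SmoothGerm.const X)
  have hfY : SmoothGerm fun p => fderiv ℝ f p Y := hf.fderiv_apply (SmoothGerm.const Y)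
  have hyO : (fun p => fderiv ℝ f p Y) =O[𝓝 0] fun p => ‖p‖ :=
    isBigO_of_differentiableAt hfY.differentiableAt hY
  let u : (Fin 2 → ℝ) → ℝ := fun p => det3 (fderiv ℝ d (f p) ![1, 0, 0])
    (fderiv ℝ d (f p) ![0, 1, 0]) (fderiv ℝ d (f p) ![0, 0, 1])
  have hu : SmoothGerm u := (hM.clm_apply (SmoothGerm.const _)).det3
    (hM.clm_apply (SmoothGerm.const _)) (hM.clm_apply (SmoothGerm.const _))
  refine h.of_isLittleO hu.continuousAt ?_ ?_
  · simp only [u, hf0]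
    exact det3_basis_ne_zero fun v hv => hd.injective_fderiv hv
  · have h1 : (fun p => fderiv ℝ d (f p) (fderiv ℝ f p X)) =O[𝓝 0] fun _ => (1 : ℝ) :=
      (hM.clm_apply hfX).isBigO_one
    have h2 : (fun p => fderiv ℝ d (f p) (fderiv ℝ f p Y)) =O[𝓝 0] fun p => ‖p‖ :=
      isBigO_of_differentiableAt (hM.clm_apply hfY).differentiableAt (by rw [hY, map_zero])
    have h3 : (fun p => fderiv ℝ (fderiv ℝ d) (f p) (fderiv ℝ f p Y) (fderiv ℝ f p Y)) =O[𝓝 0]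
        fun p => ‖p‖ * ‖p‖ := by
      have h4 : (fun p => ‖fderiv ℝ (fderiv ℝ d) (f p)‖ * ‖fderiv ℝ f p Y‖ * ‖fderiv ℝ f p Y‖)
          =O[𝓝 0] fun p => 1 * ‖p‖ * ‖p‖ :=
        (hN.isBigO_one.norm_left.mul hyO.norm_left).mul hyO.norm_left
      refine (IsBigO.of_bound 1 (Eventually.of_forall fun p => ?_)).trans
        (h4.congr_right fun p => by rw [one_mul])
      rw [one_mul, Real.norm_of_nonneg (by positivity)]
      exact ContinuousLinearMap.le_opNorm₂ _ _ _
    have h5 := det3_isBigO h1 h2 h3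
    have h6 : (fun p : Fin 2 → ℝ => ‖p‖ * (‖p‖ * ‖p‖ * 1)) =o[𝓝 0] fun p => ‖p‖ ^ 2 :=
      (((isLittleO_one_iff ℝ).2 tendsto_norm_zero).mul_isBigO
        (isBigO_refl (fun p : Fin 2 → ℝ => ‖p‖ ^ 2) (𝓝 0))).congr
        (fun p => by ring) fun p => one_mul _
    refine (h5.trans_isLittleO h6).congr' ?_ EventuallyEq.rfl
    filter_upwards [snd_fderiv_comp hds hf hf0] with p hp
    rw [phiAt, hp.1, hp.1, hp.2, det3_add_right, phiAt, det3_map]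
    ring

/-- Diffeomorphisms of the source transport `phi` together with the frame. -/
theorem phiAt_comp_source {g : (Fin 2 → ℝ) → (Fin 3 → ℝ)} (hg : SmoothGerm g)
    {d : (Fin 2 → ℝ) → (Fin 2 → ℝ)} (hd : SmoothGerm d) (hd0 : d 0 = 0) :
    ∀ᶠ p in 𝓝 (0 : Fin 2 → ℝ), ∀ X Y, phiAt (fun q => g (d q)) p X Y =
      phiAt g (d p) (fderiv ℝ d p X) (fderiv ℝ d p Y) := by
  filter_upwards [snd_fderiv_comp hg hd hd0] with p hp X Y
  rw [phiAt, hp.1, hp.1, hp.2, det3_add_right, det3_range, add_zero, phiAt]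

theorem linearIndependent_of_injective {A : (Fin 2 → ℝ) →L[ℝ] (Fin 2 → ℝ)}
    (hA : ∀ v, A v = 0 → v = 0) {u v : Fin 2 → ℝ} (h : LinearIndependent ℝ ![u, v]) :
    LinearIndependent ℝ ![A u, A v] := by
  rw [LinearIndependent.pair_iff] at h ⊢
  intro a b hab
  refine h a b (hA _ ?_)
  rw [map_add, map_smul, map_smul, hab]

/-- If `d_t ∘ f = g ∘ d_s`, then `d_s` maps a null frame of `f` to a null frame of `g`. -/
theorem IsNullFrame.push {f g : (Fin 2 → ℝ) → (Fin 3 → ℝ)} (hf : SmoothGerm f) (hf0 : f 0 = 0)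
    (hg : SmoothGerm g) {ds es : (Fin 2 → ℝ) → (Fin 2 → ℝ)} {dt : (Fin 3 → ℝ) → (Fin 3 → ℝ)}
    (hs : IsDiffeo ds) (he : IsDiffeo es) (ht : IsDiffeo dt)
    (heq : ∀ᶠ p in 𝓝 (0 : Fin 2 → ℝ), dt (f p) = g (ds p)) {X Y : Fin 2 → ℝ}
    (h : IsNullFrame f (fun _ => X) (fun _ => Y)) :
    IsNullFrame g (fun p => fderiv ℝ ds (es p) X) (fun p => fderiv ℝ ds (es p) Y) := by
  have hds : SmoothGerm fun p => fderiv ℝ ds (es p) :=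
    (SmoothGerm.fderiv_right hs.1).comp he.1 he.2.1
  refine ⟨hds.clm_apply (SmoothGerm.const _), hds.clm_apply (SmoothGerm.const _), ?_, ?_⟩
  · rw [he.2.1]
    have h1 := (snd_fderiv_comp hg hs.1 hs.2.1).self_of_nhds.1 Y
    have h2 := (snd_fderiv_comp ht.1 hf hf0).self_of_nhds.1 Y
    rw [hs.2.1] at h1
    rw [← h1, ← Filter.EventuallyEq.fderiv_eq heq, h2, h.null, map_zero]
  · simp only [he.2.1]
    exact linearIndependent_of_injective (fun v hv => hs.injective_fderiv hv) h.linearIndependent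

/-- The condition on the leading form of `phi` is invariant under `𝒜`-equivalence. -/
theorem QSign.of_aEquiv {f g : (Fin 2 → ℝ) → (Fin 3 → ℝ)} (hf : SmoothGerm f) (hf0 : f 0 = 0)
    (hf1 : fderiv ℝ f 0 ≠ 0) (hg : SmoothGerm g) (hg1 : fderiv ℝ g 0 ≠ 0) (hfg : AEquiv f g)
    {ξ η ξ' η' : (Fin 2 → ℝ) → (Fin 2 → ℝ)} (h : IsNullFrame f ξ η) (h' : IsNullFrame g ξ' η')
    {s : ℝ} (hq : QSign s (phi ξ η f)) : QSign s (phi ξ' η' g) := by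
  obtain ⟨ds, dt, hs, ht, heq⟩ := hfg
  obtain ⟨es, he, -, hse⟩ := hs.exists_inverse
  have h1 := (qSign_frame hf hf1 h h.const).1 ((qSign_congr (phi_eventuallyEq hf h.smooth_right)).1 hq)
  have h2 := h1.comp_target hf hf0 h.null ht
  have h3 := h2.comp (SmoothGerm.differentiableAt he.1) he.2.1 fun v hv => he.injective_fderiv hv
  have hpush := h.const.push hf hf0 hg hs he ht heq
  have h4 : QSign s fun p => phiAt g p (fderiv ℝ ds (es p) (ξ 0)) (fderiv ℝ ds (es p) (η 0)) := by
    refine (qSign_congr ?_).1 h3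
    filter_upwards [he.tendsto.eventually (phiAt_congr heq),
      he.tendsto.eventually (phiAt_comp_source hg hs.1 hs.2.1), hse] with p hp hq hr
    rw [hp, hq, hr]
  refine (qSign_congr (phi_eventuallyEq hg h'.smooth_right)).2 ?_
  exact (qSign_frame hg hg1 h' h'.const).2 ((qSign_frame hg hg1 hpush h'.const).1 h4)

/-- The second derivative of `f` in the direction `Y` is transversal to the image of `df` at the
origin. -/
def IsTransversal (f : (Fin 2 → ℝ) → (Fin 3 → ℝ)) (Y : Fin 2 → ℝ) : Prop :=
  ∀ v, fderiv ℝ (fderiv ℝ f) 0 Y Y ≠ fderiv ℝ f 0 v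

theorem isTransversal_iff {f : (Fin 2 → ℝ) → (Fin 3 → ℝ)} (hf : SmoothGerm f)
    (hf1 : fderiv ℝ f 0 ≠ 0) {X Y : (Fin 2 → ℝ) → (Fin 2 → ℝ)} (h : IsNullFrame f X Y) :
    IsTransversal f (Y 0) ↔
      LinearIndependent ℝ ![dirDeriv X f 0, dirDeriv Y (dirDeriv Y f) 0] := by
  obtain ⟨α, β, hαβ⟩ := exists_frame_coordinates h.linearIndependent
  have hw := h.fderiv_ne_zero hf1
  have him : ∀ v, fderiv ℝ f 0 v = α v • fderiv ℝ f 0 (X 0) := by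
    intro v
    conv_lhs => rw [hαβ v, map_add, map_smul, map_smul, h.null, smul_zero, add_zero]
  have h2 : dirDeriv Y (dirDeriv Y f) 0 =
      fderiv ℝ f 0 (fderiv ℝ Y 0 (Y 0)) + fderiv ℝ (fderiv ℝ f) 0 (Y 0) (Y 0) := by
    change fderiv ℝ (fun q => fderiv ℝ f q (Y q)) 0 (Y 0) = _
    rw [fderiv_clm_apply hf.fderiv_right.differentiableAt h.smooth_right.differentiableAt]
    rfl
  rw [h2]
  change _ ↔ LinearIndependent ℝ ![fderiv ℝ f 0 (X 0), _]
  rw [LinearIndependent.pair_iff' (K := ℝ) hw]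
  constructor
  · intro ht a ha
    refine ht (a • X 0 - fderiv ℝ Y 0 (Y 0)) ?_
    rw [map_sub, map_smul, ha]
    abel
  · intro ht v hv
    refine ht (α (fderiv ℝ Y 0 (Y 0)) + α v) ?_
    rw [add_smul, ← him, ← him, hv]

/-- Transversality is invariant under `𝒜`-equivalence. -/
theorem IsTransversal.of_aEquiv {f g : (Fin 2 → ℝ) → (Fin 3 → ℝ)} (hf : SmoothGerm f)
    (hf0 : f 0 = 0) (hg : SmoothGerm g) (hg1 : fderiv ℝ g 0 ≠ 0)
    (hfg : AEquiv f g) {X Y X' Y' : Fin 2 → ℝ} (h : IsNullFrame f (fun _ => X) (fun _ => Y))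
    (h' : IsNullFrame g (fun _ => X') (fun _ => Y')) (hT : IsTransversal f Y) :
    IsTransversal g Y' := by
  obtain ⟨ds, dt, hs, ht, heq⟩ := hfg
  obtain ⟨es, he, -, hse⟩ := hs.exists_inverse
  have hpush := h.push hf hf0 hg hs he ht heq
  obtain ⟨α, β, hαβ⟩ := exists_frame_coordinates h'.linearIndependent
  have hs1 := (snd_fderiv_comp hg hs.1 hs.2.1).self_of_nhds
  have ht1 := (snd_fderiv_comp ht.1 hf hf0).self_of_nhds
  have heq1 := Filter.EventuallyEq.fderiv_eq (𝕜 := ℝ) heq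
  have heq2 := (Filter.EventuallyEq.fderiv (𝕜 := ℝ) heq).fderiv_eq (𝕜 := ℝ)
  rw [hf0] at ht1
  rw [hs.2.1] at hs1
  intro v hv
  have hnull : fderiv ℝ g 0 (fderiv ℝ ds 0 Y) = 0 := by simpa [he.2.1] using hpush.null
  have hα : α (fderiv ℝ ds 0 Y) = 0 := by
    rw [hαβ (fderiv ℝ ds 0 Y), map_add, map_smul, map_smul, h'.null, smul_zero, add_zero] at hnull
    exact (smul_eq_zero.1 hnull).resolve_right (h'.fderiv_ne_zero hg1)
  have hY : fderiv ℝ ds 0 Y = β (fderiv ℝ ds 0 Y) • Y' := by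
    conv_lhs => rw [hαβ (fderiv ℝ ds 0 Y), hα, zero_smul, zero_add]
  set e := β (fderiv ℝ ds 0 Y)
  have h1 : fderiv ℝ dt 0 (fderiv ℝ (fderiv ℝ f) 0 Y Y) =
      fderiv ℝ g 0 ((e * e) • v + fderiv ℝ (fderiv ℝ ds) 0 Y Y) := by
    have h2 := ht1.2 Y
    rw [h.null, map_zero, zero_add, heq2, hs1.2 Y, hY] at h2
    rw [← h2, map_smul, map_smul, smul_apply, smul_smul, hv, ← map_smul, map_add]
  have hsurj : Function.Surjective (fderiv ℝ ds 0 : (Fin 2 → ℝ) →ₗ[ℝ] (Fin 2 → ℝ)) :=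
    LinearMap.injective_iff_surjective.1
      ((injective_iff_map_eq_zero _).2 fun v hv => hs.injective_fderiv hv)
  obtain ⟨w, hw⟩ := hsurj ((e * e) • v + fderiv ℝ (fderiv ℝ ds) 0 Y Y)
  rw [ContinuousLinearMap.coe_coe] at hw
  refine hT w ?_
  have h3 : fderiv ℝ dt 0 (fderiv ℝ (fderiv ℝ f) 0 Y Y - fderiv ℝ f 0 w) = 0 := by
    rw [map_sub, h1, ← hw, ← hs1.1, ← ht1.1, heq1, sub_self]
  exact sub_eq_zero.1 (ht.injective_fderiv h3)

/-! ### Germs of corank one as graphs -/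

theorem fderiv_comp_zero {E F G : Type*} [NormedAddCommGroup E] [NormedSpace ℝ E]
    [NormedAddCommGroup F] [NormedSpace ℝ F] [NormedAddCommGroup G] [NormedSpace ℝ G]
    {h : F → G} {d : E → F} (hh : SmoothGerm h) (hd : SmoothGerm d) (h0 : d 0 = 0) (v : E) :
    fderiv ℝ (fun p => h (d p)) 0 v = fderiv ℝ h 0 (fderiv ℝ d 0 v) := by
  have h1 : HasFDerivAt h (fderiv ℝ h 0) (d 0) := by
    rw [h0]
    exact hh.differentiableAt.hasFDerivAt
  exact congrArg (fun A => A v) (h1.comp 0 hd.differentiableAt.hasFDerivAt).fderiv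

section Graph

variable {G H : (Fin 2 → ℝ) → ℝ}

theorem fderiv_graph {p : Fin 2 → ℝ} (hG : DifferentiableAt ℝ G p) (hH : DifferentiableAt ℝ H p)
    (v : Fin 2 → ℝ) :
    fderiv ℝ (fun p => ![p 0, G p, H p]) p v = ![v 0, fderiv ℝ G p v, fderiv ℝ H p v] := by
  have hd : DifferentiableAt ℝ (fun p : Fin 2 → ℝ => ![p 0, G p, H p]) p := by
    rw [differentiableAt_pi]
    intro i
    fin_cases i
    · exact differentiableAt_apply 0 p
    · exact hG
    · exact hH
  ext i
  rw [← fderiv_component hd]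
  fin_cases i
  · exact fderiv_coord 0 p v
  · rfl
  · rfl

theorem snd_fderiv_graph (hG : SmoothGerm G) (hH : SmoothGerm H) :
    ∀ᶠ p in 𝓝 (0 : Fin 2 → ℝ),
      fderiv ℝ (fderiv ℝ fun p => ![p 0, G p, H p]) p ![0, 1] ![0, 1] =
        ![0, fderiv ℝ (fun q => fderiv ℝ G q ![0, 1]) p ![0, 1],
          fderiv ℝ (fun q => fderiv ℝ H q ![0, 1]) p ![0, 1]] := by
  have hk : SmoothGerm fun p => ![p 0, G p, H p] := (SmoothGerm.coord 0).vec3 hG hH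
  have hG1 : SmoothGerm fun q => fderiv ℝ G q ![0, 1] := hG.fderiv_apply (SmoothGerm.const _)
  have hH1 : SmoothGerm fun q => fderiv ℝ H q ![0, 1] := hH.fderiv_apply (SmoothGerm.const _)
  have h1 : ∀ᶠ p in 𝓝 (0 : Fin 2 → ℝ), fderiv ℝ (fun p => ![p 0, G p, H p]) p ![0, 1] =
      ![0, fderiv ℝ G p ![0, 1], fderiv ℝ H p ![0, 1]] := by
    filter_upwards [hG.eventually_differentiableAt, hH.eventually_differentiableAt] with p hp hq
    simpa using fderiv_graph hp hq ![0, 1]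
  have hv : SmoothGerm fun p => ![0, fderiv ℝ G p ![0, 1], fderiv ℝ H p ![0, 1]] :=
    (SmoothGerm.const 0).vec3 hG1 hH1
  filter_upwards [h1.eventually_nhds, hk.fderiv_right.eventually_differentiableAt,
    hv.eventually_differentiableAt] with p hp hq hr
  have h2 : fderiv ℝ (fderiv ℝ fun p => ![p 0, G p, H p]) p ![0, 1] ![0, 1] =
      fderiv ℝ (fun q => fderiv ℝ (fun p => ![p 0, G p, H p]) q ![0, 1]) p ![0, 1] := by
    rw [fderiv_clm_apply hq (by fun_prop)]
    simp
  rw [h2, Filter.EventuallyEq.fderiv_eq hp]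
  ext i
  rw [← fderiv_component hr]
  fin_cases i
  · simp
  · rfl
  · rfl

/-- `phi` of a germ of the form `(x, G, H)` in the coordinate frame. -/
theorem phi_graph (hG : SmoothGerm G) (hH : SmoothGerm H) :
    phi (fun _ => ![1, 0]) (fun _ => ![0, 1]) (fun p => ![p 0, G p, H p]) =ᶠ[𝓝 0] fun p =>
      fderiv ℝ G p ![0, 1] * fderiv ℝ (fun q => fderiv ℝ H q ![0, 1]) p ![0, 1] -
        fderiv ℝ H p ![0, 1] * fderiv ℝ (fun q => fderiv ℝ G q ![0, 1]) p ![0, 1] := by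
  filter_upwards [phi_eventuallyEq ((SmoothGerm.coord 0).vec3 hG hH) (X := fun _ => ![1, 0])
    (Y := fun _ => ![0, 1]) (SmoothGerm.const _), snd_fderiv_graph hG hH,
    hG.eventually_differentiableAt, hH.eventually_differentiableAt] with p h1 h2 h3 h4
  rw [h1, phiAt, h2, fderiv_graph h3 h4, fderiv_graph h3 h4, det3_eq]
  simp
  ring

theorem linearIndependent_axes : LinearIndependent ℝ ![(![1, 0] : Fin 2 → ℝ), ![0, 1]] := by
  rw [linearIndependent_pair_iff_det]
  simp

theorem isNullFrame_graph (hG : SmoothGerm G) (hH : SmoothGerm H)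
    (hG1 : fderiv ℝ G 0 ![0, 1] = 0) (hH1 : fderiv ℝ H 0 ![0, 1] = 0) :
    IsNullFrame (fun p => ![p 0, G p, H p]) (fun _ => ![1, 0]) (fun _ => ![0, 1]) := by
  refine ⟨SmoothGerm.const _, SmoothGerm.const _, ?_, linearIndependent_axes⟩
  rw [fderiv_graph hG.differentiableAt hH.differentiableAt, hG1, hH1]
  ext i; fin_cases i <;> rfl

theorem fderiv_graph_ne_zero (hG : SmoothGerm G) (hH : SmoothGerm H) :
    fderiv ℝ (fun p => ![p 0, G p, H p]) 0 ≠ 0 := by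
  intro h
  have h1 := fderiv_graph hG.differentiableAt hH.differentiableAt ![1, 0]
  rw [h] at h1
  simpa using congrFun h1 0

/-- If `G_yy` and `H_yy` both vanish at the origin, then `phi` is `o(y²)` on the `y`-axis, so the
discriminant of its leading form cannot be positive. -/
theorem snd_ne_zero_of_qSign (hG : SmoothGerm G) (hH : SmoothGerm H)
    (hG1 : fderiv ℝ G 0 ![0, 1] = 0) (hH1 : fderiv ℝ H 0 ![0, 1] = 0)
    (hq : QSign 1 (phi (fun _ => ![1, 0]) (fun _ => ![0, 1]) fun p => ![p 0, G p, H p])) :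
    fderiv ℝ (fun q => fderiv ℝ G q ![0, 1]) 0 ![0, 1] ≠ 0 ∨
      fderiv ℝ (fun q => fderiv ℝ H q ![0, 1]) 0 ![0, 1] ≠ 0 := by
  by_contra! hcon
  obtain ⟨hG2, hH2⟩ := hcon
  obtain ⟨a, b, c, hq, hs⟩ := hq
  have hline : HasDerivAt (fun t : ℝ => (![0, t] : Fin 2 → ℝ)) ![0, 1] 0 :=
    hasDerivAt_vec2_right 0 0
  have hlt : Tendsto (fun t : ℝ => (![0, t] : Fin 2 → ℝ)) (𝓝 0) (𝓝 0) := by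
    have := hline.continuousAt.tendsto
    rwa [vec2_zero] at this
  have hO : ∀ F : (Fin 2 → ℝ) → ℝ, SmoothGerm F → F 0 = 0 →
      (fun t : ℝ => F ![0, t]) =O[𝓝 0] fun t => t := by
    intro F hF h0
    have h1 : (fun t : ℝ => ‖(![0, t] : Fin 2 → ℝ)‖) =O[𝓝 0] fun t => t := by
      have := hline.hasFDerivAt.isBigO_sub
      simpa [vec2_zero] using this.norm_left
    exact ((hF.isBigO h0).comp_tendsto hlt).trans h1
  have ho : ∀ F : (Fin 2 → ℝ) → ℝ, SmoothGerm F → F 0 = 0 → fderiv ℝ F 0 ![0, 1] = 0 →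
      (fun t : ℝ => F ![0, t]) =o[𝓝 0] fun t => t := by
    intro F hF h0 h1
    have h2 : HasFDerivAt F (fderiv ℝ F 0) ![0, 0] := by
      rw [vec2_zero]
      exact hF.differentiableAt.hasFDerivAt
    have h3 := (h2.comp_hasDerivAt (0 : ℝ) hline).isLittleO
    simpa [h1, vec2_zero, h0] using h3
  have hGs : SmoothGerm fun q => fderiv ℝ G q ![0, 1] := hG.fderiv_apply (SmoothGerm.const _)
  have hHs : SmoothGerm fun q => fderiv ℝ H q ![0, 1] := hH.fderiv_apply (SmoothGerm.const _)
  have h1 := (ho _ hGs hG1 hG2).mul_isBigO (hO _ (hHs.fderiv_apply (SmoothGerm.const _)) hH2)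
  have h2 := (ho _ hHs hH1 hH2).mul_isBigO (hO _ (hGs.fderiv_apply (SmoothGerm.const _)) hG2)
  have h3 := h1.sub h2
  have h4 : ((fun p : Fin 2 → ℝ => ‖p‖ ^ 2) ∘ fun t : ℝ => ![0, t]) =O[𝓝 0] fun t => t * t := by
    have := hline.hasFDerivAt.isBigO_sub
    simp only [vec2_zero, sub_zero] at this
    exact (this.norm_left.mul this.norm_left).congr_left fun t => (sq _).symm
  have h5 := (hq.comp_tendsto hlt).trans_isBigO h4
  have h6 := (h3.sub h5).congr' (f₂ := fun t => 0 * t + c * t ^ 2) (g₂ := fun t => t ^ 2) ?_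
    (Eventually.of_forall fun t => (sq t).symm)
  · obtain ⟨-, hc⟩ := eq_zero_of_isLittleO_sq h6
    rw [hc] at hs
    nlinarith [sq_nonneg b]
  · filter_upwards [hlt.eventually (phi_graph hG hH)] with t ht
    simp only [Function.comp_apply, ht, Matrix.cons_val_zero, Matrix.cons_val_one]
    ring

end Graph

/-- A germ of corank one is, in suitable coordinates, of the form `(x, G, H)` with `G_y` and `H_y`
vanishing at the origin. -/
theorem exists_graph {f : (Fin 2 → ℝ) → (Fin 3 → ℝ)} (hf : SmoothGerm f) (hf0 : f 0 = 0)
    (hf1 : fderiv ℝ f 0 ≠ 0) {X Y : Fin 2 → ℝ} (h : IsNullFrame f (fun _ => X) (fun _ => Y)) :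
    ∃ G H : (Fin 2 → ℝ) → ℝ, SmoothGerm G ∧ SmoothGerm H ∧ G 0 = 0 ∧ H 0 = 0 ∧
      fderiv ℝ G 0 ![0, 1] = 0 ∧ fderiv ℝ H 0 ![0, 1] = 0 ∧
      AEquiv f (fun p => ![p 0, G p, H p]) := by
  obtain ⟨L, hL⟩ := SeparatingDual.exists_continuousLinearEquiv_apply_eq (R := ℝ)
    (h.fderiv_ne_zero hf1) (y := (![1, 0, 0] : Fin 3 → ℝ)) (fun h0 => by simpa using congrFun h0 0)
  have hLs : SmoothGerm (L : (Fin 3 → ℝ) → (Fin 3 → ℝ)) := L.contDiff.smoothGerm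
  have hLd : IsDiffeo (L : (Fin 3 → ℝ) → (Fin 3 → ℝ)) := by
    refine isDiffeo_of_injective hLs (map_zero L) fun v hv => ?_
    rw [L.fderiv] at hv
    exact (map_eq_zero_iff L L.injective).1 hv
  let k : (Fin 2 → ℝ) → (Fin 3 → ℝ) := fun p => L (f p)
  have hk : SmoothGerm k := hLs.comp hf hf0
  have hk0 : k 0 = 0 := by simp [k, hf0]
  have hdk : ∀ v, fderiv ℝ k 0 v = L (fderiv ℝ f 0 v) := by
    intro v
    have := fderiv_comp_zero hLs hf hf0 v
    rwa [L.fderiv] at this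
  have hkX : fderiv ℝ k 0 X = ![1, 0, 0] := by rw [hdk, hL]
  have hkY : fderiv ℝ k 0 Y = 0 := by rw [hdk, h.null, map_zero]
  obtain ⟨α, β, hαβ⟩ := exists_frame_coordinates h.linearIndependent
  have hkv : ∀ v, fderiv ℝ k 0 v = α v • ![1, 0, 0] := by
    intro v
    conv_lhs => rw [hαβ v, map_add, map_smul, map_smul, hkX, hkY, smul_zero, add_zero]
  -- new source coordinates: the first component of `L ∘ f`, and the `Y`-coordinate
  have hβs : SmoothGerm (β : (Fin 2 → ℝ) → ℝ) := β.contDiff.smoothGerm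
  have hds : SmoothGerm fun p => ![k p 0, β p] := (hk.apply 0).vec2 hβs
  have hdv : ∀ v, fderiv ℝ (fun p => ![k p 0, β p]) 0 v = ![α v, β v] := by
    intro v
    ext i
    rw [← fderiv_component hds.differentiableAt]
    fin_cases i
    · change fderiv ℝ (fun q => k q 0) 0 v = α v
      rw [fderiv_component hk.differentiableAt, hkv]
      simp
    · change fderiv ℝ (fun q => β q) 0 v = β v
      rw [β.fderiv]
  have hd : IsDiffeo fun p => ![k p 0, β p] := by
    refine isDiffeo_of_injective hds ?_ fun v hv => ?_
    · simp [hk0, vec2_zero]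
    · rw [hdv] at hv
      have h0 : α v = 0 := by simpa using congrFun hv 0
      have h1 : β v = 0 := by simpa using congrFun hv 1
      rw [hαβ v, h0, h1, zero_smul, zero_smul, add_zero]
  obtain ⟨e, he, hed, hde⟩ := hd.exists_inverse
  have hes : SmoothGerm e := he.1
  have hke : SmoothGerm fun p => k (e p) := hk.comp hes he.2.1
  have hder : fderiv ℝ (fun p => k (e p)) 0 ![0, 1] = 0 := by
    have h1 := fderiv_comp_zero hds hes he.2.1 ![0, 1]
    rw [Filter.EventuallyEq.fderiv_eq (f := fun p => p) hde, fderiv_fun_id, hdv] at h1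
    have h2 : α (fderiv ℝ e 0 ![0, 1]) = 0 := by simpa using (congrFun h1 0).symm
    rw [fderiv_comp_zero hk hes he.2.1, hkv, h2, zero_smul]
  refine ⟨fun p => k (e p) 1, fun p => k (e p) 2, hke.apply 1, hke.apply 2, by simp [he.2.1, hk0],
    by simp [he.2.1, hk0], ?_, ?_, ?_⟩
  · rw [fderiv_component hke.differentiableAt, hder]
    rfl
  · rw [fderiv_component hke.differentiableAt, hder]
    rfl
  · have h1 : AEquiv f k := AEquiv.of_target hLd
    have h2 : AEquiv k fun p => k (e p) :=
      (AEquiv.of_source he).symm hke (by simp [he.2.1, hk0])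
    refine (h1.trans h2).trans (AEquiv.of_eventuallyEq ?_)
    filter_upwards [hde] with p hp
    have h3 : k (e p) 0 = p 0 := by simpa using congrFun hp 0
    ext i
    fin_cases i
    · exact h3
    · rfl
    · rfl

theorem AEquiv.swap (G H : (Fin 2 → ℝ) → ℝ) :
    AEquiv (fun p => ![p 0, G p, H p]) (fun p => ![p 0, H p, G p]) := by
  have hd : IsDiffeo fun q : Fin 3 → ℝ => ![q 0, q 2, q 1] := by
    have hs : SmoothGerm fun q : Fin 3 → ℝ => ![q 0, q 2, q 1] :=
      (SmoothGerm.coord 0).vec3 (SmoothGerm.coord 2) (SmoothGerm.coord 1)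
    have h0 : (![(0 : Fin 3 → ℝ) 0, (0 : Fin 3 → ℝ) 2, (0 : Fin 3 → ℝ) 1]) = 0 := by
      ext i; fin_cases i <;> rfl
    have h1 : ∀ q : Fin 3 → ℝ, ![q 0, q 1, q 2] = q := fun q => by
      ext i; fin_cases i <;> rfl
    exact ⟨hs, h0, _, hs, h0, Eventually.of_forall h1, Eventually.of_forall h1⟩
  exact AEquiv.of_target hd

/-- The germ `(x, y) ↦ (x, y², y b(x, y²))`. -/
def evenForm (b : (Fin 2 → ℝ) → ℝ) : (Fin 2 → ℝ) → (Fin 3 → ℝ) :=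
  fun p => ![p 0, p 1 ^ 2, p 1 * b ![p 0, p 1 ^ 2]]

/-- When `G_yy` does not vanish, the Morse lemma turns `G` into `y²`, and Whitney's theorem splits
off from `H` its part even in `y`, which is removed in the target. -/
theorem exists_evenForm {G H : (Fin 2 → ℝ) → ℝ} (hG : SmoothGerm G) (hH : SmoothGerm H)
    (hG0 : G 0 = 0) (hH0 : H 0 = 0) (hG1 : fderiv ℝ G 0 ![0, 1] = 0)
    (hG2 : fderiv ℝ (fun q => fderiv ℝ G q ![0, 1]) 0 ![0, 1] ≠ 0) :
    ∃ b : (Fin 2 → ℝ) → ℝ, SmoothGerm b ∧ AEquiv (fun p => ![p 0, G p, H p]) (evenForm b) := by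
  obtain ⟨σ, hσ, hpos⟩ : ∃ σ : ℝ, σ ^ 2 = 1 ∧
      0 < σ * fderiv ℝ (fun q => fderiv ℝ G q ![0, 1]) 0 ![0, 1] := by
    rcases lt_or_gt_of_ne hG2 with h | h
    · exact ⟨-1, by norm_num, by linarith⟩
    · exact ⟨1, by norm_num, by linarith⟩
  obtain ⟨c, Y, hc, hY, hY0, hY1, hGc⟩ := hG.exists_morse hσ hG1 hpos
  have hc0 : c 0 = 0 := by
    have := hGc.self_of_nhds
    simp only [hG0, hY0, Pi.zero_apply] at this
    linarith
  have hds : SmoothGerm fun p : Fin 2 → ℝ => ![p 0, Y p] := (SmoothGerm.coord 0).vec2 hY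
  have hd : IsDiffeo fun p : Fin 2 → ℝ => ![p 0, Y p] := by
    refine isDiffeo_of_injective hds ?_ fun v hv => ?_
    · simp [hY0, vec2_zero]
    · have h0 := fderiv_component hds.differentiableAt v 0
      have h1 := fderiv_component hds.differentiableAt v 1
      rw [hv] at h0 h1
      simp only [Matrix.cons_val_zero, Matrix.cons_val_one, Pi.zero_apply] at h0 h1
      rw [fderiv_coord] at h0
      rw [eq_smul_add_smul v, map_add, map_smul, map_smul, h0, zero_smul, zero_add,
        smul_eq_mul] at h1
      rw [eq_smul_add_smul v, h0, (mul_eq_zero.1 h1).resolve_right hY1.ne']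
      simp
  obtain ⟨e, he, hed, hde⟩ := hd.exists_inverse
  have hes : SmoothGerm e := he.1
  have hHe : SmoothGerm fun p => H (e p) := hH.comp hes he.2.1
  obtain ⟨E, b, hE, hb, hEb⟩ := hHe.exists_even_odd
  have hE0 : E 0 = 0 := by
    have := hEb.self_of_nhds
    simp only [he.2.1, hH0, Pi.zero_apply] at this
    rw [show (![0, 0 ^ 2] : Fin 2 → ℝ) = 0 by ext i; fin_cases i <;> simp] at this
    linarith
  -- target coordinates in which the second component is `Y²` and the third one is odd in `Y`
  let T : (Fin 3 → ℝ) → (Fin 3 → ℝ) := fun q =>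
    ![q 0, σ * (q 1 - c (q 0)), q 2 - E ![q 0, σ * (q 1 - c (q 0))]]
  let T' : (Fin 3 → ℝ) → (Fin 3 → ℝ) := fun q =>
    ![q 0, σ * q 1 + c (q 0), q 2 + E ![q 0, q 1]]
  have hcq : SmoothGerm fun q : Fin 3 → ℝ => c (q 0) := hc.comp (SmoothGerm.coord 0) rfl
  have hT1 : SmoothGerm fun q : Fin 3 → ℝ => σ * (q 1 - c (q 0)) :=
    (SmoothGerm.const σ).mul ((SmoothGerm.coord 1).sub hcq)
  have hTs : SmoothGerm T := (SmoothGerm.coord 0).vec3 hT1 ((SmoothGerm.coord 2).sub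
    (hE.smoothGerm.comp ((SmoothGerm.coord 0).vec2 hT1) (by simp [hc0, vec2_zero])))
  have hTs' : SmoothGerm T' := (SmoothGerm.coord 0).vec3
    (((SmoothGerm.const σ).mul (SmoothGerm.coord 1)).add hcq) ((SmoothGerm.coord 2).add
    (hE.smoothGerm.comp ((SmoothGerm.coord 0).vec2 (SmoothGerm.coord 1)) (by simp [vec2_zero])))
  have hT : IsDiffeo T := by
    refine ⟨hTs, ?_, T', hTs', ?_, Eventually.of_forall fun q => ?_,
      Eventually.of_forall fun q => ?_⟩
    · ext i; fin_cases i <;> simp [T, hc0, vec2_zero, hE0]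
    · ext i; fin_cases i <;> simp [T', hc0, vec2_zero, hE0]
    · ext i; fin_cases i
      · simp [T, T']
      · simp only [T, T', Fin.mk_one, Matrix.cons_val_zero, Matrix.cons_val_one]
        linear_combination (q 1 - c (q 0)) * hσ
      · simp [T, T']
    · have h1 : σ * (σ * q 1 + c (q 0) - c (q 0)) = q 1 := by linear_combination q 1 * hσ
      ext i; fin_cases i
      · simp [T, T']
      · simp only [T, T', Fin.mk_one, Matrix.cons_val_zero, Matrix.cons_val_one]
        exact h1
      · simp only [T, T', Matrix.cons_val_zero, Matrix.cons_val_one, h1]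
        simp
  refine ⟨b, hb.smoothGerm, ?_⟩
  let k : (Fin 2 → ℝ) → (Fin 3 → ℝ) := fun p => ![p 0, G p, H p]
  have hk : SmoothGerm k := (SmoothGerm.coord 0).vec3 hG hH
  have hk0 : k 0 = 0 := by
    ext i; fin_cases i <;> simp [k, hG0, hH0]
  have h1 : AEquiv k fun p => k (e p) :=
    (AEquiv.of_source he).symm (hk.comp hes he.2.1) (by simp only [he.2.1, hk0])
  refine (h1.trans (AEquiv.of_target hT)).trans (AEquiv.of_eventuallyEq ?_)
  filter_upwards [hde, he.tendsto.eventually hGc, hEb] with p h2 h3 h4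
  have h5 : e p 0 = p 0 := by simpa using congrFun h2 0
  have h6 : Y (e p) = p 1 := by simpa using congrFun h2 1
  have h7 : σ * (G (e p) - c (p 0)) = p 1 ^ 2 := by
    rw [h3, h5, h6]
    linear_combination p 1 ^ 2 * hσ
  ext i; fin_cases i
  · simp [T, k, evenForm, h5]
  · simp [T, k, evenForm, h5, h7]
  · simp [T, k, evenForm, h5, h7, h4]

/-! ### The germs `(x, y², y b(x, y²))` -/

/-- The substitution `(x, y) ↦ (x, y²)`. -/
def fold (p : Fin 2 → ℝ) : Fin 2 → ℝ := ![p 0, p 1 ^ 2]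

theorem smoothGerm_fold : SmoothGerm fold :=
  (SmoothGerm.coord 0).vec2 ((SmoothGerm.coord 1).pow 2)

theorem fold_zero : fold 0 = 0 := by
  ext i; fin_cases i <;> simp [fold]

theorem tendsto_fold : Tendsto fold (𝓝 0) (𝓝 0) := by
  have := smoothGerm_fold.continuousAt
  rwa [ContinuousAt, fold_zero] at this

theorem fderiv_fold (p v : Fin 2 → ℝ) : fderiv ℝ fold p v = ![v 0, 2 * p 1 * v 1] := by
  have hd : DifferentiableAt ℝ fold p := by
    rw [differentiableAt_pi]
    intro i
    fin_cases i
    · exact differentiableAt_apply 0 p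
    · exact (differentiableAt_apply 1 p).pow 2
  ext i
  rw [← fderiv_component hd]
  fin_cases i
  · exact fderiv_coord 0 p v
  · change fderiv ℝ (fun q : Fin 2 → ℝ => q 1 ^ 2) p v = 2 * p 1 * v 1
    rw [fderiv_fun_pow 2 (differentiableAt_apply 1 p)]
    simp [fderiv_coord]

theorem fderiv_sq_coord (p : Fin 2 → ℝ) :
    fderiv ℝ (fun q : Fin 2 → ℝ => q 1 ^ 2) p ![0, 1] = 2 * p 1 := by
  rw [fderiv_fun_pow 2 (differentiableAt_apply 1 p)]
  simp [fderiv_coord]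

theorem snd_fderiv_sq_coord (p : Fin 2 → ℝ) :
    fderiv ℝ (fun q => fderiv ℝ (fun q : Fin 2 → ℝ => q 1 ^ 2) q ![0, 1]) p ![0, 1] = 2 := by
  simp only [fderiv_sq_coord]
  rw [fderiv_const_mul (differentiableAt_apply 1 p)]
  simp [fderiv_coord]

section EvenForm

variable {b : (Fin 2 → ℝ) → ℝ}

theorem SmoothGerm.comp_fold (hb : SmoothGerm b) : SmoothGerm fun p => b (fold p) :=
  hb.comp smoothGerm_fold fold_zero

theorem fderiv_comp_fold (hb : SmoothGerm b) : ∀ᶠ p in 𝓝 (0 : Fin 2 → ℝ),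
    fderiv ℝ (fun q => b (fold q)) p ![0, 1] = p 1 * (2 * fderiv ℝ b (fold p) ![0, 1]) := by
  filter_upwards [tendsto_fold.eventually hb.eventually_differentiableAt,
    smoothGerm_fold.eventually_differentiableAt] with p h1 h2
  have h3 := (h1.hasFDerivAt.comp p h2.hasFDerivAt).fderiv
  refine (congrArg (fun A => A ![0, 1]) h3).trans ?_
  simp only [ContinuousLinearMap.comp_apply, fderiv_fold]
  rw [show (![(![0, 1] : Fin 2 → ℝ) 0, 2 * p 1 * (![0, 1] : Fin 2 → ℝ) 1] : Fin 2 → ℝ) =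
    (2 * p 1) • ![0, 1] by ext i; fin_cases i <;> simp, map_smul, smul_eq_mul]
  ring

theorem fderiv_odd (hb : SmoothGerm b) : ∀ᶠ p in 𝓝 (0 : Fin 2 → ℝ),
    fderiv ℝ (fun q : Fin 2 → ℝ => q 1 * b (fold q)) p ![0, 1] =
      b (fold p) + p 1 * (p 1 * (2 * fderiv ℝ b (fold p) ![0, 1])) := by
  filter_upwards [fderiv_comp_fold hb, hb.comp_fold.eventually_differentiableAt] with p h1 h2
  rw [fderiv_mul_coord EventuallyEq.rfl h2, h1]

/-- `phi` of the germ `(x, y², y b(x, y²))`, up to an error of third order. -/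
theorem phi_evenForm (hb : SmoothGerm b) : ∃ K : (Fin 2 → ℝ) → ℝ, SmoothGerm K ∧
    phi (fun _ => ![1, 0]) (fun _ => ![0, 1]) (evenForm b) =ᶠ[𝓝 0] fun p =>
      8 * p 1 ^ 2 * fderiv ℝ b (fold p) ![0, 1] - 2 * b (fold p) + p 1 ^ 3 * K p := by
  have hbv : SmoothGerm fun p => 2 * fderiv ℝ b (fold p) ![0, 1] :=
    (SmoothGerm.const 2).mul (hb.fderiv_apply (SmoothGerm.const _)).comp_fold
  have hK : SmoothGerm fun p =>
      fderiv ℝ (fun q => 2 * fderiv ℝ b (fold q) ![0, 1]) p ![0, 1] :=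
    hbv.fderiv_apply (SmoothGerm.const _)
  refine ⟨fun p => 2 * fderiv ℝ (fun q => 2 * fderiv ℝ b (fold q) ![0, 1]) p ![0, 1],
    (SmoothGerm.const 2).mul hK, ?_⟩
  have hG : SmoothGerm fun p : Fin 2 → ℝ => p 1 ^ 2 := (SmoothGerm.coord 1).pow 2
  have hH : SmoothGerm fun p : Fin 2 → ℝ => p 1 * b (fold p) :=
    (SmoothGerm.coord 1).mul hb.comp_fold
  filter_upwards [phi_graph hG hH, fderiv_odd hb, (fderiv_odd hb).eventually_nhds,
    fderiv_comp_fold hb, hb.comp_fold.eventually_differentiableAt,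
    hbv.eventually_differentiableAt,
    ((SmoothGerm.coord 1).mul hbv).eventually_differentiableAt,
    ((SmoothGerm.coord 1).mul ((SmoothGerm.coord 1).mul hbv)).eventually_differentiableAt]
    with p h1 h2 h3 h4 h5 h6 h7 h8
  refine h1.trans ?_
  rw [h2, fderiv_sq_coord, snd_fderiv_sq_coord, Filter.EventuallyEq.fderiv_eq h3,
    fderiv_fun_add h5 h8]
  simp only [add_apply]
  rw [h4, fderiv_mul_coord EventuallyEq.rfl h7, fderiv_mul_coord EventuallyEq.rfl h6]
  ring

theorem isNullFrame_evenForm (hb : SmoothGerm b) (hb0 : b 0 = 0) :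
    IsNullFrame (evenForm b) (fun _ => ![1, 0]) (fun _ => ![0, 1]) := by
  refine isNullFrame_graph ((SmoothGerm.coord 1).pow 2)
    ((SmoothGerm.coord 1).mul hb.comp_fold) ?_ ?_
  · rw [fderiv_sq_coord]
    simp
  · refine (fderiv_odd hb).self_of_nhds.trans ?_
    rw [fold_zero, hb0]
    simp

theorem smoothGerm_evenForm (hb : SmoothGerm b) : SmoothGerm (evenForm b) :=
  (SmoothGerm.coord 0).vec3 ((SmoothGerm.coord 1).pow 2) ((SmoothGerm.coord 1).mul hb.comp_fold)

theorem evenForm_zero : evenForm b 0 = 0 := by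
  ext i; fin_cases i <;> simp [evenForm]

theorem fderiv_evenForm_ne_zero (hb : SmoothGerm b) : fderiv ℝ (evenForm b) 0 ≠ 0 :=
  fderiv_graph_ne_zero ((SmoothGerm.coord 1).pow 2) ((SmoothGerm.coord 1).mul hb.comp_fold)

theorem isTransversal_evenForm (hb : SmoothGerm b) : IsTransversal (evenForm b) ![0, 1] := by
  intro v hv
  have hG : SmoothGerm fun p : Fin 2 → ℝ => p 1 ^ 2 := (SmoothGerm.coord 1).pow 2
  have hH : SmoothGerm fun p : Fin 2 → ℝ => p 1 * b (fold p) :=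
    (SmoothGerm.coord 1).mul hb.comp_fold
  have h1 := (snd_fderiv_graph hG hH).self_of_nhds
  have h2 := fderiv_graph hG.differentiableAt hH.differentiableAt v
  have h3 := congrFun (h1.symm.trans (hv.trans h2)) 1
  simp only [Matrix.cons_val_one, Matrix.cons_val_zero, snd_fderiv_sq_coord] at h3
  rw [fderiv_fun_pow 2 (differentiableAt_apply 1 _)] at h3
  simp at h3

/-- The Taylor expansion of order two of `b(x, y²)`. -/
theorem taylor_comp_fold (hb : SmoothGerm b) :
    (fun p => b (fold p) - (b 0 + fderiv ℝ b 0 ![1, 0] * p 0 + (fderiv ℝ b 0 ![0, 1] * p 1 ^ 2 +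
      fderiv ℝ (fderiv ℝ b) 0 ![1, 0] ![1, 0] / 2 * p 0 ^ 2))) =o[𝓝 0] fun p => ‖p‖ ^ 2 := by
  set B := fderiv ℝ (fderiv ℝ b) 0
  have h1 := taylor_two (hb.contDiffAt.of_le (WithTop.coe_le_coe.2 le_top))
  have hO : fold =O[𝓝 0] fun p => ‖p‖ :=
    isBigO_of_differentiableAt smoothGerm_fold.differentiableAt fold_zero
  have h2 := (h1.comp_tendsto tendsto_fold).trans_isBigO (hO.norm_left.pow 2)
  have hcube : ∀ i : Fin 2, (fun p : Fin 2 → ℝ => p 1 ^ 2 * p i) =o[𝓝 0] fun p => ‖p‖ ^ 2 := by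
    intro i
    have h3 : (fun p : Fin 2 → ℝ => p i) =o[𝓝 0] fun _ => (1 : ℝ) := by
      rw [isLittleO_one_iff]
      exact tendsto_coord i
    exact (((isBigO_coord 1).pow 2).mul_isLittleO h3).congr_right fun p => mul_one _
  have h4 : (fun p : Fin 2 → ℝ => p 1 ^ 2 * p 1 * p 1) =o[𝓝 0] fun p => ‖p‖ ^ 2 :=
    ((hcube 1).mul_isBigO (((SmoothGerm.coord (1 : Fin 2)).isBigO_one))).congr_right
      fun p => mul_one _
  have h5 := ((hcube 0).const_mul_left (B ![1, 0] ![0, 1] / 2 + B ![0, 1] ![1, 0] / 2)).add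
    (h4.const_mul_left (B ![0, 1] ![0, 1] / 2))
  refine (h2.add h5).congr_left fun p => ?_
  have h6 : fold p = p 0 • ![1, 0] + p 1 ^ 2 • ![0, 1] := eq_smul_add_smul (fold p)
  have h7 : B (fold p) (fold p) = p 0 ^ 2 * B ![1, 0] ![1, 0] +
      p 0 * p 1 ^ 2 * (B ![1, 0] ![0, 1] + B ![0, 1] ![1, 0]) +
      p 1 ^ 4 * B ![0, 1] ![0, 1] := by
    rw [h6]
    simp only [map_add, map_smul, add_apply, smul_apply, smul_eq_mul]
    ring
  have h8 : fderiv ℝ b 0 (fold p) =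
      p 0 * fderiv ℝ b 0 ![1, 0] + p 1 ^ 2 * fderiv ℝ b 0 ![0, 1] := by
    rw [h6, map_add, map_smul, map_smul, smul_eq_mul, smul_eq_mul]
  simp only [Function.comp_apply]
  rw [h7, h8]
  ring

/-- The expansion of `phi` of the germ `(x, y², y b(x, y²))` to second order. -/
theorem phi_evenForm_isLittleO (hb : SmoothGerm b) :
    (fun p => phi (fun _ => ![1, 0]) (fun _ => ![0, 1]) (evenForm b) p -
      (-2 * b 0 + -2 * fderiv ℝ b 0 ![1, 0] * p 0 +
        (-fderiv ℝ (fderiv ℝ b) 0 ![1, 0] ![1, 0] * p 0 ^ 2 +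
          6 * fderiv ℝ b 0 ![0, 1] * p 1 ^ 2))) =o[𝓝 0] fun p => ‖p‖ ^ 2 := by
  obtain ⟨K, hK, hφ⟩ := phi_evenForm hb
  have h1 : (fun p : Fin 2 → ℝ => p 1 ^ 2 * (8 * fderiv ℝ b (fold p) ![0, 1] -
      8 * fderiv ℝ b 0 ![0, 1] + p 1 * K p)) =o[𝓝 0] fun p => ‖p‖ ^ 2 := by
    have h2 : SmoothGerm fun p : Fin 2 → ℝ => 8 * fderiv ℝ b (fold p) ![0, 1] -
        8 * fderiv ℝ b 0 ![0, 1] + p 1 * K p :=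
      (((SmoothGerm.const 8).mul (hb.fderiv_apply (SmoothGerm.const _)).comp_fold).sub
        (SmoothGerm.const _)).add ((SmoothGerm.coord 1).mul hK)
    have h3 : (fun p : Fin 2 → ℝ => 8 * fderiv ℝ b (fold p) ![0, 1] -
        8 * fderiv ℝ b 0 ![0, 1] + p 1 * K p) =o[𝓝 0] fun _ => (1 : ℝ) := by
      rw [isLittleO_one_iff]
      simpa [ContinuousAt, fold_zero] using h2.continuousAt
    exact (((isBigO_coord 1).pow 2).mul_isLittleO h3).congr_right fun p => mul_one _
  refine (h1.sub ((taylor_comp_fold hb).const_mul_left 2)).congr' ?_ EventuallyEq.rfl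
  filter_upwards [hφ] with p hp
  rw [hp]
  ring

theorem evenForm_of_qSign (hb : SmoothGerm b) {s : ℝ}
    (h : QSign s (phi (fun _ => ![1, 0]) (fun _ => ![0, 1]) (evenForm b))) (hb0 : b 0 = 0) :
    fderiv ℝ b 0 ![1, 0] = 0 ∧
      s * (fderiv ℝ (fderiv ℝ b) 0 ![1, 0] ![1, 0] * fderiv ℝ b 0 ![0, 1]) < 0 := by
  obtain ⟨l, m, n, hq, hs⟩ := h
  have h1 := (hq.sub (phi_evenForm_isLittleO hb)).congr_left (f₂ := fun p =>
    -2 * fderiv ℝ b 0 ![1, 0] * p 0 + 0 * p 1 +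
      ((-fderiv ℝ (fderiv ℝ b) 0 ![1, 0] ![1, 0] - l) * p 0 ^ 2 + 2 * (-m) * p 0 * p 1 +
        (6 * fderiv ℝ b 0 ![0, 1] - n) * p 1 ^ 2)) fun p => by rw [hb0]; ring
  obtain ⟨h2, -, h3, h4, h5⟩ := quad_unique h1
  refine ⟨by linarith, ?_⟩
  have hl : l = -fderiv ℝ (fderiv ℝ b) 0 ![1, 0] ![1, 0] := by linarith
  have hn : n = 6 * fderiv ℝ b 0 ![0, 1] := by linarith
  have hm : m = 0 := by linarith
  rw [hl, hn, hm] at hs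
  nlinarith

end EvenForm

/-- The two Chen–Matumoto–Mond germs `(x, y², y (x² - s y²))`, `s = ±1`, as germs of the form
`(x, y², y b(x, y²))`. -/
def cmmCoeff (s : ℝ) : (Fin 2 → ℝ) → ℝ := fun q => q 0 ^ 2 - s * q 1

theorem cmmMinus_eq : cmmMinus = evenForm (cmmCoeff 1) := by
  ext p i; fin_cases i <;> simp [cmmMinus, evenForm, cmmCoeff]

theorem cmmPlus_eq : cmmPlus = evenForm (cmmCoeff (-1)) := by
  ext p i; fin_cases i <;> simp [cmmPlus, evenForm, cmmCoeff]

theorem smoothGerm_cmmCoeff (s : ℝ) : SmoothGerm (cmmCoeff s) :=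
  ((SmoothGerm.coord 0).pow 2).sub ((SmoothGerm.const s).mul (SmoothGerm.coord 1))

theorem cmmCoeff_zero (s : ℝ) : cmmCoeff s 0 = 0 := by simp [cmmCoeff]

theorem fderiv_cmmCoeff (s : ℝ) (q v : Fin 2 → ℝ) :
    fderiv ℝ (cmmCoeff s) q v = 2 * q 0 * v 0 - s * v 1 := by
  have h0 := differentiableAt_apply (𝕜 := ℝ) (F' := fun _ : Fin 2 => ℝ) 0 q
  have h1 := differentiableAt_apply (𝕜 := ℝ) (F' := fun _ : Fin 2 => ℝ) 1 q
  have h2 : DifferentiableAt ℝ (fun q : Fin 2 → ℝ => q 0 ^ 2) q := h0.pow 2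
  unfold cmmCoeff
  rw [fderiv_fun_sub h2 (h1.const_mul s), fderiv_fun_pow 2 h0, fderiv_const_mul h1]
  simp [fderiv_coord]

theorem qSign_cmm {s : ℝ} (hs : s ^ 2 = 1) :
    QSign s (phi (fun _ => ![1, 0]) (fun _ => ![0, 1]) (evenForm (cmmCoeff s))) := by
  have h := phi_evenForm_isLittleO (smoothGerm_cmmCoeff s)
  have hxx : fderiv ℝ (fderiv ℝ (cmmCoeff s)) 0 ![1, 0] ![1, 0] = 2 := by
    have h1 : fderiv ℝ (fun q => fderiv ℝ (cmmCoeff s) q ![1, 0]) 0 ![1, 0] =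
        fderiv ℝ (fderiv ℝ (cmmCoeff s)) 0 ![1, 0] ![1, 0] := by
      rw [fderiv_clm_apply (smoothGerm_cmmCoeff s).fderiv_right.differentiableAt (by fun_prop)]
      simp
    rw [← h1]
    simp only [fderiv_cmmCoeff]
    simp only [Matrix.cons_val_zero, Matrix.cons_val_one, mul_zero, sub_zero, mul_one]
    rw [fderiv_const_mul (differentiableAt_apply 0 _)]
    simp [fderiv_coord]
  refine ⟨-2, 0, -6 * s, h.congr_left fun p => ?_, by nlinarith⟩
  rw [hxx, cmmCoeff_zero, fderiv_cmmCoeff, fderiv_cmmCoeff]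
  simp

end MapGerm

namespace MapGerm

/-! ### Recognition of the two models -/

/-- The germ `(x, y², y b(x, y²))` with `b = b_x = 0` and `s b_xx b_v < 0` at the origin is
equivalent to `(x, y², y (x² - s y²))`. By the Morse lemma in `x`, `b(x, v)` becomes
`v γ(v) + σ X(x, v)²`, and the remaining factors are absorbed by rescaling `y` and the target with
powers of `√|γ(y²)|`, which depends on the second target coordinate only. -/
theorem aEquiv_cmm_of_coeff {b : (Fin 2 → ℝ) → ℝ} (hb : SmoothGerm b) (hb0 : b 0 = 0)
    (hb1 : fderiv ℝ b 0 ![1, 0] = 0) {s : ℝ} (hs : s ^ 2 = 1)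
    (hneg : s * (fderiv ℝ (fderiv ℝ b) 0 ![1, 0] ![1, 0] * fderiv ℝ b 0 ![0, 1]) < 0) :
    AEquiv (evenForm b) (evenForm (cmmCoeff s)) := by
  set γ := fderiv ℝ (fderiv ℝ b) 0 ![1, 0] ![1, 0]
  set β := fderiv ℝ b 0 ![0, 1]
  obtain ⟨σ, hσ, hpos⟩ : ∃ σ : ℝ, σ ^ 2 = 1 ∧ 0 < σ * γ := by
    rcases lt_trichotomy γ 0 with h | h | h
    · exact ⟨-1, by norm_num, by linarith⟩
    · rw [h] at hneg
      simp at hneg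
    · exact ⟨1, by norm_num, by linarith⟩
  have hsβ : 0 < -(s * σ) * β := by
    have h1 : 0 < (-(s * σ) * β) * (σ * γ) := by
      rw [show (-(s * σ) * β) * (σ * γ) = -(s * (γ * β)) * σ ^ 2 by ring, hσ]
      linarith
    exact pos_of_mul_pos_left h1 hpos.le
  -- the Morse lemma is applied with the roles of the two variables exchanged
  let sw : (Fin 2 → ℝ) → (Fin 2 → ℝ) := fun p => ![p 1, p 0]
  have hsw : SmoothGerm sw := (SmoothGerm.coord 1).vec2 (SmoothGerm.coord 0)
  have hsw0 : sw 0 = 0 := by simp [sw, vec2_zero]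
  have hswt : Tendsto sw (𝓝 0) (𝓝 0) := by
    have := hsw.continuousAt
    rwa [ContinuousAt, hsw0] at this
  have hdsw : ∀ p v, fderiv ℝ sw p v = sw v := by
    intro p v
    have hd : DifferentiableAt ℝ sw p := by
      rw [differentiableAt_pi]
      intro i
      fin_cases i
      · exact differentiableAt_apply 1 p
      · exact differentiableAt_apply 0 p
    ext i
    rw [← fderiv_component hd]
    fin_cases i
    · exact fderiv_coord 1 p v
    · exact fderiv_coord 0 p v
  have hsw01 : sw ![0, 1] = ![1, 0] := rfl
  have hder : ∀ F : (Fin 2 → ℝ) → ℝ, SmoothGerm F → ∀ᶠ p in 𝓝 (0 : Fin 2 → ℝ),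
      fderiv ℝ (fun q => F (sw q)) p ![0, 1] = fderiv ℝ F (sw p) ![1, 0] := by
    intro F hF
    filter_upwards [hswt.eventually hF.eventually_differentiableAt,
      hsw.eventually_differentiableAt] with p h1 h2
    have h3 := (h1.hasFDerivAt.comp p h2.hasFDerivAt).fderiv
    refine (congrArg (fun A => A ![0, 1]) h3).trans ?_
    rw [ContinuousLinearMap.comp_apply, hdsw, hsw01]
  have hbx : SmoothGerm fun p => fderiv ℝ b p ![1, 0] := hb.fderiv_apply (SmoothGerm.const _)
  have hm1 : fderiv ℝ (fun q => b (sw q)) 0 ![0, 1] = 0 := by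
    rw [(hder b hb).self_of_nhds, hsw0, hb1]
  have hm2 : fderiv ℝ (fun p => fderiv ℝ (fun q => b (sw q)) p ![0, 1]) 0 ![0, 1] = γ := by
    rw [Filter.EventuallyEq.fderiv_eq (hder b hb), (hder _ hbx).self_of_nhds, hsw0,
      fderiv_clm_apply hb.fderiv_right.differentiableAt (by fun_prop)]
    simp [γ]
  obtain ⟨c, Z, hc, hZ, hZ0, hZ1, hbc⟩ :=
    (hb.comp hsw hsw0).exists_morse hσ hm1 (by rw [hm2]; exact hpos)
  let X : (Fin 2 → ℝ) → ℝ := fun p => Z (sw p)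
  have hX : SmoothGerm X := hZ.comp hsw hsw0
  have hX0 : X 0 = 0 := by simp only [X, hsw0, hZ0]
  have hX1 : 0 < fderiv ℝ X 0 ![1, 0] := by
    simp only [X]
    rw [fderiv_comp_zero hZ hsw hsw0, hdsw]
    exact hZ1
  have hbX : ∀ᶠ q in 𝓝 (0 : Fin 2 → ℝ), b q = c (q 1) + σ * X q ^ 2 := by
    filter_upwards [hswt.eventually hbc] with q hq
    have h1 : sw (sw q) = q := vec2_eta q
    rw [h1] at hq
    exact hq
  have hc0 : c 0 = 0 := by
    have := hbX.self_of_nhds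
    simp only [hb0, hX0, Pi.zero_apply] at this
    linarith
  obtain ⟨K, hK, hcK⟩ := (hc.comp (SmoothGerm.coord (1 : Fin 2)) rfl).exists_eq_mul
    (Eventually.of_forall fun p => by simp [hc0])
  have hK0 : K 0 = β := by
    have h1 : b =ᶠ[𝓝 0] fun q => q 1 * K q + X q * (σ * X q) := by
      filter_upwards [hbX, hcK] with q h2 h3
      rw [h2, h3]
      ring
    have hKd : DifferentiableAt ℝ (fun q : Fin 2 → ℝ => q 1 * K q) 0 :=
      ((SmoothGerm.coord 1).mul hK).differentiableAt
    have hσX : SmoothGerm fun q => σ * X q := (SmoothGerm.const σ).mul hX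
    have hXX : DifferentiableAt ℝ (fun q => X q * (σ * X q)) 0 := (hX.mul hσX).differentiableAt
    simp only [β]
    rw [h1.fderiv_eq, fderiv_fun_add hKd hXX, add_apply,
      fderiv_mul_coord EventuallyEq.rfl hK.differentiableAt,
      fderiv_fun_mul hX.differentiableAt hσX.differentiableAt]
    simp [hX0]
  -- `γ₁(v) = K(0, v)` is the quotient `c(v) / v`, and `-s σ γ₁ > 0`
  let κ : ℝ → ℝ := fun v => -(s * σ) * K ![0, v]
  have haxis : SmoothGerm fun v : ℝ => ![0, v] := (SmoothGerm.const 0).vec2 contDiff_id.smoothGerm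
  have hκ : SmoothGerm κ := (SmoothGerm.const _).mul (hK.comp haxis vec2_zero)
  have hκ0 : 0 < κ 0 := by simp only [κ, vec2_zero, hK0]; exact hsβ
  let ρ : ℝ → ℝ := fun v => Real.sqrt (κ v)
  have hρ : SmoothGerm ρ := hκ.sqrt hκ0.ne'
  have hρ0 : 0 < ρ 0 := Real.sqrt_pos.2 hκ0
  have hρ2 : ∀ᶠ v in 𝓝 (0 : ℝ), ρ v ^ 2 = κ v := by
    filter_upwards [hκ.continuousAt.eventually (lt_mem_nhds hκ0)] with v hv
    exact Real.sq_sqrt hv.le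
  have hcκ : ∀ᶠ v in 𝓝 (0 : ℝ), σ * c v = -s * (v * κ v) := by
    have ht : Tendsto (fun v : ℝ => (![0, v] : Fin 2 → ℝ)) (𝓝 0) (𝓝 0) := by
      have := haxis.continuousAt
      rwa [ContinuousAt, vec2_zero] at this
    filter_upwards [ht.eventually hcK] with v hv
    simp only [Matrix.cons_val_one, Matrix.cons_val_zero] at hv
    simp only [κ]
    rw [hv]
    linear_combination (-σ * v * K ![0, v]) * hs
  -- the source diffeomorphism
  have hρs : SmoothGerm fun p : Fin 2 → ℝ => ρ (p 1 ^ 2) :=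
    hρ.comp ((SmoothGerm.coord 1).pow 2) (by simp)
  have hds : IsDiffeo fun p : Fin 2 → ℝ => ![X (fold p), p 1 * ρ (p 1 ^ 2)] := by
    have hsm : SmoothGerm fun p : Fin 2 → ℝ => ![X (fold p), p 1 * ρ (p 1 ^ 2)] :=
      hX.comp_fold.vec2 ((SmoothGerm.coord 1).mul hρs)
    refine isDiffeo_of_injective hsm ?_ fun v hv => ?_
    · simp [fold_zero, hX0, vec2_zero]
    · have h0 := fderiv_component hsm.differentiableAt v 0
      have h1 := fderiv_component hsm.differentiableAt v 1
      rw [hv] at h0 h1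
      simp only [Matrix.cons_val_zero, Matrix.cons_val_one, Pi.zero_apply] at h0 h1
      rw [fderiv_comp_zero hX smoothGerm_fold fold_zero, fderiv_fold,
        show (![v 0, 2 * (0 : Fin 2 → ℝ) 1 * v 1] : Fin 2 → ℝ) = v 0 • ![1, 0] by
          ext i; fin_cases i <;> simp, map_smul, smul_eq_mul] at h0
      rw [fderiv_fun_mul (SmoothGerm.coord 1).differentiableAt hρs.differentiableAt] at h1
      simp [fderiv_coord, hρ0.ne'] at h1
      rw [eq_smul_add_smul v, (mul_eq_zero.1 h0).resolve_right hX1.ne', h1]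
      simp
  -- the target diffeomorphism
  have hX3 : SmoothGerm fun q : Fin 3 → ℝ => X ![q 0, q 1] :=
    hX.comp ((SmoothGerm.coord 0).vec2 (SmoothGerm.coord 1)) (by simp [vec2_zero])
  have hρ3 : SmoothGerm fun q : Fin 3 → ℝ => ρ (q 1) := hρ.comp (SmoothGerm.coord 1) rfl
  have hρσ : SmoothGerm fun q : Fin 3 → ℝ => σ * ρ (q 1) := (SmoothGerm.const σ).mul hρ3
  have hdt : IsDiffeo fun q : Fin 3 → ℝ =>
      ![X ![q 0, q 1], q 1 * ρ (q 1) ^ 2, q 2 * (σ * ρ (q 1))] := by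
    have hsm : SmoothGerm fun q : Fin 3 → ℝ =>
        ![X ![q 0, q 1], q 1 * ρ (q 1) ^ 2, q 2 * (σ * ρ (q 1))] :=
      hX3.vec3 ((SmoothGerm.coord 1).mul (hρ3.pow 2)) ((SmoothGerm.coord 2).mul hρσ)
    refine isDiffeo_of_injective hsm ?_ fun v hv => ?_
    · ext i; fin_cases i <;> simp [vec2_zero, hX0]
    · have h0 := fderiv_component hsm.differentiableAt v 0
      have h1 := fderiv_component hsm.differentiableAt v 1
      have h2 := fderiv_component hsm.differentiableAt v 2
      rw [hv] at h0 h1 h2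
      simp only [Matrix.cons_val_zero, Matrix.cons_val_one, Matrix.cons_val, Pi.zero_apply]
        at h0 h1 h2
      rw [fderiv_fun_mul (SmoothGerm.coord 1).differentiableAt (hρ3.pow 2).differentiableAt] at h1
      rw [fderiv_fun_mul (SmoothGerm.coord 2).differentiableAt hρσ.differentiableAt] at h2
      have hσ0 : σ ≠ 0 := by
        intro h
        rw [h] at hσ
        norm_num at hσ
      simp [fderiv_coord, hρ0.ne'] at h1
      simp [fderiv_coord, hρ0.ne', hσ0] at h2
      have hv2 : SmoothGerm fun q : Fin 3 → ℝ => ![q 0, q 1] :=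
        (SmoothGerm.coord 0).vec2 (SmoothGerm.coord 1)
      rw [fderiv_comp_zero hX hv2 (by simp [vec2_zero])] at h0
      have h3 : fderiv ℝ (fun q : Fin 3 → ℝ => ![q 0, q 1]) 0 v = v 0 • ![1, 0] := by
        ext i
        rw [← fderiv_component hv2.differentiableAt]
        fin_cases i
        · exact (fderiv_coord 0 0 v).trans (by simp)
        · exact (fderiv_coord 1 0 v).trans (by simp [h1])
      rw [h3, map_smul, smul_eq_mul] at h0
      have h4 := (mul_eq_zero.1 h0).resolve_right hX1.ne'
      ext i; fin_cases i
      · exact h4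
      · exact h1
      · exact h2
  refine ⟨_, _, hds, hdt, ?_⟩
  have hsq : Tendsto (fun p : Fin 2 → ℝ => p 1 ^ 2) (𝓝 0) (𝓝 0) := by
    simpa using (tendsto_coord 1).pow 2
  filter_upwards [tendsto_fold.eventually hbX, hsq.eventually hρ2, hsq.eventually hcκ]
    with p h1 h2 h3
  have h4 : b ![p 0, p 1 ^ 2] = c (p 1 ^ 2) + σ * X (fold p) ^ 2 := h1
  ext i; fin_cases i
  · simp [evenForm, fold]
  · simp [evenForm]
    ring
  · simp only [evenForm, cmmCoeff, fold, Matrix.cons_val, Matrix.cons_val_zero,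
      Matrix.cons_val_one, Fin.reduceFinMk]
    rw [h4]
    simp only [fold]
    linear_combination (p 1 * ρ (p 1 ^ 2)) * h3 +
      (p 1 * ρ (p 1 ^ 2) * X ![p 0, p 1 ^ 2] ^ 2) * hσ + s * p 1 ^ 3 * ρ (p 1 ^ 2) * h2

/-- In the normal form of a germ of corank one the coefficient `b` vanishes at the origin, since the
derivative of the normal form has a kernel there. -/
theorem coeff_zero_of_aEquiv {f : (Fin 2 → ℝ) → (Fin 3 → ℝ)} (hf : SmoothGerm f) (hf0 : f 0 = 0)
    {X Y : Fin 2 → ℝ} (h : IsNullFrame f (fun _ => X) (fun _ => Y)) {b : (Fin 2 → ℝ) → ℝ}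
    (hb : SmoothGerm b) (hfb : AEquiv f (evenForm b)) : b 0 = 0 := by
  obtain ⟨ds, dt, hs, ht, heq⟩ := hfb
  obtain ⟨es, he, -, -⟩ := hs.exists_inverse
  have hpush := h.push hf hf0 (smoothGerm_evenForm hb) hs he ht heq
  have hne : fderiv ℝ ds (es 0) Y ≠ 0 := hpush.linearIndependent.ne_zero 1
  set w := fderiv ℝ ds (es 0) Y
  have hH : SmoothGerm fun p : Fin 2 → ℝ => p 1 * b (fold p) :=
    (SmoothGerm.coord 1).mul hb.comp_fold
  have h1 := (fderiv_graph (((SmoothGerm.coord 1).pow 2).differentiableAt) hH.differentiableAt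
    w).symm.trans hpush.null
  have h2 : w 0 = 0 := by simpa using congrFun h1 0
  have h3 : fderiv ℝ (fun p : Fin 2 → ℝ => p 1 * b (fold p)) 0 w = 0 := by
    simpa using congrFun h1 2
  rw [eq_smul_add_smul w, h2, zero_smul, zero_add, map_smul, (fderiv_odd hb).self_of_nhds,
    fold_zero] at h3
  simp only [Pi.zero_apply, zero_mul, add_zero, smul_eq_mul] at h3
  refine (mul_eq_zero.1 h3).resolve_left fun h4 => hne ?_
  rw [eq_smul_add_smul w, h2, h4]
  simp

/-- Sufficiency of the criteria, with `s = 1` for the `-` germ and `s = -1` for the `+` germ. -/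
theorem aEquiv_cmm {f : (Fin 2 → ℝ) → (Fin 3 → ℝ)} (hf : SmoothGerm f) (hf0 : f 0 = 0)
    (hf1 : fderiv ℝ f 0 ≠ 0) {ξ η : (Fin 2 → ℝ) → (Fin 2 → ℝ)} (h : IsNullFrame f ξ η) {s : ℝ}
    (hs : s ^ 2 = 1) (hq : QSign s (phi ξ η f)) (hT : s = 1 ∨ IsTransversal f (η 0)) :
    AEquiv f (evenForm (cmmCoeff s)) := by
  obtain ⟨G, H, hG, hH, hG0, hH0, hG1, hH1, hfk⟩ := exists_graph hf hf0 hf1 h.const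
  have hk : SmoothGerm fun p => ![p 0, G p, H p] := (SmoothGerm.coord 0).vec3 hG hH
  have hk1 := fderiv_graph_ne_zero hG hH
  have hframe := isNullFrame_graph hG hH hG1 hH1
  have h2 : fderiv ℝ (fun q => fderiv ℝ G q ![0, 1]) 0 ![0, 1] ≠ 0 ∨
      fderiv ℝ (fun q => fderiv ℝ H q ![0, 1]) 0 ![0, 1] ≠ 0 := by
    rcases hT with rfl | hT
    · exact snd_ne_zero_of_qSign hG hH hG1 hH1 (hq.of_aEquiv hf hf0 hf1 hk hk1 hfk h hframe)
    · by_contra! hcon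
      refine hT.of_aEquiv hf hf0 hk hk1 hfk h.const hframe 0 ?_
      rw [(snd_fderiv_graph hG hH).self_of_nhds, hcon.1, hcon.2, map_zero]
      ext i; fin_cases i <;> rfl
  obtain ⟨b, hb, hkb⟩ : ∃ b : (Fin 2 → ℝ) → ℝ, SmoothGerm b ∧ AEquiv f (evenForm b) := by
    rcases h2 with h2 | h2
    · obtain ⟨b, hb, hkb⟩ := exists_evenForm hG hH hG0 hH0 hG1 h2
      exact ⟨b, hb, hfk.trans hkb⟩
    · obtain ⟨b, hb, hkb⟩ := exists_evenForm hH hG hH0 hG0 hH1 h2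
      exact ⟨b, hb, (hfk.trans (AEquiv.swap G H)).trans hkb⟩
  have hb0 := coeff_zero_of_aEquiv hf hf0 h.const hb hkb
  have hqb := hq.of_aEquiv hf hf0 hf1 (smoothGerm_evenForm hb) (fderiv_evenForm_ne_zero hb) hkb h
    (isNullFrame_evenForm hb hb0)
  obtain ⟨hb1, hneg⟩ := evenForm_of_qSign hb hqb hb0
  exact hkb.trans (aEquiv_cmm_of_coeff hb hb0 hb1 hs hneg)

/-- Necessity of the criteria, with `s = 1` for the `-` germ and `s = -1` for the `+` germ. -/
theorem criteria_of_aEquiv_cmm {f : (Fin 2 → ℝ) → (Fin 3 → ℝ)} (hf : SmoothGerm f) (hf0 : f 0 = 0)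
    (hf1 : fderiv ℝ f 0 ≠ 0) {ξ η : (Fin 2 → ℝ) → (Fin 2 → ℝ)} (h : IsNullFrame f ξ η) {s : ℝ}
    (hs : s ^ 2 = 1) (hfs : AEquiv f (evenForm (cmmCoeff s))) :
    QSign s (phi ξ η f) ∧ IsTransversal f (η 0) := by
  have hc := smoothGerm_cmmCoeff s
  have hg := smoothGerm_evenForm hc
  have hframe := isNullFrame_evenForm hc (cmmCoeff_zero s)
  have hsf := hfs.symm hf hf0
  exact ⟨(qSign_cmm hs).of_aEquiv hg evenForm_zero (fderiv_evenForm_ne_zero hc) hf hf1 hsf hframe h,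
    (isTransversal_evenForm hc).of_aEquiv hg evenForm_zero hf hf1 hsf hframe h.const⟩

end MapGerm

open MapGerm in
theorem theorem2p2
    (f : (Fin 2 → ℝ) → (Fin 3 → ℝ)) (hf : MapGerm.IsSmooth f) (hf0 : f 0 = 0)
    (hcorank : MapGerm.IsCorankOne f)
    (ξ η : (Fin 2 → ℝ) → (Fin 2 → ℝ)) (hξ : MapGerm.IsSmooth ξ) (hη : MapGerm.IsSmooth η)
    (hnull : fderiv ℝ f 0 (η 0) = 0) (hindep : LinearIndependent ℝ ![ξ 0, η 0]) :
    (MapGerm.AEquiv f MapGerm.cmmMinus ↔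
      fderiv ℝ (MapGerm.phi ξ η f) 0 = 0 ∧
      0 < (MapGerm.hess (MapGerm.phi ξ η f)).det) ∧
    (MapGerm.AEquiv f MapGerm.cmmPlus ↔
      fderiv ℝ (MapGerm.phi ξ η f) 0 = 0 ∧
      (MapGerm.hess (MapGerm.phi ξ η f)).det < 0 ∧
      LinearIndependent ℝ
        ![MapGerm.dirDeriv ξ f 0, MapGerm.dirDeriv η (MapGerm.dirDeriv η f) 0]) := by
  have hf1 : fderiv ℝ f 0 ≠ 0 := by
    intro h
    rw [IsCorankOne, h, ContinuousLinearMap.toLinearMap_zero, LinearMap.range_zero,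
      finrank_bot] at hcorank
    exact zero_ne_one hcorank
  have h : IsNullFrame f ξ η := ⟨hξ, hη, hnull, hindep⟩
  have hφ : ContDiffAt ℝ 2 (phi ξ η f) 0 :=
    ((SmoothGerm.phiAt hf hξ hη).congr (phi_eventuallyEq hf hη)).contDiffAt.of_le
      (WithTop.coe_le_coe.2 le_top)
  have hφ0 : phi ξ η f 0 = 0 := (phi_eventuallyEq hf hη).self_of_nhds.trans h.phiAt_zero
  have hT := isTransversal_iff hf hf1 h
  constructor
  · rw [cmmMinus_eq]
    have hq := qSign_iff (s := 1) hφ hφ0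
    rw [one_mul] at hq
    rw [← hq]
    exact ⟨fun hA => (criteria_of_aEquiv_cmm hf hf0 hf1 h (one_pow 2) hA).1,
      fun hQ => aEquiv_cmm hf hf0 hf1 h (one_pow 2) hQ (Or.inl rfl)⟩
  · have hq := qSign_iff (s := -1) hφ hφ0
    rw [neg_one_mul, neg_pos] at hq
    rw [cmmPlus_eq, ← hT, ← and_assoc, ← hq]
    exact ⟨fun hA => criteria_of_aEquiv_cmm hf hf0 hf1 h (by norm_num) hA,
      fun hQ => aEquiv_cmm hf hf0 hf1 h (by norm_num) hQ.1 (Or.inr hQ.2)⟩
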